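/- Let $N\ge 1$. For a nonempty open set $\Omega\subset\mathbb{R}^N$ of finite Lebesgue measure $|\Omega|$, let \[ \mu_2(\Omega)=\inf\left\{\frac{\int_\Omega|\nabla u|^2\,dx}{\int_\Omega u^2\,dx}\ :\ u\in W^{1,2}(\Omega)\setminus\{0\},\ \int_\Omega u\,dx=0\right\} \] be its first nontrivial Neumann eigenvalue, and let \[ \mathcal{A}(\Omega)=\inf\left\{\frac{|\Omega\,\Delta\, B'|}{|\Omega|}\ :\ B'\text{ a ball with }|B'|=|\Omega|\right\} \] be its Fraenkel asymmetry. Then there is a constant $\rho_N>0$, depending only on $N$, such that for every nonempty open set $\Omega\subset\mathbb{R}^N$ of finite measure and every open ball $B\subset\mathbb{R}^N$ of positive radius, \[ |B|^{2/N}\,\mu_2(B)-|\Omega|^{2/N}\,\mu_2(\Omega)\ \ge\ \rho_N\,\mathcal{A}(\Omega)^2 . \] Moreover, for $N\ge 2$ one can take \[ \rho_N=(N-1)\,\frac{(2^{1/N}-1)^2}{8\cdot 2^{1/N}}\;\frac{\omega_N^{2/N}\,J_{N/2}(\beta_{N/2,1})^2}{\int_0^1 J_{N/2}(\beta_{N/2,1}\,\varrho)^2\,\varrho\,d\varrho},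 \] which is then positive, where $\omega_N$ is the measure of the unit ball of $\mathbb{R}^N$, $J_{N/2}$ is the Bessel function of the first kind of order $N/2$, and $\beta_{N/2,1}$ is the first positive zero of the derivative of $t\mapsto t^{(2-N)/2}J_{N/2}(t)$ on $(0,\infty)$. -/

import Mathlib

open MeasureTheory
open scoped ContDiff

noncomputable section

namespace SzegoWeinberger

/-- `ℝ^N` with its Euclidean norm and Lebesgue measure. -/
abbrev E (N : ℕ) : Type := EuclideanSpace ℝ (Fin N)

/-- `G` is the weak gradient of `u` in the open set `Ω`: for every `φ ∈ C_c^∞(Ω)` and every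
direction `v`, `∫_Ω u ∂_v φ dx = - ∫_Ω ⟨G, v⟩ φ dx`. -/
def IsWeakGradient {N : ℕ} (Ω : Set (E N)) (u : E N → ℝ) (G : E N → E N) : Prop :=
  ∀ φ : E N → ℝ, ContDiff ℝ ∞ φ → HasCompactSupport φ → tsupport φ ⊆ Ω → ∀ v : E N,
    ∫ x in Ω, u x * fderiv ℝ φ x v = - ∫ x in Ω, inner ℝ (G x) v * φ x

/-- `u ∈ W^{1,2}(Ω)`, with weak gradient `∇u = G`. -/
structure IsSobolev {N : ℕ} (Ω : Set (E N)) (u : E N → ℝ) (G : E N → E N) : Prop where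
  memLp : MemLp u 2 (volume.restrict Ω)
  memLp_grad : MemLp G 2 (volume.restrict Ω)
  weakGradient : IsWeakGradient Ω u G

/-- The first nontrivial Neumann eigenvalue `μ₂(Ω)` of a nonempty open set of finite measure:
the infimum of `∫_Ω |∇u|² / ∫_Ω u²` over the nonzero `u ∈ W^{1,2}(Ω)` with `∫_Ω u = 0`. -/
def mu2 {N : ℕ} (Ω : Set (E N)) : ℝ :=
  sInf {q : ℝ | ∃ (u : E N → ℝ) (G : E N → E N), IsSobolev Ω u G ∧
    ¬ (u =ᵐ[volume.restrict Ω] 0) ∧ ∫ x in Ω, u x = 0 ∧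
    q = (∫ x in Ω, ‖G x‖ ^ 2) / ∫ x in Ω, u x ^ 2}

/-- The Fraenkel asymmetry: the infimum of `|Ω Δ B| / |Ω|` over the balls `B` with `|B| = |Ω|`. -/
def asymmetry {N : ℕ} (Ω : Set (E N)) : ℝ :=
  sInf {a : ℝ | ∃ (x : E N) (r : ℝ), 0 < r ∧ volume (Metric.ball x r) = volume Ω ∧
    a = volume.real (symmDiff Ω (Metric.ball x r)) / volume.real Ω}

/-- The Bessel function of the first kind `J_ν(t)`, for `ν ≥ 0` and `t ≥ 0`, through its
(everywhere absolutely convergent) power series. -/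
def besselJ (ν t : ℝ) : ℝ :=
  ∑' m : ℕ, (-1) ^ m / ((m.factorial : ℝ) * Real.Gamma (m + ν + 1)) *
    (t / 2) ^ (2 * (m : ℝ) + ν)

/-- `β_{N/2,1}`: the first positive zero of the derivative of `t ↦ t^{(2-N)/2} J_{N/2}(t)`. -/
def besselBeta (N : ℕ) : ℝ :=
  sInf {t : ℝ | 0 < t ∧
    deriv (fun s : ℝ => s ^ ((2 - (N : ℝ)) / 2) * besselJ ((N : ℝ) / 2) s) t = 0}

/-- `ω_N`: the measure of the unit ball of `ℝ^N`. -/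
def omega (N : ℕ) : ℝ := volume.real (Metric.ball (0 : E N) 1)

/-- The explicit constant
`ρ_N = (N-1) (2^{1/N}-1)² / (8 · 2^{1/N}) ·
  ω_N^{2/N} J_{N/2}(β_{N/2,1})² / ∫_0^1 J_{N/2}(β_{N/2,1} ϱ)² ϱ dϱ`. -/
def rho (N : ℕ) : ℝ :=
  ((N : ℝ) - 1) * (((2 : ℝ) ^ (1 / (N : ℝ)) - 1) ^ 2 / (8 * (2 : ℝ) ^ (1 / (N : ℝ)))) *
    (omega N ^ (2 / (N : ℝ)) * besselJ ((N : ℝ) / 2) (besselBeta N) ^ 2 /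
      ∫ s in (0 : ℝ)..1, besselJ ((N : ℝ) / 2) (besselBeta N * s) ^ 2 * s)

end SzegoWeinberger

end

namespace SzegoWeinberger

open Filter Topology Set

/-! The inequality compares both sets with the unit ball. Write `κ = profile N`. The functions `⟨x,
e⟩ κ(|x|²)` satisfy the Neumann problem on the unit ball with eigenvalue `β²`, where `β = besselBeta
N`. The proof rests on two estimates: `|B|^{2/N} μ₂(B) ≥ ω^{2/N} β²`, and an upper bound for
`|Ω|^{2/N} μ₂(Ω)` which falls short of `ω^{2/N} β²` by a multiple of the squared asymmetry. The
exact value of `μ₂(B)` is never needed.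

Lower bound on balls (`poincare_unitBall`, `le_mu2_ball`). No spectral theory or separation of
variables is used. A function odd under a hyperplane reflection satisfies the sharp Poincaré
inequality, by Picone's inequality against the eigenfunction vanishing on that hyperplane
(`poincare_of_odd`). The spherical mean `v` of a mean-zero function is handled by duality
(`poincare_radialMean`): `v` is the divergence of a radial field `c x` whose components are odd. If
the optimal constant `I` were smaller than `β²`, then a near-minimiser would have small odd part
under every reflection (`reflection_split`). It would be almost invariant under all isometries,
hence close to its spherical mean, and the radial estimate would give a contradiction. Mollification
carries the inequality over to Sobolev functions.

Upper bound (`exists_centre_mu2_mul_le`). Following Weinberger, the eigenfunctions are extended past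
the unit sphere by a radial factor of constant modulus. After rescaling and translation they have
mean zero on `Ω`; the translation is found by minimising a coercive potential. Summed over the
coordinates, their squares have radially nondecreasing density and their energies radially
nonincreasing density. Rearranging `Ω` into the ball therefore lowers the mass and raises the
energy.

Stability (`integral_energyDensity_le`). If a fraction `a` of the rescaled set lies outside the unit
ball, at least half of that part lies beyond radius `1 + (2^{1/N} - 1) a / 2`, where the energy
density has dropped by a definite amount. This yields a gain of order `a²`, while the asymmetry is
at most `2 a`.

The gain carries a factor `N - 1`, so dimension one is separate (`one_dimensional_bound`): connected
sets are intervals and have no asymmetry, and disconnected sets have vanishing eigenvalue. -/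

/-! ### Bessel functions and the zero `besselBeta`. -/

/-- The entire function `z ↦ ∑ (-1)^m (z/4)^m / (m! Γ(m+ν+1))`, so that
`J_ν(t) = (t/2)^ν * besselEntire ν (t^2)`. -/
noncomputable def besselEntire (ν z : ℝ) : ℝ :=
  ∑' m : ℕ, (-1) ^ m / ((m.factorial : ℝ) * Real.Gamma (m + ν + 1)) * (z / 4) ^ m

lemma gamma_le_gamma_nat_add {ν : ℝ} (hν : 0 ≤ ν) (m : ℕ) :
    Real.Gamma (ν + 1) ≤ Real.Gamma (m + ν + 1) := by
  induction m with
  | zero => simp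
  | succ k ih =>
    have h : ((k + 1 : ℕ) : ℝ) + ν + 1 = (k + ν + 1) + 1 := by push_cast; ring
    rw [h, Real.Gamma_add_one (s := k + ν + 1) (by positivity)]
    have hk : (0 : ℝ) ≤ k := by positivity
    nlinarith [Real.Gamma_pos_of_pos (show (0 : ℝ) < k + ν + 1 by positivity)]

lemma abs_besselEntire_coeff_le {ν : ℝ} (hν : 0 ≤ ν) (m : ℕ) :
    |(-1) ^ m / ((m.factorial : ℝ) * Real.Gamma (m + ν + 1))|
      ≤ (Real.Gamma (ν + 1))⁻¹ / m.factorial := by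
  have h0 : 0 < Real.Gamma (ν + 1) := Real.Gamma_pos_of_pos (by positivity)
  have h1 : 0 < Real.Gamma (m + ν + 1) := Real.Gamma_pos_of_pos (by positivity)
  have h2 : (0 : ℝ) < m.factorial := by positivity
  rw [abs_div, abs_pow, abs_neg, abs_one, one_pow, abs_of_pos (by positivity)]
  rw [div_le_div_iff₀ (by positivity) (by positivity), inv_mul_eq_div, le_div_iff₀ h0]
  nlinarith [gamma_le_gamma_nat_add hν m]

lemma summable_besselEntire {ν : ℝ} (hν : 0 ≤ ν) (z : ℝ) :
    Summable fun m : ℕ ↦ (-1) ^ m / ((m.factorial : ℝ) * Real.Gamma (m + ν + 1)) * (z / 4) ^ m := by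
  refine Summable.of_norm_bounded
    (g := fun m : ℕ ↦ (Real.Gamma (ν + 1))⁻¹ * (|z / 4| ^ m / m.factorial)) ?_ ?_
  · exact (Real.summable_pow_div_factorial _).mul_left _
  · intro m
    rw [norm_mul, Real.norm_eq_abs, norm_pow, Real.norm_eq_abs]
    calc _ ≤ (Real.Gamma (ν + 1))⁻¹ / m.factorial * |z / 4| ^ m :=
          mul_le_mul_of_nonneg_right (abs_besselEntire_coeff_le hν m) (by positivity)
      _ = _ := by ring

lemma hasDerivAt_besselEntire {ν : ℝ} (hν : 0 ≤ ν) (z : ℝ) :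
    HasDerivAt (besselEntire ν) (-besselEntire (ν + 1) z / 4) z := by
  obtain ⟨R, hR⟩ : ∃ R, |z| < R := exists_gt _
  have hR0 : 0 < R := (abs_nonneg z).trans_lt hR
  set c : ℕ → ℝ := fun m ↦ (-1) ^ m / ((m.factorial : ℝ) * Real.Gamma (m + ν + 1)) with hc
  have hcs : ∀ m : ℕ, c (m + 1) * ((m + 1 : ℕ) * (z / 4) ^ m * (1 / 4))
      = (-1 / 4) * ((-1) ^ m / ((m.factorial : ℝ) * Real.Gamma (m + (ν + 1) + 1)) * (z / 4) ^ m) := by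
    intro m
    have h1 : Real.Gamma (m + (ν + 1) + 1) ≠ 0 := (Real.Gamma_pos_of_pos (by positivity)).ne'
    have h2 : ((m + 1 : ℕ) : ℝ) + ν + 1 = m + (ν + 1) + 1 := by push_cast; ring
    have h3 : (m.factorial : ℝ) ≠ 0 := by positivity
    simp only [hc, h2, Nat.factorial_succ, pow_succ]
    push_cast
    field_simp
  have key : HasDerivAt (fun y ↦ ∑' m : ℕ, c m * (y / 4) ^ m)
      (∑' m : ℕ, c m * (m * (z / 4) ^ (m - 1) * (1 / 4))) z := by
    refine hasDerivAt_tsum_of_isPreconnected (𝕜 := ℝ) (g := fun m y ↦ c m * (y / 4) ^ m)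
      (g' := fun m y ↦ c m * (m * (y / 4) ^ (m - 1) * (1 / 4))) (t := Metric.ball (0 : ℝ) R) (y₀ := z)
      (u := fun m : ℕ ↦ (Real.Gamma (ν + 1))⁻¹ * (1 / 4) * (m * (R / 4) ^ (m - 1) / m.factorial))
      ?_ Metric.isOpen_ball (convex_ball (0 : ℝ) R).isPreconnected ?_ ?_ ?_ ?_ ?_
    · refine Summable.mul_left _ ?_
      rw [← summable_nat_add_iff 1]
      refine (Real.summable_pow_div_factorial (R / 4)).congr fun m ↦ ?_
      have h3 : (m.factorial : ℝ) ≠ 0 := by positivity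
      simp only [Nat.factorial_succ, Nat.add_sub_cancel]
      push_cast
      field_simp
    · intro m y _
      have := (((hasDerivAt_id y).div_const 4).pow m).const_mul (c m)
      simpa using this
    · intro m y hy
      have hy' : |y / 4| ≤ R / 4 := by
        rw [abs_div, abs_of_pos (show (0 : ℝ) < 4 by norm_num)]
        have : |y| < R := by simpa using hy
        linarith
      rw [norm_mul, Real.norm_eq_abs, norm_mul, norm_mul, norm_pow, Real.norm_eq_abs (y / 4)]
      calc _ ≤ (Real.Gamma (ν + 1))⁻¹ / m.factorial * (m * (R / 4) ^ (m - 1) * (1 / 4)) := by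
            refine mul_le_mul (abs_besselEntire_coeff_le hν m) ?_ (by positivity)
              (div_nonneg (inv_nonneg.2 (Real.Gamma_pos_of_pos (by positivity)).le) (by positivity))
            simp only [Real.norm_natCast]
            norm_num
            gcongr
        _ = _ := by ring
    · simpa using hR
    · exact summable_besselEntire hν z
    · simpa using hR
  have hsum : ∑' m : ℕ, c m * (m * (z / 4) ^ (m - 1) * (1 / 4)) = -besselEntire (ν + 1) z / 4 := by
    rw [tsum_eq_zero_add']
    · simp only [Nat.cast_zero, zero_mul, mul_zero, zero_add, Nat.add_sub_cancel]
      simp_rw [hcs]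
      rw [tsum_mul_left, besselEntire]
      ring
    · simp only [Nat.add_sub_cancel]
      simp_rw [hcs]
      exact (summable_besselEntire (by linarith) z).mul_left _
  rw [← hsum]
  exact key

lemma contDiff_besselEntire {ν : ℝ} (hν : 0 ≤ ν) {n : ℕ∞} : ContDiff ℝ n (besselEntire ν) := by
  suffices h : ∀ n : ℕ, ∀ ν : ℝ, 0 ≤ ν → ContDiff ℝ n (besselEntire ν) by
    have h' : ContDiff ℝ ∞ (besselEntire ν) := contDiff_infty.2 fun n ↦ h n ν hν
    exact h'.of_le (by exact_mod_cast le_top)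
  intro n
  induction n with
  | zero =>
    intro ν hν
    exact contDiff_zero.2 (continuous_iff_continuousAt.2 fun z ↦
      (hasDerivAt_besselEntire hν z).continuousAt)
  | succ n ih =>
    intro ν hν
    rw [show ((n + 1 : ℕ) : WithTop ℕ∞) = (n : WithTop ℕ∞) + 1 by norm_cast,
      contDiff_succ_iff_deriv]
    refine ⟨fun z ↦ (hasDerivAt_besselEntire hν z).differentiableAt, by simp, ?_⟩
    have : deriv (besselEntire ν) = fun z ↦ -besselEntire (ν + 1) z / 4 :=
      funext fun z ↦ (hasDerivAt_besselEntire hν z).deriv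
    rw [this]
    exact (ih (ν + 1) (by linarith)).neg.div_const 4

/-- Together with the derivative formula, this is Bessel's differential equation. Coefficients are
compared after shifting one of the series by one, using the functional equation of the Gamma
function. -/
lemma besselEntire_recurrence {ν : ℝ} (hν : 0 ≤ ν) (z : ℝ) :
    besselEntire ν z = (ν + 1) * besselEntire (ν + 1) z - z / 4 * besselEntire (ν + 2) z := by
  have h1 := summable_besselEntire (show 0 ≤ ν + 1 by linarith) z
  have h2 := summable_besselEntire (show 0 ≤ ν + 2 by linarith) z
  have h0 := summable_besselEntire hν z
  unfold besselEntire
  rw [← tsum_mul_left, ← tsum_mul_left, h0.tsum_eq_zero_add, (h1.mul_left _).tsum_eq_zero_add,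
    add_sub_assoc, ← Summable.tsum_sub ((summable_nat_add_iff 1).2 (h1.mul_left _)) (h2.mul_left _)]
  congr 1
  · have hg : Real.Gamma (ν + 1) ≠ 0 := (Real.Gamma_pos_of_pos (by positivity)).ne'
    have e : Real.Gamma (ν + 1 + 1) = (ν + 1) * Real.Gamma (ν + 1) :=
      Real.Gamma_add_one (by positivity)
    simp [e]
    field_simp
  · refine tsum_congr fun m ↦ ?_
    have hg : Real.Gamma (m + ν + 2) ≠ 0 := (Real.Gamma_pos_of_pos (by positivity)).ne'
    have e1 : ((m + 1 : ℕ) : ℝ) + ν + 1 = m + ν + 2 := by push_cast; ring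
    have e2 : ((m + 1 : ℕ) : ℝ) + (ν + 1) + 1 = (m + ν + 2) + 1 := by push_cast; ring
    have e3 : (m : ℝ) + (ν + 2) + 1 = (m + ν + 2) + 1 := by ring
    have e4 : (m : ℝ) + ν + 2 ≠ 0 := by positivity
    rw [e1, e2, e3, Real.Gamma_add_one e4, Nat.factorial_succ, pow_succ, pow_succ]
    have h3 : (m.factorial : ℝ) ≠ 0 := by positivity
    push_cast
    field_simp
    ring

lemma besselEntire_zero_pos {ν : ℝ} (hν : 0 ≤ ν) : 0 < besselEntire ν 0 := by
  have : besselEntire ν 0 = (Real.Gamma (ν + 1))⁻¹ := by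
    unfold besselEntire
    rw [tsum_eq_single 0]
    · simp
    · intro m hm; simp [hm]
  rw [this]
  exact inv_pos.2 (Real.Gamma_pos_of_pos (by positivity))

lemma besselJ_eq {ν t : ℝ} (ht : 0 < t) :
    besselJ ν t = (t / 2) ^ ν * besselEntire ν (t ^ 2) := by
  unfold besselJ besselEntire
  rw [← tsum_mul_left]
  refine tsum_congr fun m ↦ ?_
  rw [Real.rpow_add (by positivity), show (2 : ℝ) * (m : ℝ) = ((2 * m : ℕ) : ℝ) by push_cast; ring,
    Real.rpow_natCast, pow_mul, show (t / 2) ^ 2 = t ^ 2 / 4 by ring]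
  ring

/-- The derivative of `t ↦ t * besselEntire (N/2) (t^2)`. -/
noncomputable def besselSlope (N : ℕ) (t : ℝ) : ℝ :=
  besselEntire (N / 2) (t ^ 2) - t ^ 2 / 2 * besselEntire (N / 2 + 1) (t ^ 2)

lemma hasDerivAt_besselEntire_sq {ν : ℝ} (hν : 0 ≤ ν) (t : ℝ) :
    HasDerivAt (fun t : ℝ ↦ besselEntire ν (t ^ 2)) (-(t / 2) * besselEntire (ν + 1) (t ^ 2)) t := by
  have h := (hasDerivAt_besselEntire hν (t ^ 2)).comp t (hasDerivAt_pow 2 t)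
  refine h.congr_deriv ?_
  push_cast
  ring

lemma hasDerivAt_mul_besselEntire_sq (N : ℕ) (t : ℝ) :
    HasDerivAt (fun t : ℝ ↦ t * besselEntire (N / 2) (t ^ 2)) (besselSlope N t) t := by
  have h := (hasDerivAt_id t).mul (hasDerivAt_besselEntire_sq (ν := N / 2) (by positivity) t)
  refine h.congr_deriv ?_
  simp only [besselSlope, id]
  ring

lemma hasDerivAt_besselSlope (N : ℕ) (t : ℝ) :
    HasDerivAt (besselSlope N)
      (t * ((N / 2 - 1 / 2) * besselEntire (N / 2 + 1) (t ^ 2) - besselEntire (N / 2) (t ^ 2))) t := by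
  have hν : (0 : ℝ) ≤ N / 2 := by positivity
  have h := (hasDerivAt_besselEntire_sq hν t).sub (((hasDerivAt_pow 2 t).div_const 2).mul
    (hasDerivAt_besselEntire_sq (ν := N / 2 + 1) (by positivity) t))
  refine h.congr_deriv ?_
  rw [besselEntire_recurrence hν (t ^ 2), show (N / 2 + 1 + 1 : ℝ) = N / 2 + 2 by ring]
  push_cast
  ring

lemma continuous_besselSlope (N : ℕ) : Continuous (besselSlope N) :=
  continuous_iff_continuousAt.2 fun t ↦ (hasDerivAt_besselSlope N t).continuousAt

lemma besselSlope_zero_pos (N : ℕ) : 0 < besselSlope N 0 := by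
  simpa [besselSlope] using besselEntire_zero_pos (ν := N / 2) (by positivity)

/-- For `t > 0`, `t^{(2-N)/2} J_{N/2}(t)` equals `2^{-N/2} t * besselEntire (N/2) (t²)`, whose
derivative is a positive multiple of `besselSlope`. The point `t = 0` can be admitted because the
slope is positive there; this makes the set closed, so its infimum is attained. -/
lemma besselBeta_set_eq (N : ℕ) :
    {t : ℝ | 0 < t ∧
      deriv (fun s : ℝ => s ^ ((2 - (N : ℝ)) / 2) * besselJ ((N : ℝ) / 2) s) t = 0}
      = {t : ℝ | 0 ≤ t ∧ besselSlope N t = 0} := by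
  ext t
  simp only [mem_ofPred_eq]
  have key : ∀ t : ℝ, 0 < t →
      deriv (fun s : ℝ => s ^ ((2 - (N : ℝ)) / 2) * besselJ ((N : ℝ) / 2) s) t
        = (2 : ℝ) ^ (-((N : ℝ) / 2)) * besselSlope N t := by
    intro t ht
    have h := (hasDerivAt_mul_besselEntire_sq N t).const_mul ((2 : ℝ) ^ (-((N : ℝ) / 2)))
    rw [← h.deriv]
    refine EventuallyEq.deriv_eq ?_
    filter_upwards [lt_mem_nhds ht] with s hs
    rw [besselJ_eq hs, Real.div_rpow hs.le (by norm_num), Real.rpow_neg (by norm_num),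
      show (2 - (N : ℝ)) / 2 = 1 - N / 2 by ring, Real.rpow_sub hs, Real.rpow_one]
    have : s ^ ((N : ℝ) / 2) ≠ 0 := (Real.rpow_pos_of_pos hs _).ne'
    field_simp
  constructor
  · rintro ⟨ht, h⟩
    rw [key t ht] at h
    exact ⟨ht.le, (mul_eq_zero.1 h).resolve_left (by positivity)⟩
  · rintro ⟨ht, h⟩
    have ht' : 0 < t := lt_of_le_of_ne ht fun h0 ↦ by
      rw [← h0] at h; exact (besselSlope_zero_pos N).ne' h
    exact ⟨ht', by rw [key t ht', h, mul_zero]⟩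

lemma besselSlope_pos_of_forall_ne {N : ℕ} {b : ℝ}
    (h : ∀ t, 0 ≤ t → t < b → besselSlope N t ≠ 0) {t : ℝ} (ht : 0 ≤ t) (htb : t < b) :
    0 < besselSlope N t := by
  by_contra! hneg
  obtain ⟨s, hs, hs0⟩ := intermediate_value_Icc' ht (continuous_besselSlope N).continuousOn
    ⟨hneg, (besselSlope_zero_pos N).le⟩
  exact h s hs.1 (hs.2.trans_lt htb) hs0

lemma mul_besselEntire_sq_pos {N : ℕ} {b : ℝ}
    (h : ∀ t, 0 ≤ t → t < b → 0 < besselSlope N t) {t : ℝ} (ht : 0 < t) (htb : t ≤ b) :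
    0 < t * besselEntire (N / 2) (t ^ 2) := by
  have hm : StrictMonoOn (fun t : ℝ ↦ t * besselEntire (N / 2) (t ^ 2)) (Icc 0 t) := by
    refine strictMonoOn_of_deriv_pos (convex_Icc _ _)
      (continuous_iff_continuousAt.2 fun s ↦
        (hasDerivAt_mul_besselEntire_sq N s).continuousAt).continuousOn ?_
    intro s hs
    rw [interior_Icc] at hs
    rw [(hasDerivAt_mul_besselEntire_sq N s).deriv]
    exact h s hs.1.le (hs.2.trans_le htb)
  simpa using hm (left_mem_Icc.2 ht.le) (right_mem_Icc.2 ht.le) ht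

/-- Without a zero, `p t = t * besselEntire (N/2) (t²)` would increase forever. By Bessel's equation
its slope would then decrease at least linearly, and could not stay positive. -/
lemma exists_besselSlope_eq_zero (N : ℕ) [NeZero N] : ∃ t, 0 ≤ t ∧ besselSlope N t = 0 := by
  by_contra! hne
  have hpos : ∀ t, 0 ≤ t → 0 < besselSlope N t := fun t ht ↦
    besselSlope_pos_of_forall_ne (b := t + 1) (fun s hs _ ↦ hne s hs) ht (by linarith)
  set p : ℝ → ℝ := fun t ↦ t * besselEntire (N / 2) (t ^ 2) with hp
  have hmono : MonotoneOn p (Ici 0) := by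
    refine monotoneOn_of_deriv_nonneg (convex_Ici _)
      (continuous_iff_continuousAt.2 fun s ↦
        (hasDerivAt_mul_besselEntire_sq N s).continuousAt).continuousOn
      (fun s _ ↦ (hasDerivAt_mul_besselEntire_sq N s).differentiableAt.differentiableWithinAt) ?_
    intro s hs
    rw [interior_Ici] at hs
    rw [(hasDerivAt_mul_besselEntire_sq N s).deriv]
    exact (hpos s (le_of_lt hs)).le
  -- From here on `t² ≥ 2 N`, so in `t p'' = (N - 1)(F - p') - t² F`, with `F = p / t`, half of the
  -- last term absorbs the first one.
  set t₀ : ℝ := 2 * N + 1 with ht₀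
  have hN : (0 : ℝ) ≤ N := by positivity
  have ht₀1 : 1 ≤ t₀ := by linarith
  have hp0 : 0 < p t₀ := mul_besselEntire_sq_pos (b := t₀) (fun s hs _ ↦ hpos s hs)
    (by linarith) le_rfl
  have hslope : ∀ t, t₀ ≤ t →
      t * ((N / 2 - 1 / 2) * besselEntire (N / 2 + 1) (t ^ 2) - besselEntire (N / 2) (t ^ 2))
        ≤ -(p t₀ / 2) := by
    intro t ht
    have ht1 : 0 < t := by linarith
    have h1 : p t₀ ≤ p t := hmono (by simp; linarith) (by simp; linarith) ht
    have h2 := hpos t ht1.le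
    have hHpos : 0 < besselEntire (N / 2) (t ^ 2) := by
      have : 0 < t * besselEntire (N / 2) (t ^ 2) := hp0.trans_le h1
      exact pos_of_mul_pos_right this ht1.le
    have ht2 : 2 * (N : ℝ) ≤ t ^ 2 := by nlinarith
    have hH1 : t ^ 2 * besselEntire (N / 2 + 1) (t ^ 2)
        = 2 * (besselEntire (N / 2) (t ^ 2) - besselSlope N t) := by
      simp only [besselSlope]; ring
    refine le_trans ?_ (by linarith : -(p t / 2) ≤ -(p t₀ / 2))
    simp only [hp]
    rw [← mul_le_mul_iff_right₀ ht1]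
    have e : t * (t * ((N / 2 - 1 / 2) * besselEntire (N / 2 + 1) (t ^ 2)
          - besselEntire (N / 2) (t ^ 2)))
        = (N / 2 - 1 / 2) * (2 * (besselEntire (N / 2) (t ^ 2) - besselSlope N t))
          - t ^ 2 * besselEntire (N / 2) (t ^ 2) := by
      rw [← hH1]; ring
    rw [e]
    have hN1 : (1 : ℝ) ≤ N := by exact_mod_cast NeZero.one_le
    nlinarith
  have hbound : ∀ t, t₀ ≤ t → besselSlope N t - besselSlope N t₀ ≤ -(p t₀ / 2) * (t - t₀) := by
    intro t ht
    refine (convex_Ici t₀).image_sub_le_mul_sub_of_deriv_le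
      (continuous_besselSlope N).continuousOn
      (fun s _ ↦ (hasDerivAt_besselSlope N s).differentiableAt.differentiableWithinAt)
      (fun s hs ↦ ?_) t₀ (by simp) t (by simpa using ht) ht
    rw [interior_Ici] at hs
    rw [(hasDerivAt_besselSlope N s).deriv]
    exact hslope s (le_of_lt hs)
  have h1 := hpos t₀ (by linarith)
  -- The abscissa at which the line of slope `-(p t₀ / 2)` started from `besselSlope N t₀` reaches
  -- zero.
  have h2 := hbound (t₀ + 2 * besselSlope N t₀ / p t₀) (by
    have := div_pos (mul_pos two_pos h1) hp0
    linarith)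
  have h3 := hpos (t₀ + 2 * besselSlope N t₀ / p t₀) (by
    have := div_pos (mul_pos two_pos h1) hp0
    linarith)
  have h4 : -(p t₀ / 2) * (t₀ + 2 * besselSlope N t₀ / p t₀ - t₀) = -besselSlope N t₀ := by
    field_simp
    ring
  rw [h4] at h2
  linarith

lemma besselBeta_mem (N : ℕ) [NeZero N] : 0 ≤ besselBeta N ∧ besselSlope N (besselBeta N) = 0 := by
  have hcl : IsClosed {t : ℝ | 0 ≤ t ∧ besselSlope N t = 0} :=
    (isClosed_le continuous_const continuous_id).inter
      (isClosed_eq (continuous_besselSlope N) continuous_const)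
  rw [besselBeta, besselBeta_set_eq]
  exact hcl.csInf_mem (exists_besselSlope_eq_zero N) ⟨0, fun t ht ↦ ht.1⟩

lemma besselBeta_pos (N : ℕ) [NeZero N] : 0 < besselBeta N := by
  refine lt_of_le_of_ne (besselBeta_mem N).1 fun h ↦ ?_
  have := (besselBeta_mem N).2
  rw [← h] at this
  exact (besselSlope_zero_pos N).ne' this

lemma besselSlope_pos {N : ℕ} [NeZero N] {t : ℝ} (ht : 0 ≤ t) (htb : t < besselBeta N) :
    0 < besselSlope N t := by
  refine besselSlope_pos_of_forall_ne (fun s hs hsb h0 ↦ ?_) ht htb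
  refine hsb.not_ge ?_
  rw [besselBeta, besselBeta_set_eq]
  exact csInf_le ⟨0, fun t ht ↦ ht.1⟩ ⟨hs, h0⟩

/-! ### The radial profile of the eigenfunctions. -/

/-- The radial profile `κ`: the functions `x_i κ(|x|²)` are Neumann eigenfunctions of the unit
ball with eigenvalue `β²`. -/
noncomputable def profile (N : ℕ) (s : ℝ) : ℝ := besselEntire (N / 2) (besselBeta N ^ 2 * s)

/-- The derivative of `profile`. -/
noncomputable def profileD (N : ℕ) (s : ℝ) : ℝ :=
  -(besselBeta N ^ 2 / 4) * besselEntire (N / 2 + 1) (besselBeta N ^ 2 * s)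

/-- The second derivative of `profile`. -/
noncomputable def profileDD (N : ℕ) (s : ℝ) : ℝ :=
  besselBeta N ^ 4 / 16 * besselEntire (N / 2 + 2) (besselBeta N ^ 2 * s)

lemma hasDerivAt_profile (N : ℕ) (s : ℝ) : HasDerivAt (profile N) (profileD N s) s := by
  have h := (hasDerivAt_besselEntire (ν := N / 2) (by positivity) (besselBeta N ^ 2 * s)).comp s
    ((hasDerivAt_id s).const_mul (besselBeta N ^ 2))
  refine h.congr_deriv ?_
  simp only [profileD]; ring

lemma hasDerivAt_profileD (N : ℕ) (s : ℝ) : HasDerivAt (profileD N) (profileDD N s) s := by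
  have h := ((hasDerivAt_besselEntire (ν := N / 2 + 1) (by positivity)
    (besselBeta N ^ 2 * s)).comp s ((hasDerivAt_id s).const_mul (besselBeta N ^ 2))).const_mul
      (-(besselBeta N ^ 2 / 4))
  refine h.congr_deriv ?_
  simp only [profileDD, show (N / 2 + 1 + 1 : ℝ) = N / 2 + 2 by ring]; ring

lemma contDiff_profile (N : ℕ) {n : ℕ∞} : ContDiff ℝ n (profile N) :=
  (contDiff_besselEntire (ν := N / 2) (by positivity)).comp (contDiff_const.mul contDiff_id)

lemma contDiff_profileD (N : ℕ) {n : ℕ∞} : ContDiff ℝ n (profileD N) :=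
  contDiff_const.mul
    ((contDiff_besselEntire (ν := N / 2 + 1) (by positivity)).comp (contDiff_const.mul contDiff_id))

lemma profile_ode (N : ℕ) (s : ℝ) :
    4 * s * profileDD N s + 2 * (N + 2) * profileD N s + besselBeta N ^ 2 * profile N s = 0 := by
  simp only [profile, profileD, profileDD]
  rw [besselEntire_recurrence (ν := N / 2) (by positivity)]
  ring

/-- At `s = r²` the left side is the derivative of `r κ(r²)` in `r`. Hence `r κ(r²)` increases up to
`r = 1`, where its derivative vanishes: this is the Neumann condition. -/
lemma profile_add_eq_slope {N : ℕ} {s : ℝ} (hs : 0 ≤ s) :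
    profile N s + 2 * s * profileD N s = besselSlope N (besselBeta N * √s) := by
  simp only [profile, profileD, besselSlope, mul_pow, Real.sq_sqrt hs]
  ring

lemma profile_add_nonneg {N : ℕ} [NeZero N] {s : ℝ} (hs : 0 ≤ s) (hs1 : s ≤ 1) :
    0 ≤ profile N s + 2 * s * profileD N s := by
  rw [profile_add_eq_slope hs]
  have h1 : √s ≤ 1 := Real.sqrt_le_one.2 hs1
  have h2 : besselBeta N * √s ≤ besselBeta N := mul_le_of_le_one_right (besselBeta_pos N).le h1
  rcases h2.lt_or_eq with h | h
  · exact (besselSlope_pos (mul_nonneg (besselBeta_pos N).le (Real.sqrt_nonneg s)) h).le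
  · rw [h, (besselBeta_mem N).2]

lemma profile_add_one (N : ℕ) [NeZero N] : profile N 1 + 2 * profileD N 1 = 0 := by
  have := profile_add_eq_slope (N := N) (s := 1) zero_le_one
  simpa [(besselBeta_mem N).2] using this

lemma profile_pos {N : ℕ} [NeZero N] {s : ℝ} (hs : 0 ≤ s) (hs1 : s ≤ 1) : 0 < profile N s := by
  rcases hs.eq_or_lt with rfl | hs0
  · simpa [profile] using besselEntire_zero_pos (ν := N / 2) (by positivity)
  · have hb := besselBeta_pos N
    have h := mul_besselEntire_sq_pos (b := besselBeta N) (fun t ht htb ↦ besselSlope_pos ht htb)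
      (t := besselBeta N * √s) (by positivity)
      (mul_le_of_le_one_right hb.le (Real.sqrt_le_one.2 hs1))
    rw [mul_pow, Real.sq_sqrt hs] at h
    exact pos_of_mul_pos_right h (by positivity)

lemma besselJ_besselBeta_mul {N : ℕ} [NeZero N] {s : ℝ} (hs : 0 < s) :
    besselJ (N / 2) (besselBeta N * s) = (besselBeta N / 2) ^ ((N : ℝ) / 2) * s ^ ((N : ℝ) / 2)
      * profile N (s ^ 2) := by
  have hb := besselBeta_pos N
  rw [besselJ_eq (by positivity), profile, mul_pow, mul_div_right_comm,
    Real.mul_rpow (by positivity) hs.le]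

/-! ### Divergence theorem on the unit ball. -/

open Metric

variable {N : ℕ}

/-- The divergence of a vector field on `ℝ^N`. -/
noncomputable def divg (Y : E N → E N) (x : E N) : ℝ :=
  ∑ i, fderiv ℝ Y x (EuclideanSpace.single i 1) i

lemma hasFDerivAt_apply {Y : E N → E N} {x : E N} {Y' : E N →L[ℝ] E N} (h : HasFDerivAt Y Y' x)
    (i : Fin N) :
    HasFDerivAt (fun y ↦ Y y i) ((EuclideanSpace.proj i : E N →L[ℝ] ℝ) ∘L Y') x :=
  (EuclideanSpace.proj i : E N →L[ℝ] ℝ).hasFDerivAt.comp x h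

lemma sum_clm_single_mul (l : E N →L[ℝ] ℝ) (v : E N) :
    ∑ i, l (EuclideanSpace.single i 1) * v i = l v := by
  conv_rhs => rw [← (EuclideanSpace.basisFun (Fin N) ℝ).sum_repr v]
  simp [mul_comm]

lemma divg_smul {φ : E N → ℝ} {Y : E N → E N} {x : E N} (hφ : DifferentiableAt ℝ φ x)
    (hY : DifferentiableAt ℝ Y x) :
    divg (fun y ↦ φ y • Y y) x = φ x * divg Y x + fderiv ℝ φ x (Y x) := by
  have h := (hφ.hasFDerivAt.smul hY.hasFDerivAt).fderiv
  simp only [divg]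
  erw [h]
  simp only [add_apply, smul_apply,
    ContinuousLinearMap.smulRight_apply, PiLp.add_apply, PiLp.smul_apply, smul_eq_mul,
    Finset.sum_add_distrib, ← Finset.mul_sum, sum_clm_single_mul]

lemma divg_add {Y Z : E N → E N} {x : E N} (hY : DifferentiableAt ℝ Y x)
    (hZ : DifferentiableAt ℝ Z x) :
    divg (fun y ↦ Y y + Z y) x = divg Y x + divg Z x := by
  simp only [divg]
  rw [fderiv_fun_add hY hZ]
  simp [Finset.sum_add_distrib]

lemma divg_id (x : E N) : divg (fun y ↦ y) x = N := by
  simp [divg]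

lemma divg_const (v x : E N) : divg (fun _ ↦ v) x = 0 := by
  simp [divg]

lemma continuous_divg {Y : E N → E N} (hY : ContDiff ℝ 1 Y) : Continuous (divg Y) := by
  have h := hY.continuous_fderiv (by norm_num)
  unfold divg
  refine continuous_finsetSum _ fun i _ ↦ ?_
  exact (EuclideanSpace.proj i : E N →L[ℝ] ℝ).continuous.comp (h.clm_apply continuous_const)

lemma _root_.Continuous.integrableOn_ball {F : Type*} [NormedAddCommGroup F] {f : E N → F}
    (hf : Continuous f) {x : E N} {r : ℝ} : IntegrableOn f (ball x r) :=
  (hf.continuousOn.integrableOn_compact (isCompact_closedBall x r)).mono_set ball_subset_closedBall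

/-- Each component is integrated by parts against the constant function `1`. -/
lemma integral_divg_of_hasCompactSupport {Y : E N → E N} (hY : ContDiff ℝ 1 Y)
    (hc : HasCompactSupport Y) : ∫ x, divg Y x = 0 := by
  have hd : ∀ i, ContDiff ℝ 1 fun x ↦ Y x i := fun i ↦
    (EuclideanSpace.proj i : E N →L[ℝ] ℝ).contDiff.comp hY
  have hci : ∀ i, HasCompactSupport fun x ↦ Y x i := fun i ↦
    hc.comp_left (g := fun y : E N ↦ y i) rfl
  have hcont : ∀ i, Continuous fun x ↦ fderiv ℝ (fun x ↦ Y x i) x (EuclideanSpace.single i 1) :=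
    fun i ↦ ((hd i).continuous_fderiv (by norm_num)).clm_apply continuous_const
  have hint : ∀ i, Integrable fun x ↦ fderiv ℝ (fun x ↦ Y x i) x (EuclideanSpace.single i 1) :=
    fun i ↦ (hcont i).integrable_of_hasCompactSupport ((hci i).fderiv_apply ℝ _)
  have e : ∀ x, divg Y x = ∑ i, fderiv ℝ (fun x ↦ Y x i) x (EuclideanSpace.single i 1) := by
    intro x
    refine Finset.sum_congr rfl fun i _ ↦ ?_
    rw [(hasFDerivAt_apply ((hY.differentiable (by norm_num)) x).hasFDerivAt i).fderiv]
    rfl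
  simp_rw [e]
  rw [integral_finsetSum _ fun i _ ↦ hint i]
  refine Finset.sum_eq_zero fun i _ ↦ ?_
  have := integral_mul_fderiv_eq_neg_fderiv_mul_of_integrable (μ := (volume : Measure (E N)))
    (f := fun _ ↦ (1 : ℝ)) (g := fun x ↦ Y x i) (v := EuclideanSpace.single i 1)
    (by simp) (by simpa using hint i)
    (by simpa using (hd i).continuous.integrable_of_hasCompactSupport (hci i))
    (fun _ _ ↦ differentiableAt_const _) (fun x _ ↦ ((hd i).differentiable (by norm_num)) x)
  simpa using this

lemma exists_bound_deriv_smoothTransition : ∃ M, 0 ≤ M ∧ ∀ t, |deriv Real.smoothTransition t| ≤ M := by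
  have hc : Continuous (deriv Real.smoothTransition) :=
    (Real.smoothTransition.contDiff (n := 1)).continuous_deriv le_rfl
  obtain ⟨M, hM⟩ := isCompact_Icc.exists_bound_of_continuousOn (s := Icc (0 : ℝ) 1) hc.continuousOn
  refine ⟨M, (norm_nonneg _).trans (hM 0 (by simp)), fun t ↦ ?_⟩
  by_cases ht : t ∈ Icc (0 : ℝ) 1
  · exact hM t ht
  have h0 : deriv Real.smoothTransition t = 0 := by
    rcases le_or_gt t 0 with h | h
    · refine IsLocalMin.deriv_eq_zero (Eventually.of_forall fun s ↦ ?_)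
      rw [Real.smoothTransition.zero_of_nonpos h]
      exact Real.smoothTransition.nonneg s
    · have : 1 ≤ t := by by_contra! h1; exact ht ⟨h.le, h1.le⟩
      refine IsLocalMax.deriv_eq_zero (Eventually.of_forall fun s ↦ ?_)
      rw [Real.smoothTransition.one_of_one_le this]
      exact Real.smoothTransition.le_one s
  rw [h0, abs_zero]
  exact (norm_nonneg _).trans (hM 0 (by simp))

lemma deriv_smoothTransition_of_one_le {t : ℝ} (h : 1 ≤ t) : deriv Real.smoothTransition t = 0 := by
  refine IsLocalMax.deriv_eq_zero (Eventually.of_forall fun s ↦ ?_)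
  rw [Real.smoothTransition.one_of_one_le h]
  exact Real.smoothTransition.le_one s

lemma deriv_smoothTransition_of_nonpos {t : ℝ} (h : t ≤ 0) : deriv Real.smoothTransition t = 0 := by
  refine IsLocalMin.deriv_eq_zero (Eventually.of_forall fun s ↦ ?_)
  rw [Real.smoothTransition.zero_of_nonpos h]
  exact Real.smoothTransition.nonneg s

/-- A `C^1` function vanishing on the unit sphere is bounded by the distance to it. -/
lemma exists_le_mul_one_sub_norm {L : E N → ℝ} (hL : ContDiff ℝ 1 L)
    (h0 : L 0 = 0) (h1 : ∀ x, ‖x‖ = 1 → L x = 0) :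
    ∃ C, 0 ≤ C ∧ ∀ x, ‖x‖ ≤ 1 → |L x| ≤ C * (1 - ‖x‖) := by
  have hc : Continuous (fderiv ℝ L) := hL.continuous_fderiv (by norm_num)
  obtain ⟨C, hC⟩ := (isCompact_closedBall (0 : E N) 1).exists_bound_of_continuousOn hc.continuousOn
  have hC0 : 0 ≤ C := (norm_nonneg _).trans (hC 0 (by simp))
  refine ⟨C, hC0, fun x hx ↦ ?_⟩
  rcases eq_or_ne x 0 with rfl | hx0
  · simpa [h0] using hC0
  have hxn : ‖x‖ ≠ 0 := norm_ne_zero_iff.2 hx0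
  have hy : ‖‖x‖⁻¹ • x‖ = 1 := by
    rw [norm_smul, norm_inv, norm_norm, inv_mul_cancel₀ hxn]
  have h := (convex_closedBall (0 : E N) 1).norm_image_sub_le_of_norm_fderiv_le (𝕜 := ℝ)
    (fun y _ ↦ (hL.differentiable (by norm_num)) y) hC (x := ‖x‖⁻¹ • x) (y := x)
    (by simp [hy]) (by simpa using hx)
  rw [h1 _ hy, sub_zero] at h
  refine h.trans (mul_le_mul_of_nonneg_left ?_ hC0)
  have : x - ‖x‖⁻¹ • x = (1 - ‖x‖⁻¹) • x := by rw [sub_smul, one_smul]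
  rw [this, norm_smul, Real.norm_eq_abs, ← abs_of_nonneg (norm_nonneg x), ← abs_mul, abs_norm,
    sub_mul, inv_mul_cancel₀ hxn, one_mul, abs_sub_comm, abs_of_nonneg (by linarith)]

/-- The divergence theorem on the unit ball for a tangential vector field. -/
lemma integral_divg_ball_eq_zero {Y : E N → E N} (hY : ContDiff ℝ 1 Y)
    (hb : ∀ x, ‖x‖ = 1 → inner ℝ (Y x) x = 0) : ∫ x in ball (0 : E N) 1, divg Y x = 0 := by
  obtain ⟨M, hM0, hM⟩ := exists_bound_deriv_smoothTransition
  obtain ⟨C, hC0, hC⟩ := exists_le_mul_one_sub_norm (L := fun x ↦ inner ℝ (Y x) x)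
    (hY.inner ℝ contDiff_id) (by simp) hb
  obtain ⟨D, hD⟩ := (isCompact_closedBall (0 : E N) 1).exists_bound_of_continuousOn
    (continuous_divg hY).continuousOn
  -- Cutoffs vanishing outside the ball, with transition layer of width of order `1 / n`. Their
  -- gradients are of size `n`, but tangency makes `⟨Y, x⟩` at most `C (1 - |x|)`, so the commutator
  -- term stays bounded.
  set χ : ℕ → E N → ℝ := fun n x ↦ Real.smoothTransition ((n + 1) * (1 - ‖x‖ ^ 2)) with hχ
  have hχd : ∀ n x, HasFDerivAt (χ n)
      ((deriv Real.smoothTransition ((n + 1) * (1 - ‖x‖ ^ 2)) * (-2 * (n + 1))) • innerSL ℝ x) x := by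
    intro n x
    have h1 : HasFDerivAt (fun x : E N ↦ ((n : ℝ) + 1) * (1 - ‖x‖ ^ 2))
        (((n : ℝ) + 1) • (-((2 : ℕ) • innerSL ℝ x : E N →L[ℝ] ℝ))) x :=
      ((hasStrictFDerivAt_norm_sq x).hasFDerivAt.const_sub 1).const_mul _
    have h2 := ((Real.smoothTransition.contDiff (n := 1)).differentiable (by norm_num)
      (((n : ℝ) + 1) * (1 - ‖x‖ ^ 2))).hasDerivAt.comp_hasFDerivAt x h1
    refine h2.congr_fderiv ?_
    ext v
    simp
    ring
  have hχc : ∀ n, ContDiff ℝ 1 (χ n) := fun n ↦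
    Real.smoothTransition.contDiff.comp (contDiff_const.mul (contDiff_const.sub (contDiff_norm_sq ℝ)))
  have hχ0 : ∀ n x, 1 ≤ ‖x‖ → χ n x = 0 := fun n x hx ↦
    Real.smoothTransition.zero_of_nonpos
      (mul_nonpos_of_nonneg_of_nonpos (by positivity) (by nlinarith))
  have hYd : Differentiable ℝ Y := hY.differentiable (by norm_num)
  have hdiv : ∀ n x, divg (fun y ↦ χ n y • Y y) x = χ n x * divg Y x
      + deriv Real.smoothTransition ((n + 1) * (1 - ‖x‖ ^ 2)) * (-2 * (n + 1)) * inner ℝ (Y x) x := by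
    intro n x
    rw [divg_smul (hχd n x).differentiableAt (hYd x), (hχd n x).fderiv]
    simp [real_inner_comm]
  have hzero : ∀ n, ∫ x in ball (0 : E N) 1, divg (fun y ↦ χ n y • Y y) x = 0 := by
    intro n
    rw [setIntegral_eq_integral_of_forall_compl_eq_zero]
    · refine integral_divg_of_hasCompactSupport ((hχc n).smul hY) ?_
      refine HasCompactSupport.intro (isCompact_closedBall (0 : E N) 1) fun x hx ↦ ?_
      rw [hχ0 n x, zero_smul]
      simpa using le_of_not_ge (by simpa using hx : ¬ ‖x‖ ≤ 1)
    · intro x hx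
      have hx1 : 1 ≤ ‖x‖ := by simpa using hx
      rw [hdiv, hχ0 n x hx1, deriv_smoothTransition_of_nonpos]
      · simp
      · exact mul_nonpos_of_nonneg_of_nonpos (by positivity) (by nlinarith)
  have hlim : Tendsto (fun n : ℕ ↦ ∫ x in ball (0 : E N) 1, divg (fun y ↦ χ n y • Y y) x) atTop
      (𝓝 (∫ x in ball (0 : E N) 1, divg Y x)) := by
    refine tendsto_integral_of_dominated_convergence (fun _ ↦ D + 2 * M * C) ?_ ?_ ?_ ?_
    · exact fun n ↦ (continuous_divg ((hχc n).smul hY)).aestronglyMeasurable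
    · exact continuous_const.integrableOn_ball
    · intro n
      refine (ae_restrict_iff' measurableSet_ball).2 (Eventually.of_forall fun x hx ↦ ?_)
      have hx1 : ‖x‖ < 1 := by simpa using hx
      rw [hdiv]
      refine (norm_add_le _ _).trans (add_le_add ?_ ?_)
      · rw [norm_mul]
        have h1 : ‖χ n x‖ ≤ 1 := by
          rw [Real.norm_eq_abs, abs_of_nonneg (Real.smoothTransition.nonneg _)]
          exact Real.smoothTransition.le_one _
        have := hD x (ball_subset_closedBall hx)
        nlinarith [norm_nonneg (divg Y x), norm_nonneg (χ n x)]
      -- Either the cutoff has already saturated and its derivative is zero, or `(n + 1)(1 - |x|) ≤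
      -- 1`, which compensates the factor `n + 1`.
      · rcases le_or_gt 1 (((n : ℝ) + 1) * (1 - ‖x‖ ^ 2)) with h1 | h1
        · rw [deriv_smoothTransition_of_one_le h1]
          simp; positivity
        · rw [norm_mul, norm_mul, Real.norm_eq_abs, Real.norm_eq_abs, Real.norm_eq_abs]
          have e : |-2 * ((n : ℝ) + 1)| = 2 * (n + 1) := by
            rw [abs_mul, abs_of_nonneg (show (0 : ℝ) ≤ n + 1 by positivity)]; norm_num
          rw [e]
          have h2 : ((n : ℝ) + 1) * (1 - ‖x‖) ≤ 1 := by
            refine le_trans ?_ h1.le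
            gcongr
            nlinarith [norm_nonneg x]
          calc _ ≤ M * (2 * ((n : ℝ) + 1)) * (C * (1 - ‖x‖)) := by
                gcongr
                · exact hM _
                · exact hC x hx1.le
            _ = 2 * M * C * (((n : ℝ) + 1) * (1 - ‖x‖)) := by ring
            _ ≤ 2 * M * C * 1 := by gcongr
            _ = _ := mul_one _
    · refine (ae_restrict_iff' measurableSet_ball).2 (Eventually.of_forall fun x hx ↦ ?_)
      have hx1 : ‖x‖ < 1 := by simpa using hx
      have hpos : 0 < 1 - ‖x‖ ^ 2 := by nlinarith [norm_nonneg x]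
      obtain ⟨n₀, hn₀⟩ := exists_nat_gt (1 / (1 - ‖x‖ ^ 2))
      refine tendsto_const_nhds.congr' ?_
      filter_upwards [eventually_ge_atTop n₀] with n hn
      have h1 : 1 ≤ ((n : ℝ) + 1) * (1 - ‖x‖ ^ 2) := by
        rw [div_lt_iff₀ hpos] at hn₀
        have : (n₀ : ℝ) ≤ n := by exact_mod_cast hn
        nlinarith
      rw [hdiv, deriv_smoothTransition_of_one_le h1]
      simp only [hχ, Real.smoothTransition.one_of_one_le h1]
      ring
  simp_rw [hzero] at hlim
  exact (tendsto_nhds_unique hlim tendsto_const_nhds)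

/-! ### Picone's inequality and the eigenfunctions of the ball. -/

/-- **Picone's inequality** on the unit ball, with comparison function `ψ` of gradient `V`. -/
lemma picone_ball {lam C : ℝ} {ψ w : E N → ℝ} {V : E N → E N}
    (hψ : ∀ x, HasFDerivAt ψ (innerSL ℝ (V x)) x) (hV : ContDiff ℝ 1 V)
    (hdiv : ∀ x, divg V x = -lam * ψ x) (hb : ∀ x, ‖x‖ = 1 → inner ℝ (V x) x = 0)
    (hw : ContDiff ℝ 1 w) (hC : ∀ x ∈ ball (0 : E N) 1, w x ^ 2 ≤ C * ψ x ^ 2)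
    (hne : ∀ᵐ x, x ∈ ball (0 : E N) 1 → ψ x ≠ 0) :
    lam * ∫ x in ball (0 : E N) 1, w x ^ 2 ≤ ∫ x in ball (0 : E N) 1, ‖fderiv ℝ w x‖ ^ 2 := by
  have hψc : ContDiff ℝ 1 ψ := by
    refine contDiff_one_iff_fderiv.2 ⟨fun x ↦ (hψ x).differentiableAt, ?_⟩
    rw [funext fun x ↦ (hψ x).fderiv]
    exact (innerSL ℝ).continuous.comp hV.continuous
  -- The lower bound produced by the regularised field `w² ψ / (ψ² + δ) V` with `δ = 1 / (n + 1)`.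
  -- The usual Picone field `(w² / ψ) V` is singular on the zero set of `ψ`.
  set f : ℕ → E N → ℝ := fun n x ↦ lam * (w x ^ 2 * (ψ x ^ 2 / (ψ x ^ 2 + 1 / (n + 1))))
    - w x ^ 2 * ((1 / (n + 1)) / (ψ x ^ 2 + 1 / (n + 1)) ^ 2) * ‖V x‖ ^ 2 with hf
  have hδ : ∀ n : ℕ, (0 : ℝ) < 1 / (n + 1) := fun n ↦ by positivity
  have hden : ∀ (n : ℕ) x, ψ x ^ 2 + 1 / ((n : ℝ) + 1) ≠ 0 := fun n x ↦ by
    have := hδ n; positivity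
  have hfc : ∀ n, Continuous (f n) := by
    intro n
    have h1 := hw.continuous
    have h2 := hψc.continuous
    have h3 := hV.continuous
    refine (continuous_const.mul ((h1.pow 2).mul ((h2.pow 2).div ((h2.pow 2).add
      continuous_const) (hden n)))).sub (((h1.pow 2).mul (continuous_const.div
        (((h2.pow 2).add continuous_const).pow 2) fun x ↦ pow_ne_zero 2 (hden n x))).mul
          (h3.norm.pow 2))
  have hwc : Continuous (fun x ↦ ‖fderiv ℝ w x‖ ^ 2) :=
    (hw.continuous_fderiv (by norm_num)).norm.pow 2
  have hle : ∀ n, ∫ x in ball (0 : E N) 1, f n x ≤ ∫ x in ball (0 : E N) 1, ‖fderiv ℝ w x‖ ^ 2 := by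
    intro n
    set δ : ℝ := 1 / ((n : ℝ) + 1) with hδd
    have ha : ContDiff ℝ 1 fun x ↦ w x ^ 2 * ψ x / (ψ x ^ 2 + δ) :=
      ((hw.pow 2).mul hψc).div ((hψc.pow 2).add contDiff_const) (hden n)
    have hY : ContDiff ℝ 1 fun x ↦ (w x ^ 2 * ψ x / (ψ x ^ 2 + δ)) • V x := ha.smul hV
    have h0 := integral_divg_ball_eq_zero hY fun x hx ↦ by rw [inner_smul_left, hb x hx, mul_zero]
    have hda : ∀ x, fderiv ℝ (fun x ↦ w x ^ 2 * ψ x / (ψ x ^ 2 + δ)) x (V x)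
        = 2 * (w x * ψ x / (ψ x ^ 2 + δ)) * fderiv ℝ w x (V x)
          + w x ^ 2 * ((δ - ψ x ^ 2) / (ψ x ^ 2 + δ) ^ 2) * ‖V x‖ ^ 2 := by
      intro x
      have hwx := ((hw.differentiable (by norm_num)) x).hasFDerivAt
      have hd := hden n x
      rw [← hδd] at hd
      have h := ((hwx.pow 2).mul (hψ x)).mul
        ((hasDerivAt_inv hd).comp_hasFDerivAt x (((hψ x).pow 2).add_const δ))
      have h' := h.fderiv
      simp only [div_eq_mul_inv (_ * _) (_ + δ)]
      erw [h']
      simp only [smul_apply, add_apply, smul_eq_mul, innerSL_apply_apply,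
        real_inner_self_eq_norm_sq]
      simp
      field_simp
      ring
    rw [← sub_nonneg, ← integral_sub hwc.integrableOn_ball (hfc n).integrableOn_ball]
    rw [← h0]
    refine integral_mono (continuous_divg hY).integrableOn_ball
      (hwc.sub (hfc n)).integrableOn_ball fun x ↦ ?_
    have hd := hden n x
    rw [← hδd] at hd
    beta_reduce
    rw [divg_smul (ha.differentiable (by norm_num) x) (hV.differentiable (by norm_num) x),
      hda, hdiv]
    simp only [hf, ← hδd]
    have h1 : |fderiv ℝ w x (V x)| ≤ ‖fderiv ℝ w x‖ * ‖V x‖ := (fderiv ℝ w x).le_opNorm _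
    -- Young's inequality: the difference between the two sides is at least the square `(|∇w| - |w ψ
    -- / (ψ² + δ)| |V|)²`.
    have h2 : 2 * (w x * ψ x / (ψ x ^ 2 + δ)) * fderiv ℝ w x (V x)
        ≤ ‖fderiv ℝ w x‖ ^ 2 + (w x * ψ x / (ψ x ^ 2 + δ)) ^ 2 * ‖V x‖ ^ 2 := by
      have h3 : (w x * ψ x / (ψ x ^ 2 + δ)) * fderiv ℝ w x (V x)
          ≤ |w x * ψ x / (ψ x ^ 2 + δ)| * (‖fderiv ℝ w x‖ * ‖V x‖) := by
        refine (le_abs_self _).trans ?_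
        rw [abs_mul]
        gcongr
      rw [← sq_abs (w x * ψ x / (ψ x ^ 2 + δ))]
      nlinarith [sq_nonneg (‖fderiv ℝ w x‖ - |w x * ψ x / (ψ x ^ 2 + δ)| * ‖V x‖)]
    have h4 : w x ^ 2 * ψ x / (ψ x ^ 2 + δ) * (-lam * ψ x)
        = -(lam * (w x ^ 2 * (ψ x ^ 2 / (ψ x ^ 2 + δ)))) := by ring
    have h5 : w x ^ 2 * ((δ - ψ x ^ 2) / (ψ x ^ 2 + δ) ^ 2) * ‖V x‖ ^ 2
        + (w x * ψ x / (ψ x ^ 2 + δ)) ^ 2 * ‖V x‖ ^ 2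
        = w x ^ 2 * (δ / (ψ x ^ 2 + δ) ^ 2) * ‖V x‖ ^ 2 := by
      field_simp
      ring
    linarith
  have hlim : Tendsto (fun n ↦ ∫ x in ball (0 : E N) 1, f n x) atTop
      (𝓝 (∫ x in ball (0 : E N) 1, lam * w x ^ 2)) := by
    -- The bound `w² ≤ C ψ²` serves here only: it keeps the error term `w² δ / (ψ² + δ)² |V|²` below
    -- `|C| |V|²`. That term tends to zero wherever `ψ ≠ 0`.
    refine tendsto_integral_of_dominated_convergence
      (fun x ↦ |lam| * w x ^ 2 + |C| * ‖V x‖ ^ 2) (fun n ↦ (hfc n).aestronglyMeasurable) ?_ ?_ ?_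
    · exact ((continuous_const.mul (hw.continuous.pow 2)).add
        (continuous_const.mul (hV.continuous.norm.pow 2))).integrableOn_ball
    · intro n
      refine (ae_restrict_iff' measurableSet_ball).2 (Eventually.of_forall fun x hx ↦ ?_)
      have hd := hδ n
      set δ : ℝ := 1 / ((n : ℝ) + 1) with hδd
      simp only [hf, ← hδd]
      refine (norm_sub_le _ _).trans (add_le_add ?_ ?_)
      · have h0 : 0 ≤ w x ^ 2 * (ψ x ^ 2 / (ψ x ^ 2 + δ)) := by positivity
        rw [norm_mul, Real.norm_eq_abs, Real.norm_eq_abs, abs_of_nonneg h0]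
        gcongr
        refine mul_le_of_le_one_right (by positivity) ?_
        rw [div_le_one (by positivity)]
        linarith
      · rw [Real.norm_eq_abs, abs_of_nonneg (by positivity)]
        gcongr
        rw [mul_div_assoc', div_le_iff₀ (by positivity)]
        have h1 := hC x hx
        have h2 : C * ψ x ^ 2 ≤ |C| * ψ x ^ 2 := by gcongr; exact le_abs_self C
        calc w x ^ 2 * δ ≤ |C| * ψ x ^ 2 * δ := by gcongr; exact h1.trans h2
          _ = |C| * (ψ x ^ 2 * δ) := by ring
          _ ≤ _ := by
            gcongr
            nlinarith [sq_nonneg (ψ x ^ 2), sq_nonneg δ, mul_nonneg (sq_nonneg (ψ x)) hd.le]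
    · refine (ae_restrict_iff' measurableSet_ball).2 ?_
      filter_upwards [hne] with x hx hxB
      replace hx := hx hxB
      have hlim0 : Tendsto (fun n : ℕ ↦ 1 / ((n : ℝ) + 1)) atTop (𝓝 0) :=
        tendsto_one_div_add_atTop_nhds_zero_nat
      have hx2 : ψ x ^ 2 ≠ 0 := pow_ne_zero 2 hx
      have hs : Tendsto (fun n : ℕ ↦ ψ x ^ 2 + 1 / ((n : ℝ) + 1)) atTop (𝓝 (ψ x ^ 2)) := by
        simpa using hlim0.const_add (ψ x ^ 2)
      have h1 : Tendsto (fun n : ℕ ↦ lam * (w x ^ 2 * (ψ x ^ 2 / (ψ x ^ 2 + 1 / ((n : ℝ) + 1)))))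
          atTop (𝓝 (lam * (w x ^ 2 * (ψ x ^ 2 / ψ x ^ 2)))) :=
        ((tendsto_const_nhds.div hs hx2).const_mul _).const_mul _
      have h2 : Tendsto (fun n : ℕ ↦ w x ^ 2 * ((1 / ((n : ℝ) + 1))
          / (ψ x ^ 2 + 1 / ((n : ℝ) + 1)) ^ 2) * ‖V x‖ ^ 2)
          atTop (𝓝 (w x ^ 2 * (0 / (ψ x ^ 2) ^ 2) * ‖V x‖ ^ 2)) :=
        ((hlim0.div (hs.pow 2) (pow_ne_zero 2 hx2)).const_mul _).mul_const _
      have := h1.sub h2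
      rw [div_self hx2, zero_div, mul_zero, zero_mul, sub_zero, mul_one] at this
      exact this
  rw [integral_const_mul] at hlim
  exact le_of_tendsto' hlim hle

/-- The Neumann eigenfunction `⟨x, e⟩ κ(|x|²)` of the unit ball. -/
noncomputable def eigenfun (e x : E N) : ℝ := inner ℝ x e * profile N (‖x‖ ^ 2)

/-- The gradient of `eigenfun e`. -/
noncomputable def eigenGrad (e x : E N) : E N :=
  profile N (‖x‖ ^ 2) • e + (2 * profileD N (‖x‖ ^ 2) * inner ℝ x e) • x

lemma hasFDerivAt_comp_norm_sq {f : ℝ → ℝ} {f' : ℝ} {x : E N} (hf : HasDerivAt f f' (‖x‖ ^ 2)) :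
    HasFDerivAt (fun y : E N ↦ f (‖y‖ ^ 2)) ((2 * f') • innerSL ℝ x) x := by
  have h := hf.comp_hasFDerivAt x (hasStrictFDerivAt_norm_sq x).hasFDerivAt
  refine h.congr_fderiv ?_
  ext v
  simp
  ring

lemma hasFDerivAt_inner_right (e x : E N) :
    HasFDerivAt (fun y : E N ↦ inner ℝ y e) (innerSL ℝ e) x := by
  have := (innerSL ℝ e).hasFDerivAt (x := x)
  refine this.congr_of_eventuallyEq (Eventually.of_forall fun y ↦ ?_)
  simp [real_inner_comm]

lemma hasFDerivAt_eigenfun (e x : E N) :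
    HasFDerivAt (eigenfun e) (innerSL ℝ (eigenGrad e x)) x := by
  have h := (hasFDerivAt_inner_right e x).mul (hasFDerivAt_comp_norm_sq (hasDerivAt_profile N _))
  refine h.congr_fderiv ?_
  ext v
  simp [eigenGrad]
  ring

lemma contDiff_eigenGrad (e : E N) : ContDiff ℝ 1 (eigenGrad e) := by
  unfold eigenGrad
  have h1 : ContDiff ℝ 1 fun x : E N ↦ profile N (‖x‖ ^ 2) :=
    (contDiff_profile N (n := 1)).comp (contDiff_norm_sq ℝ)
  have h2 : ContDiff ℝ 1 fun x : E N ↦ profileD N (‖x‖ ^ 2) :=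
    (contDiff_profileD N (n := 1)).comp (contDiff_norm_sq ℝ)
  exact (h1.smul contDiff_const).add
    (((contDiff_const.mul h2).mul (contDiff_id.inner ℝ contDiff_const)).smul contDiff_id)

lemma divg_eigenGrad (e x : E N) :
    divg (eigenGrad e) x = -besselBeta N ^ 2 * eigenfun e x := by
  have h1 := hasFDerivAt_comp_norm_sq (x := x) (hasDerivAt_profile N (‖x‖ ^ 2))
  have h2 := ((hasFDerivAt_comp_norm_sq (x := x) (hasDerivAt_profileD N (‖x‖ ^ 2))).const_mul
    2).mul (hasFDerivAt_inner_right e x)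
  have d1 : DifferentiableAt ℝ (fun y : E N ↦ profile N (‖y‖ ^ 2) • e) x :=
    h1.differentiableAt.smul (differentiableAt_const _)
  have d2 : DifferentiableAt ℝ (fun y : E N ↦ 2 * profileD N (‖y‖ ^ 2) * inner ℝ y e) x :=
    h2.differentiableAt
  have d3 : DifferentiableAt ℝ
      (fun y : E N ↦ (2 * profileD N (‖y‖ ^ 2) * inner ℝ y e) • y) x :=
    d2.smul differentiableAt_id
  unfold eigenGrad
  rw [divg_add d1 d3,
    divg_smul h1.differentiableAt (differentiableAt_const _),
    divg_smul d2 differentiableAt_fun_id, divg_const, divg_id, h1.fderiv]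
  erw [h2.fderiv]
  simp [eigenfun]
  have := profile_ode N (‖x‖ ^ 2)
  rw [real_inner_comm x e]
  linear_combination (inner ℝ x e) * this

lemma inner_eigenGrad [NeZero N] (e : E N) {x : E N} (hx : ‖x‖ = 1) :
    inner ℝ (eigenGrad e x) x = 0 := by
  have := profile_add_one N
  simp only [eigenGrad, hx, one_pow, inner_add_left, inner_smul_left, real_inner_self_eq_norm_sq,
    conj_trivial, real_inner_comm x e]
  linear_combination (inner ℝ x e) * this

/-! ### Hyperplane reflections, odd functions and even–odd splitting. -/

lemma ae_inner_ne_zero {e : E N} (he : e ≠ 0) : ∀ᵐ x : E N, inner ℝ x e ≠ 0 := by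
  have h : (ℝ ∙ e)ᗮ ≠ ⊤ := by
    intro h
    have : e ∈ (ℝ ∙ e)ᗮ := h ▸ Submodule.mem_top
    exact he (inner_self_eq_zero.1 (Submodule.mem_orthogonal_singleton_iff_inner_right.1 this))
  refine measure_mono_null (fun x hx ↦ ?_) (Measure.addHaar_submodule volume _ h)
  simp only [mem_compl_iff, mem_ofPred_eq, not_not] at hx
  exact Submodule.mem_orthogonal_singleton_iff_inner_left.2 hx

/-- The reflection in the hyperplane orthogonal to `e`. -/
noncomputable abbrev hyperplaneReflection (e : E N) : E N ≃ₗᵢ[ℝ] E N := (ℝ ∙ e)ᗮ.reflection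

lemma hyperplaneReflection_apply (e x : E N) :
    hyperplaneReflection e x = x - (2 * (inner ℝ x e / ‖e‖ ^ 2)) • e := by
  rw [Submodule.reflection_orthogonal_apply, Submodule.reflection_singleton_apply,
    real_inner_comm, mul_smul, two_smul, two_smul]
  simp

/-- A function that is odd under a reflection satisfies the sharp inequality. -/
lemma poincare_of_odd [NeZero N] {w : E N → ℝ} (hw : ContDiff ℝ 1 w) {e : E N} (he : e ≠ 0)
    (hodd : ∀ x, w (hyperplaneReflection e x) = -w x) :
    besselBeta N ^ 2 * ∫ x in ball (0 : E N) 1, w x ^ 2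
      ≤ ∫ x in ball (0 : E N) 1, ‖fderiv ℝ w x‖ ^ 2 := by
  obtain ⟨s₀, hs₀, hmin⟩ := isCompact_Icc.exists_isMinOn (s := Icc (0 : ℝ) 1) ⟨0, by simp⟩
    (contDiff_profile N (n := 1)).continuous.continuousOn
  have hc0 : 0 < profile N s₀ := profile_pos hs₀.1 hs₀.2
  have hc : Continuous (fderiv ℝ w) := hw.continuous_fderiv (by norm_num)
  obtain ⟨L, hL⟩ := (isCompact_closedBall (0 : E N) 1).exists_bound_of_continuousOn hc.continuousOn
  have hL0 : 0 ≤ L := (norm_nonneg _).trans (hL 0 (by simp))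
  have hen : 0 < ‖e‖ := norm_pos_iff.2 he
  have hmem : ∀ x ∈ ball (0 : E N) 1, ‖x‖ ^ 2 ∈ Icc (0 : ℝ) 1 := by
    intro x hx
    have : ‖x‖ < 1 := by simpa using hx
    exact ⟨by positivity, by nlinarith [norm_nonneg x]⟩
  -- The comparison function is `⟨x, e⟩ κ(|x|²)`. In the ball it vanishes exactly on the mirror,
  -- where `w` vanishes by oddness. `C` is the square of the Lipschitz bound of `w` divided by `‖e‖`
  -- and the minimum of `κ`.
  refine picone_ball (C := (L / (‖e‖ * profile N s₀)) ^ 2) (hasFDerivAt_eigenfun e)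
    (contDiff_eigenGrad e) (divg_eigenGrad e) (fun x hx ↦ inner_eigenGrad e hx) hw ?_ ?_
  · intro x hx
    have hx1 : ‖x‖ < 1 := by simpa using hx
    have h := (convex_closedBall (0 : E N) 1).norm_image_sub_le_of_norm_fderiv_le (𝕜 := ℝ)
      (fun y _ ↦ (hw.differentiable (by norm_num)) y) hL (x := hyperplaneReflection e x) (y := x)
      (by simpa using hx1.le) (by simpa using hx1.le)
    -- Oddness turns the increment of `w` between `σ x` and `x` into `2 w x`, while the two points
    -- differ by `2 (⟨x, e⟩ / ‖e‖²) e`.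
    rw [hodd, hyperplaneReflection_apply, sub_sub_cancel, sub_neg_eq_add, ← two_mul, norm_mul,
      norm_smul, norm_mul, Real.norm_ofNat, norm_div, norm_pow, norm_norm] at h
    have h1 : |w x| ≤ L * (|inner ℝ x e| / ‖e‖) := by
      have e1 : L * (2 * (‖inner ℝ x e‖ / ‖e‖ ^ 2) * ‖e‖) = 2 * (L * (|inner ℝ x e| / ‖e‖)) := by
        rw [Real.norm_eq_abs]; field_simp
      rw [e1, Real.norm_eq_abs] at h
      linarith
    have h2 : |inner ℝ x e| * profile N s₀ ≤ |eigenfun e x| := by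
      rw [eigenfun, abs_mul]
      gcongr
      exact (hmin (hmem x hx)).trans (le_abs_self _)
    have h3 : |w x| ≤ L / (‖e‖ * profile N s₀) * |eigenfun e x| := by
      refine h1.trans ?_
      calc L * (|inner ℝ x e| / ‖e‖)
          = L / (‖e‖ * profile N s₀) * (|inner ℝ x e| * profile N s₀) := by field_simp
        _ ≤ _ := by gcongr
    rw [← sq_abs (w x), ← sq_abs (eigenfun e x), ← mul_pow]
    gcongr
  · filter_upwards [ae_inner_ne_zero he] with x hx hxB
    exact mul_ne_zero hx (profile_pos (hmem x hxB).1 (hmem x hxB).2).ne'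

lemma setIntegral_ball_comp_isometry {F : Type*} [NormedAddCommGroup F] [NormedSpace ℝ F]
    (σ : E N ≃ₗᵢ[ℝ] E N) (f : E N → F) (r : ℝ) :
    ∫ x in ball (0 : E N) r, f (σ x) = ∫ x in ball (0 : E N) r, f x := by
  have h := σ.measurePreserving.setIntegral_preimage_emb
    σ.toHomeomorph.measurableEmbedding f (ball (0 : E N) r)
  rw [← h]
  congr 2
  ext x
  simp

lemma norm_fderiv_comp_isometry {u : E N → ℝ} (hu : Differentiable ℝ u)
    (σ : E N ≃ₗᵢ[ℝ] E N) (x : E N) :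
    ‖fderiv ℝ (fun y ↦ u (σ y)) x‖ = ‖fderiv ℝ u (σ x)‖ := by
  have h : fderiv ℝ (fun y ↦ u (σ y)) x
      = (fderiv ℝ u (σ x)).comp (σ.toContinuousLinearEquiv : E N →L[ℝ] E N) :=
    ((hu (σ x)).hasFDerivAt.comp x σ.toContinuousLinearEquiv.hasFDerivAt).fderiv
  rw [h]
  exact ContinuousLinearMap.opNorm_comp_linearIsometryEquiv _ σ

lemma dual_parallelogram (l m : E N →L[ℝ] ℝ) :
    ‖l + m‖ ^ 2 + ‖l - m‖ ^ 2 = 2 * (‖l‖ ^ 2 + ‖m‖ ^ 2) := by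
  set φ := (InnerProductSpace.toDual ℝ (E N)).symm
  have h := parallelogram_law_with_norm ℝ (φ l) (φ m)
  rw [← map_add, ← map_sub] at h
  simp only [LinearIsometryEquiv.norm_map] at h
  nlinarith

/-- The Dirichlet energy splits along the even and odd parts under a reflection. -/
lemma reflection_split [NeZero N] {u : E N → ℝ} (hu : ContDiff ℝ 1 u) {e : E N} (he : e ≠ 0)
    {I : ℝ} (hI : ∀ w : E N → ℝ, ContDiff ℝ 1 w → ∫ x in ball (0 : E N) 1, w x = 0 →
      I * ∫ x in ball (0 : E N) 1, w x ^ 2 ≤ ∫ x in ball (0 : E N) 1, ‖fderiv ℝ w x‖ ^ 2)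
    (hmean : ∫ x in ball (0 : E N) 1, u x = 0) :
    I * (∫ x in ball (0 : E N) 1, u x ^ 2) + (besselBeta N ^ 2 - I) / 4 *
        (∫ x in ball (0 : E N) 1, (u x - u (hyperplaneReflection e x)) ^ 2)
      ≤ ∫ x in ball (0 : E N) 1, ‖fderiv ℝ u x‖ ^ 2 := by
  set σ := hyperplaneReflection e with hσ
  have hud : Differentiable ℝ u := hu.differentiable (by norm_num)
  have hus : ContDiff ℝ 1 fun x ↦ u (σ x) := hu.comp σ.contDiff
  have husd : Differentiable ℝ fun x ↦ u (σ x) := hus.differentiable (by norm_num)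
  have hσσ : ∀ x, σ (σ x) = x := Submodule.reflection_reflection _
  set P : E N → ℝ := fun x ↦ u x + u (σ x) with hP
  set Q : E N → ℝ := fun x ↦ u x - u (σ x) with hQ
  have hPc : ContDiff ℝ 1 P := hu.add hus
  have hQc : ContDiff ℝ 1 Q := hu.sub hus
  have hsq : ∀ {w : E N → ℝ}, ContDiff ℝ 1 w → IntegrableOn (fun x ↦ w x ^ 2) (ball 0 1) :=
    fun hw ↦ (hw.continuous.pow 2).integrableOn_ball
  have hPm : ∫ x in ball (0 : E N) 1, P x = 0 := by
    rw [integral_add hu.continuous.integrableOn_ball hus.continuous.integrableOn_ball,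
      setIntegral_ball_comp_isometry σ u, hmean, add_zero]
  -- The even part only has the constant `I` available; the odd part has the full `β²`. The two
  -- energies add up because the reflection is an isometry.
  have h1 := hI P hPc hPm
  have h2 := poincare_of_odd hQc he fun x ↦ by simp only [hQ, ← hσ, hσσ]; ring
  have n1 : ∫ x in ball (0 : E N) 1, P x ^ 2
      = 4 * (∫ x in ball (0 : E N) 1, u x ^ 2) - ∫ x in ball (0 : E N) 1, Q x ^ 2 := by
    have e1 : ∫ x in ball (0 : E N) 1, u x ^ 2 + u (σ x) ^ 2
        = 2 * ∫ x in ball (0 : E N) 1, u x ^ 2 := by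
      rw [integral_add (hsq hu) (hsq hus),
        setIntegral_ball_comp_isometry σ (fun x ↦ u x ^ 2)]
      ring
    have e2 : ∫ x in ball (0 : E N) 1, P x ^ 2 + Q x ^ 2
        = 2 * ∫ x in ball (0 : E N) 1, u x ^ 2 + u (σ x) ^ 2 := by
      rw [← integral_const_mul]
      refine integral_congr_ae (Eventually.of_forall fun x ↦ ?_)
      simp only [hP, hQ]; ring
    rw [integral_add (hsq hPc) (hsq hQc)] at e2
    linarith
  have hD : ∀ {w : E N → ℝ}, ContDiff ℝ 1 w →
      Continuous fun x ↦ ‖fderiv ℝ w x‖ ^ 2 := fun hw ↦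
    (hw.continuous_fderiv (by norm_num)).norm.pow 2
  have n2 : (∫ x in ball (0 : E N) 1, ‖fderiv ℝ P x‖ ^ 2)
        + ∫ x in ball (0 : E N) 1, ‖fderiv ℝ Q x‖ ^ 2
      = 4 * ∫ x in ball (0 : E N) 1, ‖fderiv ℝ u x‖ ^ 2 := by
    have e1 : ∫ x in ball (0 : E N) 1, ‖fderiv ℝ u x‖ ^ 2 + ‖fderiv ℝ (fun y ↦ u (σ y)) x‖ ^ 2
        = 2 * ∫ x in ball (0 : E N) 1, ‖fderiv ℝ u x‖ ^ 2 := by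
      rw [integral_add (hD hu).integrableOn_ball (hD hus).integrableOn_ball]
      simp_rw [norm_fderiv_comp_isometry hud σ]
      rw [setIntegral_ball_comp_isometry σ (fun x ↦ ‖fderiv ℝ u x‖ ^ 2)]
      ring
    rw [← integral_add (hD hPc).integrableOn_ball (hD hQc).integrableOn_ball]
    have e2 : ∀ x, ‖fderiv ℝ P x‖ ^ 2 + ‖fderiv ℝ Q x‖ ^ 2
        = 2 * (‖fderiv ℝ u x‖ ^ 2 + ‖fderiv ℝ (fun y ↦ u (σ y)) x‖ ^ 2) := by
      intro x
      rw [hP, hQ, fderiv_fun_add (hud x) (husd x), fderiv_fun_sub (hud x) (husd x)]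
      exact dual_parallelogram _ _
    simp_rw [e2]
    rw [integral_const_mul, e1]
    ring
  rw [n1] at h1
  linarith

/-! ### Integrals depending on a linear parameter. -/

section ParametricIntegral

variable {Y : Type*} [TopologicalSpace Y] [MeasurableSpace Y] [OpensMeasurableSpace Y] [T2Space Y]
  {μ : Measure Y} [IsLocallyFiniteMeasure μ] {s : Set Y}
  {ρ : Y → ℝ} {A : Y → E N →L[ℝ] E N} {u : E N → ℝ}

lemma hasFDerivAt_integral_comp_clm (hs : IsCompact s) (hsm : MeasurableSet s)
    (hρ : Continuous ρ) (hA : Continuous A) (hu : ContDiff ℝ 1 u) (x : E N) :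
    HasFDerivAt (fun x ↦ ∫ y in s, ρ y * u (A y x) ∂μ)
      (∫ y in s, ρ y • (fderiv ℝ u (A y x)).comp (A y) ∂μ) x := by
  have hDu : Continuous (fderiv ℝ u) := hu.continuous_fderiv (by norm_num)
  have hev : Continuous fun p : E N × Y ↦ A p.2 p.1 := (hA.comp continuous_snd).clm_apply continuous_fst
  have hF : Continuous fun p : E N × Y ↦ ρ p.2 * u (A p.2 p.1) :=
    (hρ.comp continuous_snd).mul (hu.continuous.comp hev)
  have hF' : Continuous fun p : E N × Y ↦ ρ p.2 • (fderiv ℝ u (A p.2 p.1)).comp (A p.2) :=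
    (hρ.comp continuous_snd).smul ((hDu.comp hev).clm_comp (hA.comp continuous_snd))
  obtain ⟨C, hC⟩ := ((isCompact_closedBall x 1).prod hs).exists_bound_of_continuousOn hF'.continuousOn
  refine hasFDerivAt_integral_of_dominated_of_fderiv_le (𝕜 := ℝ) (s := closedBall x 1)
    (bound := fun _ ↦ C) (F' := fun x y ↦ ρ y • (fderiv ℝ u (A y x)).comp (A y))
    (closedBall_mem_nhds x one_pos) ?_ ?_ ?_ ?_ ?_ ?_
  · exact Eventually.of_forall fun z ↦
      (hF.comp (Continuous.prodMk_right z)).aestronglyMeasurable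
  · exact (hF.comp (Continuous.prodMk_right x)).continuousOn.integrableOn_compact hs
  · exact (hF'.comp (Continuous.prodMk_right x)).aestronglyMeasurable
  · exact (ae_restrict_iff' hsm).2 (Eventually.of_forall fun y hy z hz ↦ hC (z, y) ⟨hz, hy⟩)
  · exact continuousOn_const.integrableOn_compact hs
  · refine Eventually.of_forall fun y z _ ↦ ?_
    exact (((hu.differentiable (by norm_num)) (A y z)).hasFDerivAt.comp z
      (A y).hasFDerivAt).const_mul (ρ y)

lemma contDiff_integral_comp_clm (hs : IsCompact s) (hsm : MeasurableSet s)
    (hρ : Continuous ρ) (hA : Continuous A) (hu : ContDiff ℝ 1 u) :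
    ContDiff ℝ 1 fun x ↦ ∫ y in s, ρ y * u (A y x) ∂μ := by
  have hDu : Continuous (fderiv ℝ u) := hu.continuous_fderiv (by norm_num)
  have hev : Continuous fun p : E N × Y ↦ A p.2 p.1 := (hA.comp continuous_snd).clm_apply continuous_fst
  have hF' : Continuous fun p : E N × Y ↦ ρ p.2 • (fderiv ℝ u (A p.2 p.1)).comp (A p.2) :=
    (hρ.comp continuous_snd).smul ((hDu.comp hev).clm_comp (hA.comp continuous_snd))
  refine contDiff_one_iff_fderiv.2
    ⟨fun x ↦ (hasFDerivAt_integral_comp_clm hs hsm hρ hA hu x).differentiableAt, ?_⟩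
  rw [funext fun x ↦ (hasFDerivAt_integral_comp_clm (μ := μ) hs hsm hρ hA hu x).fderiv]
  exact continuous_parametric_integral_of_continuous
    (f := fun x y ↦ ρ y • (fderiv ℝ u (A y x)).comp (A y)) hF' hs

end ParametricIntegral

/-! ### Averaging over the orthogonal group. -/

/-- The orthogonal group of `ℝ^N`, with its operator norm topology. -/
noncomputable abbrev Orth (N : ℕ) := unitary (E N →L[ℝ] E N)

instance : ContinuousStar (E N →L[ℝ] E N) :=
  ⟨(ContinuousLinearMap.adjoint (𝕜 := ℝ) (E := E N) (F := E N)).continuous⟩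

instance : CompactSpace (Orth N) := by
  refine isCompact_iff_compactSpace.1 (Metric.isCompact_of_isClosed_isBounded ?_ ?_)
  · have : (unitary (E N →L[ℝ] E N) : Set (E N →L[ℝ] E N))
        = {U | star U * U = 1} ∩ {U | U * star U = 1} := by
      ext U; exact Unitary.mem_iff
    rw [this]
    exact (isClosed_eq (continuous_star.mul continuous_id) continuous_const).inter
      (isClosed_eq (continuous_id.mul continuous_star) continuous_const)
  · refine (isBounded_iff_forall_norm_le).2 ⟨1, fun U hU ↦ ?_⟩
    refine U.opNorm_le_bound zero_le_one fun x ↦ ?_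
    rw [one_mul]
    exact (Unitary.norm_map ⟨U, hU⟩ x).le

noncomputable instance : MeasurableSpace (Orth N) := borel _

instance : BorelSpace (Orth N) := ⟨rfl⟩

/-- The Haar probability measure on the orthogonal group. -/
noncomputable def orthMeasure (N : ℕ) : Measure (Orth N) := Measure.haarMeasure ⊤

instance : (orthMeasure N).IsMulLeftInvariant := by
  unfold orthMeasure; infer_instance

instance : IsProbabilityMeasure (orthMeasure N) := by
  refine ⟨?_⟩
  have := Measure.haarMeasure_self (K₀ := (⊤ : TopologicalSpace.PositiveCompacts (Orth N)))
  simpa [orthMeasure] using this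

/-- The spherical mean of `u`, as a radial function on `ℝ^N`. -/
noncomputable def radialMean (u : E N → ℝ) (x : E N) : ℝ :=
  ∫ g : Orth N, u (((g⁻¹ : Orth N) : E N →L[ℝ] E N) x) ∂(orthMeasure N)

lemma continuous_orth_inv : Continuous fun g : Orth N ↦ ((g⁻¹ : Orth N) : E N →L[ℝ] E N) :=
  continuous_subtype_val.comp continuous_inv

lemma contDiff_radialMean {u : E N → ℝ} (hu : ContDiff ℝ 1 u) : ContDiff ℝ 1 (radialMean u) := by
  have := contDiff_integral_comp_clm (μ := orthMeasure N) (ρ := fun _ ↦ 1) isCompact_univ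
    MeasurableSet.univ continuous_const continuous_orth_inv hu
  simp only [one_mul, Measure.restrict_univ] at this
  exact this

/-- The inverse in `radialMean` is what lets left invariance of Haar measure suffice: replacing `g`
by `h * g` turns `g⁻¹ (h x)` into `g⁻¹ x`. -/
lemma radialMean_comp_isometry (u : E N → ℝ) (σ : E N ≃ₗᵢ[ℝ] E N) (x : E N) :
    radialMean u (σ x) = radialMean u x := by
  set h : Orth N := Unitary.linearIsometryEquiv.symm σ with hh
  have hσ : ∀ y, σ y = (h : E N →L[ℝ] E N) y := fun y ↦ rfl
  unfold radialMean
  rw [← integral_mul_left_eq_self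
    (fun g : Orth N ↦ u (((g⁻¹ : Orth N) : E N →L[ℝ] E N) (σ x))) h]
  refine integral_congr_ae (Eventually.of_forall fun g ↦ ?_)
  have : ((h * g)⁻¹ * h : Orth N) = g⁻¹ := by group
  simp only [← this, hσ]
  rfl

/-- Points of equal norm are exchanged by the reflection in the hyperplane orthogonal to their
difference. -/
lemma radialMean_eq_of_norm_eq (u : E N → ℝ) {x y : E N} (h : ‖x‖ = ‖y‖) :
    radialMean u x = radialMean u y := by
  rw [← Submodule.reflection_sub h, radialMean_comp_isometry]

/-- Integration on a ball commutes with averaging over the orthogonal group. -/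
lemma integral_orth_swap {f : Orth N → E N → ℝ} (hf : Continuous (Function.uncurry f)) {r : ℝ} :
    ∫ x in ball (0 : E N) r, ∫ g, f g x ∂(orthMeasure N)
      = ∫ g, (∫ x in ball (0 : E N) r, f g x) ∂(orthMeasure N) := by
  symm
  refine integral_integral_swap ?_
  have h := Measure.prod_restrict (μ := orthMeasure N) (ν := (volume : Measure (E N)))
    univ (ball 0 r)
  rw [Measure.restrict_univ] at h
  rw [h]
  have hc : IsCompact ((univ : Set (Orth N)) ×ˢ closedBall (0 : E N) r) :=
    isCompact_univ.prod (isCompact_closedBall _ _)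
  exact (hf.continuousOn.integrableOn_compact hc).mono_set
    (prod_mono subset_rfl ball_subset_closedBall)

lemma setIntegral_ball_orth {F : Type*} [NormedAddCommGroup F] [NormedSpace ℝ F]
    (g : Orth N) (f : E N → F) (r : ℝ) :
    ∫ x in ball (0 : E N) r, f ((g : E N →L[ℝ] E N) x) = ∫ x in ball (0 : E N) r, f x :=
  setIntegral_ball_comp_isometry (Unitary.linearIsometryEquiv g) f r

lemma continuous_uncurry_orth {u : E N → ℝ} (hu : Continuous u) :
    Continuous fun p : Orth N × E N ↦ u (((p.1⁻¹ : Orth N) : E N →L[ℝ] E N) p.2) :=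
  hu.comp ((continuous_orth_inv.comp continuous_fst).clm_apply continuous_snd)

/-- Averaging acts as the orthogonal projection onto radial functions. With `φ = 1` it preserves the
mean, and with `φ = radialMean u` it gives the Pythagorean identity. -/
lemma integral_radialMean_mul {u φ : E N → ℝ} (hu : Continuous u) (hφ : Continuous φ)
    (hφr : ∀ x y, ‖x‖ = ‖y‖ → φ x = φ y) (r : ℝ) :
    ∫ x in ball (0 : E N) r, radialMean u x * φ x = ∫ x in ball (0 : E N) r, u x * φ x := by
  simp_rw [radialMean, ← integral_mul_const]
  rw [integral_orth_swap (f := fun g x ↦ u (((g⁻¹ : Orth N) : E N →L[ℝ] E N) x) * φ x)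
    ((continuous_uncurry_orth hu).mul (hφ.comp continuous_snd))]
  have : ∀ g : Orth N, ∫ x in ball (0 : E N) r, u (((g⁻¹ : Orth N) : E N →L[ℝ] E N) x) * φ x
      = ∫ x in ball (0 : E N) r, u x * φ x := by
    intro g
    rw [← setIntegral_ball_orth g⁻¹ (fun x ↦ u x * φ x)]
    refine integral_congr_ae (Eventually.of_forall fun x ↦ ?_)
    simp only
    rw [hφr x _ (Unitary.norm_map g⁻¹ x).symm]
  simp_rw [this]
  simp

/-- Jensen's inequality for the Haar probability measure: almost invariance under each isometry
passes to closeness to the average. -/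
lemma integral_sub_radialMean_sq_le {u : E N → ℝ} (hu : ContDiff ℝ 1 u) {r C : ℝ}
    (hC : ∀ g : E N ≃ₗᵢ[ℝ] E N, ∫ x in ball (0 : E N) r, (u x - u (g x)) ^ 2 ≤ C) :
    ∫ x in ball (0 : E N) r, (u x - radialMean u x) ^ 2 ≤ C := by
  have hcu := continuous_uncurry_orth hu.continuous
  have hcd : Continuous fun p : Orth N × E N ↦
      (u p.2 - u (((p.1⁻¹ : Orth N) : E N →L[ℝ] E N) p.2)) ^ 2 :=
    ((hu.continuous.comp continuous_snd).sub hcu).pow 2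
  have hint : ∀ {f : Orth N → ℝ}, Continuous f → Integrable f (orthMeasure N) := fun hf ↦
    integrableOn_univ.1 (hf.continuousOn.integrableOn_compact isCompact_univ)
  have hpt : ∀ x, (u x - radialMean u x) ^ 2
      ≤ ∫ g : Orth N, (u x - u (((g⁻¹ : Orth N) : E N →L[ℝ] E N) x)) ^ 2 ∂(orthMeasure N) := by
    intro x
    have hux : Continuous fun g : Orth N ↦ u (((g⁻¹ : Orth N) : E N →L[ℝ] E N) x) :=
      hu.continuous.comp (continuous_orth_inv.clm_apply continuous_const)
    have e : u x - radialMean u x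
        = ∫ g : Orth N, (u x - u (((g⁻¹ : Orth N) : E N →L[ℝ] E N) x)) ∂(orthMeasure N) := by
      rw [integral_sub (integrable_const _) (hint hux)]
      simp [radialMean]
    rw [e]
    exact ConvexOn.map_integral_le (g := fun t : ℝ ↦ t ^ 2) (even_two.convexOn_pow)
      (continuous_pow 2).continuousOn isClosed_univ (by simp)
      (hint (continuous_const.sub hux)) (hint ((continuous_const.sub hux).pow 2))
  have hint2 : Continuous fun x ↦
      ∫ g : Orth N, (u x - u (((g⁻¹ : Orth N) : E N →L[ℝ] E N) x)) ^ 2 ∂(orthMeasure N) := by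
    have := continuous_parametric_integral_of_continuous (μ := orthMeasure N)
      (f := fun (x : E N) (g : Orth N) ↦ (u x - u (((g⁻¹ : Orth N) : E N →L[ℝ] E N) x)) ^ 2)
      (hcd.comp continuous_swap) isCompact_univ
    simpa using this
  calc _ ≤ ∫ x in ball (0 : E N) r,
        ∫ g : Orth N, (u x - u (((g⁻¹ : Orth N) : E N →L[ℝ] E N) x)) ^ 2 ∂(orthMeasure N) :=
        integral_mono
          ((hu.continuous.sub (contDiff_radialMean hu).continuous).pow 2).integrableOn_ball
          hint2.integrableOn_ball hpt
    _ = ∫ g : Orth N, (∫ x in ball (0 : E N) r,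
          (u x - u (((g⁻¹ : Orth N) : E N →L[ℝ] E N) x)) ^ 2) ∂(orthMeasure N) :=
        integral_orth_swap hcd
    _ ≤ ∫ _ : Orth N, C ∂(orthMeasure N) := by
        refine integral_mono_of_nonneg (Eventually.of_forall fun g ↦ ?_) (integrable_const _)
          (Eventually.of_forall fun g ↦ hC (Unitary.linearIsometryEquiv g⁻¹))
        exact integral_nonneg fun x ↦ sq_nonneg _
    _ = C := by simp

/-! ### Radial functions and the sharp inequality for the spherical mean. -/

/-- For radial `v`, the vector field `x ↦ rayMean v x • x` has divergence `v`. -/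
noncomputable def rayMean (v : E N → ℝ) (x : E N) : ℝ :=
  ∫ s in Icc (0 : ℝ) 1, s ^ (N - 1) * v (s • x)

lemma continuous_smul_id : Continuous fun s : ℝ ↦ s • ContinuousLinearMap.id ℝ (E N) :=
  continuous_id.smul continuous_const

lemma contDiff_rayMean {v : E N → ℝ} (hv : ContDiff ℝ 1 v) : ContDiff ℝ 1 (rayMean v) := by
  have := contDiff_integral_comp_clm (μ := volume) (s := Icc 0 1) (ρ := fun s : ℝ ↦ s ^ (N - 1))
    isCompact_Icc
    measurableSet_Icc (continuous_id.pow (N - 1)) continuous_smul_id hv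
  exact this

lemma rayMean_eq_of_norm_eq {v : E N → ℝ} (hv : ∀ x y, ‖x‖ = ‖y‖ → v x = v y) {x y : E N}
    (h : ‖x‖ = ‖y‖) : rayMean v x = rayMean v y := by
  unfold rayMean
  refine integral_congr_ae (Eventually.of_forall fun s ↦ ?_)
  simp only
  rw [hv (s • x) (s • y) (by rw [norm_smul, norm_smul, h])]

/-- Euler's identity for `rayMean`. -/
lemma mul_rayMean_add_fderiv [NeZero N] {v : E N → ℝ} (hv : ContDiff ℝ 1 v) (x : E N) :
    N * rayMean v x + fderiv ℝ (rayMean v) x x = v x := by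
  have hd : HasFDerivAt (rayMean v) (∫ s in Icc (0 : ℝ) 1,
      s ^ (N - 1) • (fderiv ℝ v (s • x)).comp (s • ContinuousLinearMap.id ℝ (E N))) x :=
    hasFDerivAt_integral_comp_clm (μ := volume) (s := Icc 0 1) (ρ := fun s : ℝ ↦ s ^ (N - 1))
    isCompact_Icc
      measurableSet_Icc (continuous_id.pow (N - 1)) continuous_smul_id hv x
  have hDv : Continuous (fderiv ℝ v) := hv.continuous_fderiv (by norm_num)
  have hsx : Continuous fun s : ℝ ↦ s • x := continuous_id.smul continuous_const
  have hint : IntegrableOn (fun s : ℝ ↦ s ^ (N - 1) •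
      (fderiv ℝ v (s • x)).comp (s • ContinuousLinearMap.id ℝ (E N))) (Icc 0 1) := by
    refine Continuous.integrableOn_Icc ?_
    exact (continuous_id.pow (N - 1)).smul ((hDv.comp hsx).clm_comp continuous_smul_id)
  have hN : N - 1 + 1 = N := Nat.succ_pred_eq_of_ne_zero (NeZero.ne N)
  rw [hd.fderiv, ContinuousLinearMap.integral_apply hint, rayMean, ← integral_const_mul,
    ← integral_add]
  · have hder : ∀ s : ℝ, HasDerivAt (fun s : ℝ ↦ s ^ N * v (s • x))
        (N * (s ^ (N - 1) * v (s • x)) + (s ^ (N - 1) •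
          (fderiv ℝ v (s • x)).comp (s • ContinuousLinearMap.id ℝ (E N))) x) s := by
      intro s
      have h1 : HasDerivAt (fun s : ℝ ↦ v (s • x)) (fderiv ℝ v (s • x) x) s := by
        have := ((hv.differentiable (by norm_num)) (s • x)).hasFDerivAt.comp_hasDerivAt s
          ((hasDerivAt_id s).smul_const x)
        rw [one_smul] at this
        exact this
      refine ((hasDerivAt_pow N s).mul h1).congr_deriv ?_
      have hs : s ^ N = s ^ (N - 1) * s := by rw [← pow_succ, hN]
      simp [hs]
      ring
    rw [integral_Icc_eq_integral_Ioc, ← intervalIntegral.integral_of_le zero_le_one,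
      intervalIntegral.integral_eq_sub_of_hasDerivAt (fun s _ ↦ hder s)]
    · simp [NeZero.ne N]
    · refine Continuous.intervalIntegrable ?_ _ _
      exact (continuous_const.mul ((continuous_id.pow (N - 1)).mul (hv.continuous.comp hsx))).add
        (((continuous_id.pow (N - 1)).smul ((hDv.comp hsx).clm_comp
          continuous_smul_id)).clm_apply continuous_const)
  · exact (continuous_const.mul
      ((continuous_id.pow (N - 1)).mul (hv.continuous.comp hsx))).integrableOn_Icc
  · exact Continuous.integrableOn_Icc
      (((continuous_id.pow (N - 1)).smul ((hDv.comp hsx).clm_comp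
        continuous_smul_id)).clm_apply continuous_const)

/-- The differential of a radial function is radial. -/
lemma norm_sq_mul_fderiv_le_of_radial {c : E N → ℝ} (hc : Differentiable ℝ c)
    (hr : ∀ x y, ‖x‖ = ‖y‖ → c x = c y) (x : E N) :
    ‖x‖ ^ 2 * ‖fderiv ℝ c x‖ ^ 2 ≤ fderiv ℝ c x x ^ 2 := by
  rcases eq_or_ne x 0 with rfl | hx
  · simp
  have hxn : 0 < ‖x‖ := norm_pos_iff.2 hx
  have hperp : ∀ v, inner ℝ x v = 0 → fderiv ℝ c x v = 0 := by
    intro v hv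
    -- This reflection fixes `x`, negates `v` and preserves `c`, so the derivative of `c` at `x` in
    -- the direction `v` equals its own negative.
    set σ := hyperplaneReflection v
    have hσx : σ x = x := by
      rw [hyperplaneReflection_apply, hv]; simp
    have hσv : σ v = -v := Submodule.reflection_orthogonalComplement_singleton_eq_neg v
    have hcσ : (fun y ↦ c (σ y)) = c := funext fun y ↦ hr _ _ (σ.norm_map y)
    have h1 : HasFDerivAt c
        ((fderiv ℝ c x).comp (σ.toContinuousLinearEquiv : E N →L[ℝ] E N)) x := by
      have h := (hc (σ x)).hasFDerivAt.comp x σ.toContinuousLinearEquiv.hasFDerivAt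
      rw [hσx] at h
      convert! h using 1
      exact hcσ.symm
    have h2 := congrArg (fun l ↦ l v) h1.fderiv
    have h3 : fderiv ℝ c x v = fderiv ℝ c x (σ v) := h2
    rw [hσv, map_neg] at h3
    linarith
  have hle : ‖fderiv ℝ c x‖ ≤ |fderiv ℝ c x x| / ‖x‖ := by
    refine (fderiv ℝ c x).opNorm_le_bound (by positivity) fun w ↦ ?_
    have hw : fderiv ℝ c x w = (inner ℝ x w / ‖x‖ ^ 2) * fderiv ℝ c x x := by
      have h := hperp (w - (inner ℝ x w / ‖x‖ ^ 2) • x) (by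
        rw [inner_sub_right, inner_smul_right, real_inner_self_eq_norm_sq]
        field_simp
        ring)
      rw [map_sub, map_smul, smul_eq_mul] at h
      linarith
    rw [hw, norm_mul, Real.norm_eq_abs, Real.norm_eq_abs, abs_div,
      abs_of_pos (show 0 < ‖x‖ ^ 2 by positivity)]
    have := abs_real_inner_le_norm x w
    calc |inner ℝ x w| / ‖x‖ ^ 2 * |fderiv ℝ c x x|
        ≤ (‖x‖ * ‖w‖) / ‖x‖ ^ 2 * |fderiv ℝ c x x| := by gcongr
      _ = _ := by field_simp
  have : ‖x‖ * ‖fderiv ℝ c x‖ ≤ |fderiv ℝ c x x| := by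
    rw [mul_comm]; exact (le_div_iff₀ hxn).1 hle
  rw [← mul_pow, ← sq_abs (fderiv ℝ c x x)]
  gcongr

lemma norm_clm_sq (l : E N →L[ℝ] ℝ) : ‖l‖ ^ 2 = ∑ i, l (EuclideanSpace.single i 1) ^ 2 := by
  set v := (InnerProductSpace.toDual ℝ (E N)).symm l with hv
  have h1 : ‖l‖ = ‖v‖ := (LinearIsometryEquiv.norm_map _ _).symm
  have h2 : ∀ w, l w = inner ℝ v w := fun w ↦ (InnerProductSpace.toDual_symm_apply).symm
  rw [h1, EuclideanSpace.norm_sq_eq]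
  refine Finset.sum_congr rfl fun i _ ↦ ?_
  rw [h2, EuclideanSpace.inner_single_right]
  simp

/-- The total Dirichlet energy density of `x ↦ c x • x`. -/
lemma sum_norm_fderiv_mul_coord {c : E N → ℝ} {x : E N} (hc : DifferentiableAt ℝ c x) :
    ∑ i, ‖fderiv ℝ (fun y : E N ↦ c y * y i) x‖ ^ 2
      = N * c x ^ 2 + 2 * c x * fderiv ℝ c x x + ‖x‖ ^ 2 * ‖fderiv ℝ c x‖ ^ 2 := by
  have hd : ∀ i, fderiv ℝ (fun y : E N ↦ c y * y i) x
      = c x • (EuclideanSpace.proj i : E N →L[ℝ] ℝ) + x i • fderiv ℝ c x := fun i ↦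
    (hc.hasFDerivAt.mul (EuclideanSpace.proj i : E N →L[ℝ] ℝ).hasFDerivAt).fderiv
  have h1 : ∀ i, ‖fderiv ℝ (fun y : E N ↦ c y * y i) x‖ ^ 2
      = c x ^ 2 + 2 * c x * (fderiv ℝ c x (EuclideanSpace.single i 1) * x i)
        + x i ^ 2 * ‖fderiv ℝ c x‖ ^ 2 := by
    intro i
    rw [hd, norm_clm_sq, norm_clm_sq]
    have : ∀ j, (c x • (EuclideanSpace.proj i : E N →L[ℝ] ℝ) + x i • fderiv ℝ c x)
        (EuclideanSpace.single j 1) ^ 2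
        = (if i = j then c x ^ 2 + 2 * c x * (fderiv ℝ c x (EuclideanSpace.single j 1) * x i) else 0)
          + x i ^ 2 * fderiv ℝ c x (EuclideanSpace.single j 1) ^ 2 := by
      intro j
      simp only [add_apply, smul_apply, smul_eq_mul, PiLp.proj_apply, PiLp.single_apply]
      split_ifs <;> ring
    simp_rw [this]
    rw [Finset.sum_add_distrib, Finset.sum_ite_eq, ← Finset.mul_sum]
    simp
  simp_rw [h1]
  rw [Finset.sum_add_distrib, Finset.sum_add_distrib, ← Finset.mul_sum, sum_clm_single_mul,
    ← Finset.sum_mul, EuclideanSpace.norm_sq_eq]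
  simp

/-- The sharp inequality for the spherical mean of a function of mean zero. -/
lemma poincare_radialMean [NeZero N] {u : E N → ℝ} (hu : ContDiff ℝ 1 u)
    (hmean : ∫ x in ball (0 : E N) 1, u x = 0) :
    besselBeta N ^ 2 * ∫ x in ball (0 : E N) 1, radialMean u x ^ 2
      ≤ ∫ x in ball (0 : E N) 1, ‖fderiv ℝ u x‖ ^ 2 := by
  set v := radialMean u with hv
  have hvc : ContDiff ℝ 1 v := contDiff_radialMean hu
  have hvr : ∀ x y, ‖x‖ = ‖y‖ → v x = v y := fun x y h ↦ radialMean_eq_of_norm_eq u h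
  set c := rayMean v with hc
  have hcc : ContDiff ℝ 1 c := contDiff_rayMean hvc
  have hcd : Differentiable ℝ c := hcc.differentiable (by norm_num)
  have hcr : ∀ x y, ‖x‖ = ‖y‖ → c x = c y := fun x y h ↦ rayMean_eq_of_norm_eq hvr h
  have heuler : ∀ x, N * c x + fderiv ℝ c x x = v x := mul_rayMean_add_fderiv hvc
  have hDc : Continuous fun x ↦ fderiv ℝ c x x :=
    (hcc.continuous_fderiv (by norm_num)).clm_apply continuous_id
  have hvmean : ∫ x in ball (0 : E N) 1, v x = 0 := by
    have := integral_radialMean_mul hu.continuous (φ := fun _ ↦ 1) continuous_const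
      (fun _ _ _ ↦ rfl) 1
    simpa [hmean] using this
  have hvv : ∫ x in ball (0 : E N) 1, v x ^ 2 = ∫ x in ball (0 : E N) 1, u x * v x := by
    rw [← integral_radialMean_mul hu.continuous hvc.continuous hvr]
    simp_rw [sq, hv]
  -- To apply the divergence theorem, which is stated for tangential fields, the boundary value of
  -- `c` is subtracted. The field `(c - c x₁) x` has divergence `v - N c x₁`, and `v` has mean zero.
  have hc1 : ∀ x : E N, ‖x‖ = 1 → c x = 0 := by
    intro x₁ hx₁
    have hYc : ContDiff ℝ 1 fun x ↦ c x - c x₁ := hcc.sub contDiff_const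
    have h := integral_divg_ball_eq_zero (Y := fun x ↦ (c x - c x₁) • x) (hYc.smul contDiff_id)
      (fun x hx ↦ by rw [hcr x x₁ (hx.trans hx₁.symm)]; simp)
    have e : ∀ x, divg (fun x ↦ (c x - c x₁) • x) x = v x - N * c x₁ := by
      intro x
      rw [divg_smul (hYc.differentiable (by norm_num) x) differentiableAt_fun_id, divg_id,
        fderiv_sub_const, ← heuler x]
      ring
    simp_rw [e] at h
    rw [integral_sub hvc.continuous.integrableOn_ball continuous_const.integrableOn_ball, hvmean,
      setIntegral_const, smul_eq_mul, zero_sub, neg_eq_zero] at h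
    have hvol : volume.real (ball (0 : E N) 1) ≠ 0 :=
      (ENNReal.toReal_pos (measure_ball_pos _ _ one_pos).ne' measure_ball_lt_top.ne).ne'
    have hN : (N : ℝ) ≠ 0 := NeZero.ne _
    simpa [hvol, hN] using h
  -- the components of `c x • x` are odd
  have hcomp : ∀ i, besselBeta N ^ 2 * ∫ x in ball (0 : E N) 1, (c x * x i) ^ 2
      ≤ ∫ x in ball (0 : E N) 1, ‖fderiv ℝ (fun y : E N ↦ c y * y i) x‖ ^ 2 := by
    intro i
    refine poincare_of_odd (e := EuclideanSpace.single i 1)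
      (hcc.mul (EuclideanSpace.proj i : E N →L[ℝ] ℝ).contDiff) (by simp) fun x ↦ ?_
    rw [hcr _ x (LinearIsometryEquiv.norm_map _ x), hyperplaneReflection_apply]
    simp [EuclideanSpace.inner_single_right]
    ring
  have hcoord : ∀ i, Continuous fun x : E N ↦ x i := fun i ↦
    (EuclideanSpace.proj i : E N →L[ℝ] ℝ).continuous
  have hcompD : ∀ i, Continuous fun x ↦ ‖fderiv ℝ (fun y : E N ↦ c y * y i) x‖ ^ 2 := fun i ↦
    (((hcc.mul (EuclideanSpace.proj i : E N →L[ℝ] ℝ).contDiff)).continuous_fderiv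
      (by norm_num)).norm.pow 2
  -- The sharp inequality for the odd functions `c x_i`, summed over `i`.
  have hsum : besselBeta N ^ 2 * ∫ x in ball (0 : E N) 1, c x ^ 2 * ‖x‖ ^ 2
      ≤ ∫ x in ball (0 : E N) 1, v x ^ 2 := by
    have h1 := Finset.sum_le_sum fun i (_ : i ∈ Finset.univ) ↦ hcomp i
    have e1 : ∀ i, IntegrableOn (fun x : E N ↦ (c x * x i) ^ 2) (ball 0 1) := fun i ↦
      ((hcc.continuous.mul (hcoord i)).pow 2).integrableOn_ball
    rw [← Finset.mul_sum, ← integral_finsetSum _ fun i _ ↦ e1 i,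
      ← integral_finsetSum _ fun i _ ↦ (hcompD i).integrableOn_ball] at h1
    have e2 : ∀ x : E N, ∑ i, (c x * x i) ^ 2 = c x ^ 2 * ‖x‖ ^ 2 := by
      intro x
      simp_rw [mul_pow]
      rw [← Finset.mul_sum, EuclideanSpace.norm_sq_eq]
      simp
    simp_rw [e2, fun x ↦ sum_norm_fderiv_mul_coord (hcd x)] at h1
    refine h1.trans ?_
    have hc2 : ContDiff ℝ 1 fun x ↦ c x ^ 2 := hcc.pow 2
    have hd2 := integral_divg_ball_eq_zero (Y := fun x ↦ c x ^ 2 • x) (hc2.smul contDiff_id)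
      (fun x hx ↦ by rw [hc1 x hx]; simp)
    have e3 : ∀ x, divg (fun x ↦ c x ^ 2 • x) x = N * c x ^ 2 + 2 * c x * fderiv ℝ c x x := by
      intro x
      rw [divg_smul (hc2.differentiable (by norm_num) x) differentiableAt_fun_id, divg_id,
        fderiv_fun_pow 2 (hcd x)]
      simp
      ring
    simp_rw [e3] at hd2
    have hcontd : Continuous fun x ↦ N * c x ^ 2 + 2 * c x * fderiv ℝ c x x :=
      (continuous_const.mul (hcc.continuous.pow 2)).add
        ((continuous_const.mul hcc.continuous).mul hDc)
    -- With `v = N c + x·∇c`, the total energy of `c x` is at most `v² - (N - 1) div(c² x)`, and the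
    -- divergence integrates to zero because `c` vanishes on the sphere.
    calc _ ≤ ∫ x in ball (0 : E N) 1,
          (v x ^ 2 - (N - 1) * (N * c x ^ 2 + 2 * c x * fderiv ℝ c x x)) := by
          refine integral_mono (Continuous.integrableOn_ball ?_) (Continuous.integrableOn_ball ?_)
            fun x ↦ ?_
          · exact hcontd.add ((continuous_norm.pow 2).mul
              ((hcc.continuous_fderiv (by norm_num)).norm.pow 2))
          · exact (hvc.continuous.pow 2).sub (continuous_const.mul hcontd)
          · have := norm_sq_mul_fderiv_le_of_radial hcd hcr x
            simp only
            rw [← heuler x]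
            nlinarith
      _ = ∫ x in ball (0 : E N) 1, v x ^ 2 := by
          have i1 : IntegrableOn (fun x ↦ v x ^ 2) (ball 0 1) :=
            (hvc.continuous.pow 2).integrableOn_ball
          rw [integral_sub i1 (hcontd.integrableOn_ball.const_mul _), integral_const_mul, hd2]
          simp
  have hY : ContDiff ℝ 1 fun x ↦ (u x * c x) • x := (hu.mul hcc).smul contDiff_id
  -- Integrating the divergence of `u c x` gives `∫ u v = -∫ c (x·∇u)`, and `∫ u v = ∫ v²`.
  have hparts := integral_divg_ball_eq_zero hY (fun x hx ↦ by rw [hc1 x hx]; simp)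
  have e4 : ∀ x, divg (fun x ↦ (u x * c x) • x) x = u x * v x + c x * fderiv ℝ u x x := by
    intro x
    rw [divg_smul ((hu.mul hcc).differentiable (by norm_num) x) differentiableAt_fun_id, divg_id,
      fderiv_fun_mul ((hu.differentiable (by norm_num)) x) (hcd x), ← heuler x]
    simp
    ring
  simp_rw [e4] at hparts
  have hDu : Continuous (fderiv ℝ u) := hu.continuous_fderiv (by norm_num)
  have hcont5 : Continuous fun x ↦ c x * fderiv ℝ u x x :=
    hcc.continuous.mul (hDu.clm_apply continuous_id)
  have i5 : IntegrableOn (fun x ↦ u x * v x) (ball 0 1) :=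
    (hu.continuous.mul hvc.continuous).integrableOn_ball
  rw [integral_add i5 hcont5.integrableOn_ball,
    ← hvv] at hparts
  have hb := besselBeta_pos N
  set b := besselBeta N with hbdef
  -- Young's inequality weighted by `b²`, so that `hsum` bounds the last term by `½ ∫ v²`, which the
  -- left side absorbs.
  have h6 : -∫ x in ball (0 : E N) 1, c x * fderiv ℝ u x x
      ≤ 1 / (2 * b ^ 2) * (∫ x in ball (0 : E N) 1, ‖fderiv ℝ u x‖ ^ 2)
        + b ^ 2 / 2 * ∫ x in ball (0 : E N) 1, c x ^ 2 * ‖x‖ ^ 2 := by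
    have hi1 : Continuous fun x ↦ ‖fderiv ℝ u x‖ ^ 2 := hDu.norm.pow 2
    have hi2 : Continuous fun x : E N ↦ c x ^ 2 * ‖x‖ ^ 2 :=
      (hcc.continuous.pow 2).mul (continuous_norm.pow 2)
    rw [← integral_neg, ← integral_const_mul, ← integral_const_mul,
      ← integral_add (hi1.integrableOn_ball.const_mul _) (hi2.integrableOn_ball.const_mul _)]
    refine integral_mono hcont5.neg.integrableOn_ball
      ((hi1.integrableOn_ball.const_mul _).add (hi2.integrableOn_ball.const_mul _)) fun x ↦ ?_
    beta_reduce
    have h7 : |fderiv ℝ u x x| ≤ ‖fderiv ℝ u x‖ * ‖x‖ := (fderiv ℝ u x).le_opNorm x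
    have h8 : -(c x * fderiv ℝ u x x) ≤ |c x| * (‖fderiv ℝ u x‖ * ‖x‖) := by
      refine (neg_le_abs _).trans ?_
      rw [abs_mul]
      gcongr
    refine h8.trans ?_
    rw [← sq_abs (c x)]
    have h9 : 0 ≤ (‖fderiv ℝ u x‖ / b - b * (|c x| * ‖x‖)) ^ 2 := sq_nonneg _
    have h10 : (‖fderiv ℝ u x‖ / b - b * (|c x| * ‖x‖)) ^ 2
        = 2 * (1 / (2 * b ^ 2) * ‖fderiv ℝ u x‖ ^ 2 + b ^ 2 / 2 * (|c x| ^ 2 * ‖x‖ ^ 2)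
          - |c x| * (‖fderiv ℝ u x‖ * ‖x‖)) := by
      field_simp
      ring
    linarith
  have h11 : ∫ x in ball (0 : E N) 1, v x ^ 2
      ≤ 1 / b ^ 2 * ∫ x in ball (0 : E N) 1, ‖fderiv ℝ u x‖ ^ 2 := by
    have : 1 / (2 * b ^ 2) = 1 / b ^ 2 / 2 := by field_simp
    rw [this] at h6
    linarith
  calc _ ≤ b ^ 2 * (1 / b ^ 2 * ∫ x in ball (0 : E N) 1, ‖fderiv ℝ u x‖ ^ 2) := by gcongr
    _ = _ := by field_simp

/-! ### The sharp Poincaré inequality for `C^1` functions on balls. -/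

/-- Almost invariance under reflections implies almost invariance under all isometries. -/
lemma integral_sub_comp_isometry_sq_le {u : E N → ℝ} (hu : Continuous u) {r η : ℝ} (hη : 0 ≤ η)
    (h : ∀ e : E N, e ≠ 0 →
      ∫ x in ball (0 : E N) r, (u x - u (hyperplaneReflection e x)) ^ 2 ≤ η)
    (g : E N ≃ₗᵢ[ℝ] E N) :
    ∫ x in ball (0 : E N) r, (u x - u (g x)) ^ 2 ≤ 2 ^ (N + 1) * η := by
  have hrefl : ∀ e : E N,
      ∫ x in ball (0 : E N) r, (u x - u (hyperplaneReflection e x)) ^ 2 ≤ η := by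
    intro e
    rcases eq_or_ne e 0 with rfl | he
    · simpa [hyperplaneReflection_apply] using hη
    · exact h e he
  -- The constants solve `c₀ = 0`, `c_{k+1} = 2 c_k + 2`, coming from `(p + q)² ≤ 2 p² + 2 q²` at
  -- each added reflection.
  have key : ∀ l : List (E N), ∫ x in ball (0 : E N) r,
      (u x - u ((l.map fun v ↦ hyperplaneReflection v).prod x)) ^ 2
        ≤ (2 ^ (l.length + 1) - 2) * η := by
    intro l
    induction l with
    | nil => simp
    | cons e l ih =>
      set p := (l.map fun v ↦ hyperplaneReflection v).prod with hp
      set σ := hyperplaneReflection e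
      have h1 : Continuous fun x ↦ (u x - u (p x)) ^ 2 :=
        (hu.sub (hu.comp p.continuous)).pow 2
      have h2 : Continuous fun x ↦ (u (p x) - u (σ (p x))) ^ 2 :=
        ((hu.comp p.continuous).sub (hu.comp (σ.continuous.comp p.continuous))).pow 2
      have e2 : ∫ x in ball (0 : E N) r, (u (p x) - u (σ (p x))) ^ 2 ≤ η := by
        rw [setIntegral_ball_comp_isometry p fun x ↦ (u x - u (σ x)) ^ 2]
        exact hrefl e
      have h3 : ∫ x in ball (0 : E N) r, (u x - u (σ (p x))) ^ 2
          ≤ ∫ x in ball (0 : E N) r,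
            (2 * (u x - u (p x)) ^ 2 + 2 * (u (p x) - u (σ (p x))) ^ 2) := by
        refine integral_mono (Continuous.integrableOn_ball
          ((hu.sub (hu.comp (σ.continuous.comp p.continuous))).pow 2))
          ((h1.integrableOn_ball.const_mul _).add (h2.integrableOn_ball.const_mul _)) fun x ↦ ?_
        beta_reduce
        nlinarith [sq_nonneg ((u x - u (p x)) - (u (p x) - u (σ (p x))))]
      rw [integral_add (h1.integrableOn_ball.const_mul _) (h2.integrableOn_ball.const_mul _),
        integral_const_mul, integral_const_mul] at h3
      have e4 : ∀ x, ((e :: l).map fun v ↦ hyperplaneReflection v).prod x = σ (p x) := by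
        intro x
        rw [List.map_cons, List.prod_cons]
        rfl
      simp_rw [e4]
      rw [List.length_cons, pow_succ]
      nlinarith
  -- Cartan–Dieudonné: a linear isometry is a product of at most `N` reflections.
  obtain ⟨l, hl, hg⟩ := g.reflections_generate_dim
  rw [hg]
  refine (key l).trans ?_
  gcongr
  have hl' : l.length ≤ N := by simpa using hl
  have : (2 : ℝ) ^ (l.length + 1) ≤ 2 ^ (N + 1) := by gcongr; norm_num
  linarith

/-- The sharp Poincaré inequality on the unit ball, for `C^1` functions. -/
lemma poincare_unitBall [NeZero N] {u : E N → ℝ} (hu : ContDiff ℝ 1 u)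
    (hmean : ∫ x in ball (0 : E N) 1, u x = 0) :
    besselBeta N ^ 2 * ∫ x in ball (0 : E N) 1, u x ^ 2
      ≤ ∫ x in ball (0 : E N) 1, ‖fderiv ℝ u x‖ ^ 2 := by
  by_contra! hcon
  set b := besselBeta N ^ 2 with hb
  have hb0 : 0 < b := pow_pos (besselBeta_pos N) 2
  have hnn : ∀ w : E N → ℝ, 0 ≤ ∫ x in ball (0 : E N) 1, w x ^ 2 := fun w ↦
    integral_nonneg fun x ↦ sq_nonneg _
  have hDnn : ∀ w : E N → ℝ, 0 ≤ ∫ x in ball (0 : E N) 1, ‖fderiv ℝ w x‖ ^ 2 := fun w ↦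
    integral_nonneg fun x ↦ sq_nonneg _
  set S : Set ℝ := {q | ∃ w : E N → ℝ, ContDiff ℝ 1 w ∧ ∫ x in ball (0 : E N) 1, w x = 0 ∧
    0 < ∫ x in ball (0 : E N) 1, w x ^ 2 ∧
    q = (∫ x in ball (0 : E N) 1, ‖fderiv ℝ w x‖ ^ 2) / ∫ x in ball (0 : E N) 1, w x ^ 2} with hS
  have hSbdd : BddBelow S := by
    refine ⟨0, ?_⟩
    rintro q ⟨w, -, -, -, rfl⟩
    exact div_nonneg (hDnn w) (hnn w)
  have hupos : 0 < ∫ x in ball (0 : E N) 1, u x ^ 2 := by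
    refine lt_of_le_of_ne (hnn u) fun h0 ↦ ?_
    rw [← h0, mul_zero] at hcon
    exact absurd hcon (not_lt.2 (hDnn u))
  have huS : (∫ x in ball (0 : E N) 1, ‖fderiv ℝ u x‖ ^ 2) / ∫ x in ball (0 : E N) 1, u x ^ 2 ∈ S :=
    ⟨u, hu, hmean, hupos, rfl⟩
  -- The optimal constant need not be attained; a near-minimiser suffices, so no compactness of the
  -- Sobolev embedding is required.
  set I := sInf S with hI
  have hIb : I < b := (csInf_le hSbdd huS).trans_lt ((div_lt_iff₀ hupos).2 hcon)
  have hImin : ∀ w : E N → ℝ, ContDiff ℝ 1 w → ∫ x in ball (0 : E N) 1, w x = 0 →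
      I * ∫ x in ball (0 : E N) 1, w x ^ 2 ≤ ∫ x in ball (0 : E N) 1, ‖fderiv ℝ w x‖ ^ 2 := by
    intro w hw hwm
    rcases (hnn w).eq_or_lt with h0 | h0
    · rw [← h0, mul_zero]; exact hDnn w
    · exact (le_div_iff₀ h0).1 (csInf_le hSbdd ⟨w, hw, hwm, h0, rfl⟩)
  -- `K` collects the losses in passing from a near-minimiser to its spherical mean; with `ε K = (b
  -- - I) / 2` the final inequality becomes `(b - I) n < (b - I) n / 2`.
  set K : ℝ := 1 + b * (2 ^ (N + 1) * (4 / (b - I))) with hK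
  have hbI : 0 < b - I := sub_pos.2 hIb
  have hK0 : 0 < K := by positivity
  set ε : ℝ := (b - I) / (2 * K) with hε
  have hε0 : 0 < ε := by positivity
  obtain ⟨q, ⟨w, hw, hwm, hwpos, rfl⟩, hq⟩ :=
    exists_lt_of_csInf_lt ⟨_, huS⟩ (show sInf S < I + ε by linarith)
  rw [div_lt_iff₀ hwpos] at hq
  set n := ∫ x in ball (0 : E N) 1, w x ^ 2 with hn
  have hrefl : ∀ e : E N, e ≠ 0 →
      ∫ x in ball (0 : E N) 1, (w x - w (hyperplaneReflection e x)) ^ 2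
        ≤ 4 / (b - I) * (ε * n) := by
    intro e he
    have := reflection_split hw he hImin hwm
    rw [← hb, ← hn] at this
    rw [div_mul_eq_mul_div, le_div_iff₀ hbI]
    nlinarith
  have hη : 0 ≤ 4 / (b - I) * (ε * n) := by positivity
  have hall := integral_sub_comp_isometry_sq_le hw.continuous hη hrefl
  have hdist := integral_sub_radialMean_sq_le hw hall
  -- The energy on the right is that of `w` itself, so no energy estimate for the spherical mean is
  -- needed.
  have hrad := poincare_radialMean hw hwm
  have hrc := contDiff_radialMean hw
  have hsplit : ∫ x in ball (0 : E N) 1, (w x - radialMean w x) ^ 2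
      = n - ∫ x in ball (0 : E N) 1, radialMean w x ^ 2 := by
    have h1 : ∫ x in ball (0 : E N) 1, radialMean w x ^ 2
        = ∫ x in ball (0 : E N) 1, w x * radialMean w x := by
      rw [← integral_radialMean_mul hw.continuous hrc.continuous
        fun x y h ↦ radialMean_eq_of_norm_eq w h]
      simp_rw [sq]
    have i1 : IntegrableOn (fun x ↦ w x ^ 2) (ball 0 1) := (hw.continuous.pow 2).integrableOn_ball
    have i2 : IntegrableOn (fun x ↦ w x * radialMean w x) (ball 0 1) :=
      (hw.continuous.mul hrc.continuous).integrableOn_ball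
    have i3 : IntegrableOn (fun x ↦ radialMean w x ^ 2) (ball 0 1) :=
      (hrc.continuous.pow 2).integrableOn_ball
    have e : ∀ x, (w x - radialMean w x) ^ 2
        = w x ^ 2 - 2 * (w x * radialMean w x) + radialMean w x ^ 2 := fun x ↦ by ring
    simp_rw [e]
    have i12 : IntegrableOn (fun x ↦ w x ^ 2 - 2 * (w x * radialMean w x)) (ball 0 1) :=
      i1.sub (i2.const_mul 2)
    rw [integral_add i12 i3, integral_sub i1 (i2.const_mul 2),
      integral_const_mul, ← h1]
    ring
  rw [hsplit] at hdist
  rw [← hb] at hrad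
  have h1 : b * (n - 2 ^ (N + 1) * (4 / (b - I) * (ε * n))) < (I + ε) * n := by
    refine lt_of_le_of_lt ?_ hq
    refine le_trans ?_ hrad
    exact mul_le_mul_of_nonneg_left (by linarith) hb0.le
  have h2 : (b - I) * n < ε * K * n := by
    have : ε * K * n = ε * n + b * (2 ^ (N + 1) * (4 / (b - I) * (ε * n))) := by
      rw [hK]; ring
    rw [this]
    linarith
  have h3 : ε * K = (b - I) / 2 := by rw [hε]; field_simp
  rw [h3] at h2
  nlinarith

/-- The sharp Poincaré inequality on a ball, for `C^1` functions. -/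
lemma poincare_ball [NeZero N] {u : E N → ℝ} (hu : ContDiff ℝ 1 u) (x₀ : E N) {r : ℝ} (hr : 0 < r) :
    besselBeta N ^ 2 / r ^ 2 * ∫ x in ball x₀ r, (u x - ⨍ y in ball x₀ r, u y) ^ 2
      ≤ ∫ x in ball x₀ r, ‖fderiv ℝ u x‖ ^ 2 := by
  have hch : ∀ f : E N → ℝ, ∫ x in ball x₀ r, f x
      = r ^ N * ∫ y in ball (0 : E N) 1, f (x₀ + r • y) := by
    intro f
    have h := Measure.setIntegral_comp_smul_of_pos (volume : Measure (E N))
      (fun x ↦ f (x₀ + x)) (ball 0 1) hr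
    rw [smul_unitBall_of_pos hr, finrank_euclideanSpace_fin] at h
    rw [h, smul_eq_mul, ← mul_assoc, mul_inv_cancel₀ (by positivity), one_mul]
    have h2 := (measurePreserving_add_left volume x₀).setIntegral_preimage_emb
      (measurableEmbedding_addLeft x₀) f (ball x₀ r)
    rw [← h2]
    congr 2
    ext x
    simp
  set m := ⨍ y in ball x₀ r, u y with hm
  set w : E N → ℝ := fun y ↦ u (x₀ + r • y) - m with hw
  have haff : ContDiff ℝ 1 fun y : E N ↦ x₀ + r • y := by fun_prop
  have hwc : ContDiff ℝ 1 w := (hu.comp haff).sub contDiff_const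
  have hvol : volume.real (ball x₀ r) ≠ 0 :=
    (ENNReal.toReal_pos (measure_ball_pos _ _ hr).ne' measure_ball_lt_top.ne).ne'
  have hwm : ∫ y in ball (0 : E N) 1, w y = 0 := by
    have h := hch (fun x ↦ u x - m)
    have h0 : ∫ x in ball x₀ r, (u x - m) = 0 := by
      rw [integral_sub hu.continuous.integrableOn_ball continuous_const.integrableOn_ball,
        setIntegral_const, smul_eq_mul, hm, setAverage_eq, smul_eq_mul, ← mul_assoc,
        mul_inv_cancel₀ hvol, one_mul, sub_self]
    rw [h0] at h
    exact (mul_eq_zero.1 h.symm).resolve_left (pow_pos hr N).ne'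
  have hD : ∀ y, ‖fderiv ℝ w y‖ ^ 2 = r ^ 2 * ‖fderiv ℝ u (x₀ + r • y)‖ ^ 2 := by
    intro y
    have h1 : HasFDerivAt (fun y : E N ↦ x₀ + r • y) (r • ContinuousLinearMap.id ℝ (E N)) y :=
      ((hasFDerivAt_id y).const_smul r).const_add x₀
    have h2 := (((hu.differentiable (by norm_num)) (x₀ + r • y)).hasFDerivAt.comp y h1).sub_const m
    have h3 : fderiv ℝ w y = r • fderiv ℝ u (x₀ + r • y) := by
      rw [show fderiv ℝ w y = _ from h2.fderiv]
      ext v; simp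
    rw [h3, norm_smul, mul_pow, Real.norm_eq_abs, sq_abs]
  have key := poincare_unitBall hwc hwm
  simp_rw [hD] at key
  rw [integral_const_mul] at key
  rw [hch, hch]
  have hrN : 0 < r ^ N := by positivity
  have e : besselBeta N ^ 2 / r ^ 2 * (r ^ N * ∫ y in ball (0 : E N) 1, (u (x₀ + r • y) - m) ^ 2)
      = r ^ N * (besselBeta N ^ 2 * (∫ y in ball (0 : E N) 1, w y ^ 2) / r ^ 2) := by
    simp only [hw]; ring
  rw [e]
  gcongr
  rw [div_le_iff₀ (by positivity)]
  linarith

/-! ### Mollification and the Poincaré inequality for Sobolev functions. -/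

/-- A form of Fatou's lemma. It is applied to mollifications restricted to increasing concentric
balls, so no convergence of integrals has to be shown. -/
lemma integral_le_of_ae_tendsto {α : Type*} {_ : MeasurableSpace α} {μ : Measure α}
    {f : ℕ → α → ℝ} {g : α → ℝ} {C : ℝ} (hf : ∀ n, Integrable (f n) μ) (h0 : ∀ n x, 0 ≤ f n x)
    (hg : AEStronglyMeasurable g μ) (hg0 : ∀ x, 0 ≤ g x)
    (hlim : ∀ᵐ x ∂μ, Tendsto (fun n ↦ f n x) atTop (𝓝 (g x)))
    (hle : ∀ n, ∫ x, f n x ∂μ ≤ C) : ∫ x, g x ∂μ ≤ C := by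
  have hC : 0 ≤ C := (integral_nonneg (h0 0)).trans (hle 0)
  have h := Lp.eLpNorm_le_of_ae_tendsto (p := 1) (C := ENNReal.ofReal C) (u := atTop)
    (Eventually.of_forall fun n ↦ ?_) (fun n ↦ (hf n).aestronglyMeasurable) hlim
  · rw [integral_eq_lintegral_of_nonneg_ae (Eventually.of_forall hg0) hg]
    refine ENNReal.toReal_le_of_le_ofReal hC ?_
    rw [eLpNorm_one_eq_lintegral_enorm] at h
    simpa only [Real.enorm_of_nonneg (hg0 _)] using h
  · rw [eLpNorm_one_eq_lintegral_enorm]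
    simp only [Real.enorm_of_nonneg (h0 _ _)]
    rw [← ofReal_integral_eq_lintegral_ofReal (hf n) (Eventually.of_forall (h0 n))]
    exact ENNReal.ofReal_le_ofReal (hle n)

/-- Mollification by a normed bump function. -/
noncomputable def mollify (φ : ContDiffBump (0 : E N)) (f : E N → ℝ) : E N → ℝ :=
  convolution (φ.normed volume) f (ContinuousLinearMap.lsmul ℝ ℝ) volume

lemma mollify_apply (φ : ContDiffBump (0 : E N)) (f : E N → ℝ) (x : E N) :
    mollify φ f x = ∫ t, φ.normed volume (x - t) * f t := by
  rw [mollify, convolution_eq_swap]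
  rfl

lemma contDiff_mollify (φ : ContDiffBump (0 : E N)) {f : E N → ℝ} (hf : Integrable f) :
    ContDiff ℝ 1 (mollify φ f) :=
  HasCompactSupport.contDiff_convolution_left (n := 1) _ φ.hasCompactSupport_normed
    φ.contDiff_normed hf.locallyIntegrable

lemma integrable_mollify (φ : ContDiffBump (0 : E N)) {f : E N → ℝ} (hf : Integrable f) :
    Integrable (mollify φ f) :=
  (φ.integrable_normed).integrable_convolution _ hf

lemma integral_mollify (φ : ContDiffBump (0 : E N)) {f : E N → ℝ} (hf : Integrable f) :
    ∫ x, mollify φ f x = ∫ x, f x := by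
  unfold mollify
  rw [integral_convolution _ φ.integrable_normed hf, φ.integral_normed]
  simp

lemma integrable_normed_sub_mul (φ : ContDiffBump (0 : E N)) {f : E N → ℝ} (hf : Integrable f)
    (x : E N) : Integrable fun t ↦ φ.normed volume (x - t) * f t :=
  (HasCompactSupport.convolutionExists_left (ContinuousLinearMap.lsmul ℝ ℝ)
    φ.hasCompactSupport_normed φ.continuous_normed hf.locallyIntegrable x).integrable_swap

lemma mollify_nonneg (φ : ContDiffBump (0 : E N)) {f : E N → ℝ} (hf : ∀ x, 0 ≤ f x) (x : E N) :
    0 ≤ mollify φ f x := by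
  rw [mollify_apply]
  exact integral_nonneg fun t ↦ mul_nonneg (φ.nonneg_normed _) (hf t)

lemma abs_mollify_le (φ : ContDiffBump (0 : E N)) (f : E N → ℝ) (x : E N) :
    |mollify φ f x| ≤ mollify φ (fun t ↦ |f t|) x := by
  rw [mollify_apply, mollify_apply]
  refine (abs_integral_le_integral_abs).trans (le_of_eq ?_)
  refine integral_congr_ae (Eventually.of_forall fun t ↦ ?_)
  simp only [abs_mul, abs_of_nonneg (φ.nonneg_normed _)]

/-- Jensen's inequality for mollification. -/
lemma mollify_sq_le (φ : ContDiffBump (0 : E N)) {f : E N → ℝ} (hf : Integrable f)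
    (hf2 : Integrable fun x ↦ f x ^ 2) (x : E N) :
    mollify φ f x ^ 2 ≤ mollify φ (fun t ↦ f t ^ 2) x := by
  set a := mollify φ f x with ha
  set ρ : E N → ℝ := fun t ↦ φ.normed volume (x - t) with hρ
  have h1 : ∫ t, ρ t = 1 := by
    rw [hρ, integral_sub_left_eq_self (fun t ↦ φ.normed volume t) volume x, φ.integral_normed]
  have hi1 : Integrable ρ := by
    by_contra h
    rw [integral_undef h] at h1
    exact zero_ne_one h1
  have hi2 : Integrable fun t ↦ ρ t * f t := integrable_normed_sub_mul φ hf x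
  have hi3 : Integrable fun t ↦ ρ t * f t ^ 2 := integrable_normed_sub_mul φ hf2 x
  have h2 : 0 ≤ ∫ t, (ρ t * f t ^ 2 - 2 * a * (ρ t * f t) + a ^ 2 * ρ t) := by
    refine integral_nonneg fun t ↦ ?_
    have : ρ t * f t ^ 2 - 2 * a * (ρ t * f t) + a ^ 2 * ρ t = ρ t * (f t - a) ^ 2 := by ring
    simp only [this]
    exact mul_nonneg (φ.nonneg_normed _) (sq_nonneg _)
  have hi4 : Integrable fun t ↦ ρ t * f t ^ 2 - 2 * a * (ρ t * f t) := hi3.sub (hi2.const_mul _)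
  rw [integral_add hi4 (hi1.const_mul _), integral_sub hi3 (hi2.const_mul _), integral_const_mul,
    integral_const_mul, h1] at h2
  have h3 : ∫ t, ρ t * f t = a := by rw [ha, mollify_apply]
  rw [h3] at h2
  rw [mollify_apply]
  linarith

lemma normed_sub_eq_zero (φ : ContDiffBump (0 : E N)) {x t : E N} (h : t ∉ closedBall x φ.rOut) :
    φ.normed volume (x - t) = 0 := by
  by_contra h0
  have : x - t ∈ Function.support (φ.normed volume) := h0
  rw [φ.support_normed_eq, mem_ball_zero_iff, ← dist_eq_norm, dist_comm] at this
  exact h this.le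

lemma fderiv_mollify_apply (φ : ContDiffBump (0 : E N)) {f : E N → ℝ} (hf : Integrable f)
    (x v : E N) : fderiv ℝ (mollify φ f) x v
      = ∫ t, fderiv ℝ (φ.normed volume) (x - t) v * f t := by
  have hc : HasCompactSupport (φ.normed (volume : Measure (E N))) := φ.hasCompactSupport_normed
  have hd : ContDiff ℝ 1 (φ.normed (volume : Measure (E N))) := φ.contDiff_normed (n := 1)
  have h := HasCompactSupport.hasFDerivAt_convolution_left (𝕜 := ℝ) (μ := (volume : Measure (E N)))
    (ContinuousLinearMap.lsmul ℝ ℝ) hc hd hf.locallyIntegrable x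
  have hex := HasCompactSupport.convolutionExists_left (μ := (volume : Measure (E N)))
    (ContinuousLinearMap.precompL (E N) (ContinuousLinearMap.lsmul ℝ ℝ)) (hc.fderiv ℝ)
    (hd.continuous_fderiv (by norm_num)) hf.locallyIntegrable x
  rw [mollify, h.fderiv, convolution_eq_swap, ContinuousLinearMap.integral_apply hex.integrable_swap]
  refine integral_congr_ae (Eventually.of_forall fun t ↦ ?_)
  simp [ContinuousLinearMap.precompL_apply]

/-- Weak gradients commute with mollification. -/
lemma norm_fderiv_mollify_le (φ : ContDiffBump (0 : E N)) {Ω : Set (E N)} (hΩ : MeasurableSet Ω)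
    {u : E N → ℝ} {G : E N → E N} (hw : IsWeakGradient Ω u G) (hu : IntegrableOn u Ω)
    (hG : IntegrableOn G Ω) {x : E N} (hx : closedBall x φ.rOut ⊆ Ω) :
    ‖fderiv ℝ (mollify φ (Ω.indicator u)) x‖ ≤ mollify φ (Ω.indicator fun t ↦ ‖G t‖) x := by
  have hGn : Integrable (Ω.indicator fun t ↦ ‖G t‖) := (integrable_indicator_iff hΩ).2 hG.norm
  have hui : Integrable (Ω.indicator u) := (integrable_indicator_iff hΩ).2 hu
  refine (fderiv ℝ _ x).opNorm_le_bound
    (mollify_nonneg φ (fun t ↦ indicator_nonneg (fun _ _ ↦ norm_nonneg _) t) x) fun v ↦ ?_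
  rw [fderiv_mollify_apply φ hui]
  set η : E N → ℝ := fun t ↦ φ.normed volume (x - t) with hη
  have hsupp : Function.support η ⊆ closedBall x φ.rOut := fun t ht ↦ by
    by_contra h; exact ht (normed_sub_eq_zero φ h)
  have hd : Differentiable ℝ (φ.normed (volume : Measure (E N))) :=
    (φ.contDiff_normed (n := 1)).differentiable (by norm_num)
  have hηd : ∀ t, fderiv ℝ η t v = -fderiv ℝ (φ.normed volume) (x - t) v := by
    intro t
    have h := (hd (x - t)).hasFDerivAt.comp t ((hasFDerivAt_id t).const_sub x)
    rw [show fderiv ℝ η t = _ from h.fderiv]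
    simp
  -- The test function is the mollifying kernel centred at `x`. Its support lies in `Ω`, so the
  -- derivative falling on the kernel can be moved to `u`.
  have h := hw η ((φ.contDiff_normed (n := ⊤)).comp (contDiff_const.sub contDiff_id))
    (HasCompactSupport.of_support_subset_isCompact (isCompact_closedBall x φ.rOut) hsupp)
    ((closure_minimal hsupp isClosed_closedBall).trans hx) v
  have e : ∫ t, fderiv ℝ (φ.normed volume) (x - t) v * Ω.indicator u t
      = ∫ t in Ω, inner ℝ (G t) v * η t := by
    rw [← neg_inj, ← h, ← integral_neg, ← integral_indicator hΩ]
    refine integral_congr_ae (Eventually.of_forall fun t ↦ ?_)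
    by_cases ht : t ∈ Ω
    · simp only [indicator_of_mem ht, hηd]; ring
    · simp only [indicator_of_notMem ht]; simp
  rw [e, mollify_apply, ← integral_mul_const, ← integral_indicator hΩ]
  refine norm_integral_le_of_norm_le ((integrable_normed_sub_mul φ hGn x).mul_const _)
    (Eventually.of_forall fun t ↦ ?_)
  by_cases ht : t ∈ Ω
  · simp only [indicator_of_mem ht]
    rw [norm_mul, Real.norm_eq_abs (η t), abs_of_nonneg (φ.nonneg_normed _), Real.norm_eq_abs]
    have := abs_real_inner_le_norm (G t) v
    have h2 : 0 ≤ η t := φ.nonneg_normed _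
    nlinarith
  · simp [indicator_of_notMem ht]

/-- The sharp Poincaré inequality on a ball, for Sobolev functions of mean zero. -/
lemma poincare_sobolev_ball [NeZero N] {x₀ : E N} {r : ℝ} (hr : 0 < r) {u : E N → ℝ}
    {G : E N → E N} (h : IsSobolev (ball x₀ r) u G) (hmean : ∫ x in ball x₀ r, u x = 0) :
    besselBeta N ^ 2 / r ^ 2 * ∫ x in ball x₀ r, u x ^ 2 ≤ ∫ x in ball x₀ r, ‖G x‖ ^ 2 := by
  set B := ball x₀ r with hB
  have hBm : MeasurableSet B := measurableSet_ball
  have : IsFiniteMeasure (volume.restrict B) := ⟨by simpa using measure_ball_lt_top⟩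
  have hu1 : IntegrableOn u B := h.memLp.integrable (by norm_num)
  have hG1 : IntegrableOn G B := h.memLp_grad.integrable (by norm_num)
  have hu2 : IntegrableOn (fun x ↦ u x ^ 2) B := h.memLp.integrable_sq
  have hG2 : IntegrableOn (fun x ↦ ‖G x‖ ^ 2) B := h.memLp_grad.norm.integrable_sq
  set U := B.indicator u with hU
  set g := B.indicator fun t ↦ ‖G t‖ with hg
  have hUi : Integrable U := (integrable_indicator_iff hBm).2 hu1
  have hgi : Integrable g := (integrable_indicator_iff hBm).2 hG1.norm
  have hg2e : (fun x ↦ g x ^ 2) = B.indicator fun x ↦ ‖G x‖ ^ 2 := by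
    ext x
    by_cases hx : x ∈ B
    · simp [hg, indicator_of_mem hx]
    · simp [hg, indicator_of_notMem hx]
  have hg2 : Integrable fun x ↦ g x ^ 2 := by
    rw [hg2e]; exact (integrable_indicator_iff hBm).2 hG2
  set D := ∫ x in B, ‖G x‖ ^ 2 with hD
  have hgD : ∫ x, g x ^ 2 = D := by rw [hg2e, integral_indicator hBm]
  -- radii
  set δ : ℕ → ℝ := fun n ↦ r / (4 * (n + 2)) with hδ
  have hδ0 : ∀ n, 0 < δ n := fun n ↦ by positivity
  have hδr : ∀ n, 4 * δ n ≤ r / 2 := fun n ↦ by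
    simp only [hδ]
    rw [mul_div_assoc', div_le_div_iff₀ (by positivity) two_pos]
    have : (0 : ℝ) ≤ n := by positivity
    nlinarith
  have hδlim : Tendsto δ atTop (𝓝 0) := by
    have h1 : Tendsto (fun n : ℕ ↦ 4 * ((n : ℝ) + 2)) atTop atTop :=
      Tendsto.const_mul_atTop (by norm_num)
        (tendsto_atTop_add_const_right _ _ tendsto_natCast_atTop_atTop)
    exact h1.const_div_atTop r
  set s : ℕ → ℝ := fun n ↦ r - 4 * δ n with hs
  have hs0 : ∀ n, r / 2 ≤ s n := fun n ↦ by have := hδr n; simp only [hs]; linarith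
  have hsr : ∀ n, s n ≤ r := fun n ↦ by have := hδ0 n; simp only [hs]; linarith
  set φ : ℕ → ContDiffBump (0 : E N) := fun n ↦
    ⟨δ n, 2 * δ n, hδ0 n, by linarith [hδ0 n]⟩ with hφ
  set w : ℕ → E N → ℝ := fun n ↦ mollify (φ n) U with hw
  have hwc : ∀ n, ContDiff ℝ 1 (w n) := fun n ↦ contDiff_mollify _ hUi
  set m : ℕ → ℝ := fun n ↦ ⨍ y in ball x₀ (s n), w n y with hm
  have hsub : ∀ n, ball x₀ (s n) ⊆ B := fun n ↦ ball_subset_ball (hsr n)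
  have hDn : ∀ n, ∫ x in ball x₀ (s n), ‖fderiv ℝ (w n) x‖ ^ 2 ≤ D := by
    intro n
    have hJ : ∀ x ∈ ball x₀ (s n), ‖fderiv ℝ (w n) x‖ ^ 2 ≤ mollify (φ n) (fun t ↦ g t ^ 2) x := by
      intro x hx
      refine le_trans ?_ (mollify_sq_le (φ n) hgi hg2 x)
      gcongr
      refine norm_fderiv_mollify_le (φ n) hBm h.weakGradient hu1 hG1 fun y hy ↦ ?_
      have h1 : dist y x ≤ 2 * δ n := hy
      have h2 : dist x x₀ < s n := hx
      have := dist_triangle y x x₀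
      have h3 : s n = r - 4 * δ n := rfl
      have := hδ0 n
      exact mem_ball.2 (by linarith)
    have hcont : Continuous fun x ↦ ‖fderiv ℝ (w n) x‖ ^ 2 :=
      ((hwc n).continuous_fderiv (by norm_num)).norm.pow 2
    calc _ ≤ ∫ x in ball x₀ (s n), mollify (φ n) (fun t ↦ g t ^ 2) x :=
          setIntegral_mono_on hcont.integrableOn_ball (integrable_mollify _ hg2).integrableOn
            measurableSet_ball hJ
      _ ≤ ∫ x, mollify (φ n) (fun t ↦ g t ^ 2) x :=
          setIntegral_le_integral (integrable_mollify _ hg2)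
            (Eventually.of_forall fun x ↦ mollify_nonneg _ (fun t ↦ sq_nonneg _) x)
      _ = D := by rw [integral_mollify _ hg2, hgD]
  have hb := besselBeta_pos N
  have hwn : ∀ n, ∫ x in ball x₀ (s n), (w n x - m n) ^ 2 ≤ D * (r ^ 2 / besselBeta N ^ 2) := by
    intro n
    have h1 := (poincare_ball (hwc n) x₀ (show 0 < s n by linarith [hs0 n])).trans (hDn n)
    have hs1 : 0 < s n := by linarith [hs0 n]
    have h2 : besselBeta N ^ 2 / r ^ 2 ≤ besselBeta N ^ 2 / s n ^ 2 := by
      have := hsr n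
      gcongr
    have h3 : 0 ≤ ∫ x in ball x₀ (s n), (w n x - m n) ^ 2 := integral_nonneg fun x ↦ sq_nonneg _
    have h4 := (mul_le_mul_of_nonneg_right h2 h3).trans h1
    calc ∫ x in ball x₀ (s n), (w n x - m n) ^ 2
        = (besselBeta N ^ 2 / r ^ 2 * ∫ x in ball x₀ (s n), (w n x - m n) ^ 2)
          * (r ^ 2 / besselBeta N ^ 2) := by field_simp
      _ ≤ _ := mul_le_mul_of_nonneg_right h4 (by positivity)
  -- the means are bounded
  set v₀ := volume.real (ball x₀ (r / 2)) with hv₀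
  have hv₀0 : 0 < v₀ := ENNReal.toReal_pos (measure_ball_pos _ _ (by linarith)).ne'
    measure_ball_lt_top.ne
  have hmb : ∀ n, m n ∈ closedBall (0 : ℝ) ((∫ x, |U x|) / v₀) := by
    intro n
    rw [mem_closedBall_zero_iff, hm]
    simp only [setAverage_eq, smul_eq_mul]
    rw [norm_mul, norm_inv, Real.norm_of_nonneg measureReal_nonneg, inv_mul_eq_div]
    have hv : v₀ ≤ volume.real (ball x₀ (s n)) :=
      measureReal_mono (ball_subset_ball (hs0 n)) measure_ball_lt_top.ne
    refine div_le_div₀ (integral_nonneg fun x ↦ abs_nonneg _) ?_ hv₀0 hv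
    calc ‖∫ y in ball x₀ (s n), w n y‖ ≤ ∫ y in ball x₀ (s n), ‖w n y‖ :=
          norm_integral_le_integral_norm _
      _ ≤ ∫ y in ball x₀ (s n), mollify (φ n) (fun t ↦ |U t|) y :=
          setIntegral_mono_on (hwc n).continuous.norm.integrableOn_ball
            (integrable_mollify _ hUi.abs).integrableOn measurableSet_ball
            fun y _ ↦ abs_mollify_le _ _ _
      _ ≤ ∫ y, mollify (φ n) (fun t ↦ |U t|) y :=
          setIntegral_le_integral (integrable_mollify _ hUi.abs)
            (Eventually.of_forall fun x ↦ mollify_nonneg _ (fun t ↦ abs_nonneg _) x)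
      _ = ∫ x, |U x| := integral_mollify _ hUi.abs
  -- The means are only known to be bounded. Identifying their limit is unnecessary: `u` has mean
  -- zero, so subtracting any constant `a` can only increase the integral of its square.
  obtain ⟨a, -, k, hk, hka⟩ := tendsto_subseq_of_bounded isBounded_closedBall hmb
  have hae : ∀ᵐ x, Tendsto (fun n ↦ w n x) atTop (𝓝 (U x)) := by
    refine ContDiffBump.ae_convolution_tendsto_right_of_locallyIntegrable (K := 2) (φ := φ) ?_ ?_
      hUi.locallyIntegrable
    · simpa [hφ] using hδlim.const_mul 2
    · exact Eventually.of_forall fun n ↦ le_rfl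
  have hfin : ∫ x in B, (u x - a) ^ 2 ≤ D * (r ^ 2 / besselBeta N ^ 2) := by
    refine integral_le_of_ae_tendsto
      (f := fun n ↦ (ball x₀ (s (k n))).indicator fun x ↦ (w (k n) x - m (k n)) ^ 2) ?_ ?_ ?_ ?_ ?_ ?_
    · intro n
      refine Integrable.integrableOn ((integrable_indicator_iff measurableSet_ball).2 ?_)
      exact (((hwc (k n)).continuous.sub continuous_const).pow 2).integrableOn_ball
    · exact fun n x ↦ indicator_nonneg (fun _ _ ↦ sq_nonneg _) x
    · exact (hu1.aestronglyMeasurable.sub aestronglyMeasurable_const).pow 2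
    · exact fun x ↦ sq_nonneg _
    · refine (ae_restrict_iff' hBm).2 ?_
      filter_upwards [hae] with x hx hxB
      have h1 : Tendsto (fun n ↦ (w (k n) x - m (k n)) ^ 2) atTop (𝓝 ((u x - a) ^ 2)) := by
        have : U x = u x := indicator_of_mem hxB _
        rw [← this]
        exact ((hx.comp hk.tendsto_atTop).sub hka).pow 2
      have h2 : Tendsto (fun n ↦ s (k n)) atTop (𝓝 r) := by
        have : Tendsto s atTop (𝓝 (r - 4 * 0)) := (hδlim.const_mul 4).const_sub r
        rw [mul_zero, sub_zero] at this
        exact this.comp hk.tendsto_atTop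
      refine h1.congr' ?_
      filter_upwards [h2.eventually (lt_mem_nhds (mem_ball.1 hxB))] with n hn
      exact (indicator_of_mem (mem_ball.2 hn) fun x ↦ (w (k n) x - m (k n)) ^ 2).symm
    · intro n
      rw [setIntegral_indicator measurableSet_ball, inter_eq_right.2 (hsub (k n))]
      exact hwn (k n)
  have hexp : ∫ x in B, (u x - a) ^ 2 = (∫ x in B, u x ^ 2) + a ^ 2 * volume.real B := by
    have e : ∀ x, (u x - a) ^ 2 = u x ^ 2 - 2 * a * u x + a ^ 2 := fun x ↦ by ring
    simp_rw [e]
    have i1 : IntegrableOn (fun x ↦ u x ^ 2 - 2 * a * u x) B := hu2.sub (hu1.const_mul _)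
    rw [integral_add i1 (integrable_const _), integral_sub hu2 (hu1.const_mul _),
      integral_const_mul, hmean, setIntegral_const, smul_eq_mul]
    ring
  rw [hexp] at hfin
  have hle : ∫ x in B, u x ^ 2 ≤ D * (r ^ 2 / besselBeta N ^ 2) := by
    have : 0 ≤ a ^ 2 * volume.real B := by positivity
    linarith
  calc _ ≤ besselBeta N ^ 2 / r ^ 2 * (D * (r ^ 2 / besselBeta N ^ 2)) := by gcongr
    _ = D := by field_simp

/-! ### The Neumann eigenvalue: admissible functions, balls and disconnected sets. -/

/-- A bounded function with bounded continuous gradient on an open set of finite measure is in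
`W^{1,2}`. -/
lemma isSobolev_of_hasFDerivAt {Ω : Set (E N)} (hΩ : IsOpen Ω) (hfin : volume Ω ≠ ⊤)
    {u : E N → ℝ} {G : E N → E N} (hu : ∀ x ∈ Ω, HasFDerivAt u (innerSL ℝ (G x)) x)
    (hG : ContinuousOn G Ω) {C : ℝ} (huC : ∀ x ∈ Ω, |u x| ≤ C) (hGC : ∀ x ∈ Ω, ‖G x‖ ≤ C) :
    IsSobolev Ω u G := by
  have hm : MeasurableSet Ω := hΩ.measurableSet
  have : IsFiniteMeasure (volume.restrict Ω) := ⟨by simpa using hfin.lt_top⟩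
  have huc : ContinuousOn u Ω := fun x hx ↦ (hu x hx).continuousAt.continuousWithinAt
  have hae : ∀ {p : E N → Prop}, (∀ x ∈ Ω, p x) → ∀ᵐ x ∂volume.restrict Ω, p x := fun h ↦
    (ae_restrict_iff' hm).2 (Eventually.of_forall h)
  refine ⟨MemLp.of_bound (huc.aestronglyMeasurable hm) C (hae huC),
    MemLp.of_bound (hG.aestronglyMeasurable hm) C (hae hGC), ?_⟩
  intro φ hφ hφc hφΩ v
  have hφd : Differentiable ℝ φ := hφ.differentiable (by simp)
  have hφ' : Continuous fun x ↦ fderiv ℝ φ x v :=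
    (hφ.continuous_fderiv (by simp)).clm_apply continuous_const
  have hφi : Integrable φ := hφ.continuous.integrable_of_hasCompactSupport hφc
  have hφ'i : Integrable fun x ↦ fderiv ℝ φ x v :=
    hφ'.integrable_of_hasCompactSupport (hφc.fderiv_apply ℝ v)
  have h0 : ∀ x, x ∉ Ω → φ x = 0 := fun x hx ↦
    image_eq_zero_of_notMem_tsupport fun h ↦ hx (hφΩ h)
  have h0' : ∀ x, x ∉ Ω → fderiv ℝ φ x v = 0 := fun x hx ↦ by
    rw [image_eq_zero_of_notMem_tsupport (f := fderiv ℝ φ)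
      fun h ↦ hx (hφΩ (tsupport_fderiv_subset ℝ h))]
    rfl
  have hGv : ContinuousOn (fun x ↦ inner ℝ (G x) v) Ω := hG.inner continuousOn_const
  have i1 : IntegrableOn (fun x ↦ u x * fderiv ℝ φ x v) Ω :=
    hφ'i.integrableOn.bdd_mul (huc.aestronglyMeasurable hm) (hae huC)
  have i2 : IntegrableOn (fun x ↦ inner ℝ (G x) v * φ x) Ω :=
    hφi.integrableOn.bdd_mul (hGv.aestronglyMeasurable hm) (c := C * ‖v‖) (hae fun x hx ↦
      (norm_inner_le_norm _ _).trans (mul_le_mul_of_nonneg_right (hGC x hx) (norm_nonneg v)))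
  have i3 : IntegrableOn (fun x ↦ u x * φ x) Ω :=
    hφi.integrableOn.bdd_mul (huc.aestronglyMeasurable hm) (hae huC)
  have full : ∀ {f : E N → ℝ}, IntegrableOn f Ω → (∀ x, x ∉ Ω → f x = 0) → Integrable f :=
    fun {f} hf hf0 ↦ (integrableOn_iff_integrable_of_support_subset fun x hx ↦ by
      by_contra h; exact hx (hf0 x h)).1 hf
  have key := integral_bilinear_hasFDerivAt_right_eq_neg_left_of_integrable
    (μ := (volume : Measure (E N))) (B := ContinuousLinearMap.mul ℝ ℝ) (f := u) (g := φ)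
    (f' := fun x ↦ innerSL ℝ (G x)) (g' := fderiv ℝ φ) (v := v)
    (full i2 fun x hx ↦ by simp [h0 x hx]) (full i1 fun x hx ↦ by simp [h0' x hx])
    (full i3 fun x hx ↦ by simp [h0 x hx]) (fun x hx ↦ hu x (hφΩ hx))
    (fun x _ ↦ (hφd x).hasFDerivAt)
  rw [setIntegral_eq_integral_of_forall_compl_eq_zero fun x hx ↦ by rw [h0' x hx, mul_zero],
    setIntegral_eq_integral_of_forall_compl_eq_zero fun x hx ↦ by rw [h0 x hx, mul_zero]]
  exact key

lemma mu2_nonneg (Ω : Set (E N)) : 0 ≤ mu2 Ω := by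
  refine Real.sInf_nonneg ?_
  rintro q ⟨u, G, -, -, -, rfl⟩
  exact div_nonneg (integral_nonneg fun x ↦ sq_nonneg _) (integral_nonneg fun x ↦ sq_nonneg _)

/-- Clearing the denominator removes the need to know that a trial function is nonzero: when its
norm vanishes, the left side is zero. -/
lemma mu2_mul_le {Ω : Set (E N)} {u : E N → ℝ} {G : E N → E N} (h : IsSobolev Ω u G)
    (hmean : ∫ x in Ω, u x = 0) : mu2 Ω * ∫ x in Ω, u x ^ 2 ≤ ∫ x in Ω, ‖G x‖ ^ 2 := by
  have hnn : 0 ≤ ∫ x in Ω, u x ^ 2 := integral_nonneg fun x ↦ sq_nonneg _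
  have hGn : 0 ≤ ∫ x in Ω, ‖G x‖ ^ 2 := integral_nonneg fun x ↦ sq_nonneg _
  rcases hnn.eq_or_lt with h0 | h0
  · rw [← h0, mul_zero]; exact hGn
  · refine (le_div_iff₀ h0).1 (csInf_le ⟨0, ?_⟩ ⟨u, G, h, fun hu ↦ h0.ne' ?_, hmean, rfl⟩)
    · rintro q ⟨u, G, -, -, -, rfl⟩
      exact div_nonneg (integral_nonneg fun x ↦ sq_nonneg _) (integral_nonneg fun x ↦ sq_nonneg _)
    · rw [integral_eq_zero_of_ae]
      filter_upwards [hu] with x hx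
      simp [hx]

/-- The lower bound for the first nontrivial Neumann eigenvalue of a ball. -/
lemma le_mu2_ball [NeZero N] (x₀ : E N) {r : ℝ} (hr : 0 < r) :
    besselBeta N ^ 2 / r ^ 2 ≤ mu2 (ball x₀ r) := by
  have : IsFiniteMeasure (volume.restrict (ball x₀ r)) := ⟨by simpa using measure_ball_lt_top⟩
  refine le_csInf ?_ ?_
  -- The real infimum of an empty set is `0`, so a competitor must be exhibited before bounding from
  -- below: a linear coordinate minus its mean.
  · set e : E N := EuclideanSpace.single 0 1 with he
    set m := ⨍ y in ball x₀ r, inner ℝ y e with hm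
    have hc : Continuous fun y : E N ↦ inner ℝ y e := continuous_id.inner continuous_const
    have hvol : volume.real (ball x₀ r) ≠ 0 :=
      (ENNReal.toReal_pos (measure_ball_pos _ _ hr).ne' measure_ball_lt_top.ne).ne'
    obtain ⟨C, hC⟩ := (isCompact_closedBall x₀ r).exists_bound_of_continuousOn
      (f := fun y ↦ inner ℝ y e - m) (hc.sub continuous_const).continuousOn
    refine ⟨_, fun y ↦ inner ℝ y e - m, fun _ ↦ e, isSobolev_of_hasFDerivAt isOpen_ball
      measure_ball_lt_top.ne (C := max C ‖e‖) (fun x _ ↦ (hasFDerivAt_inner_right e x).sub_const m)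
      continuousOn_const (fun x hx ↦ (hC x (ball_subset_closedBall hx)).trans (le_max_left _ _))
      (fun x _ ↦ le_max_right _ _), fun h0 ↦ ?_, ?_, rfl⟩
    · have h := Measure.eqOn_open_of_ae_eq h0 isOpen_ball
        (hc.sub continuous_const).continuousOn continuousOn_const
      have h1 := h (mem_ball_self hr)
      have h2 := h (x := x₀ + (r / 2) • e) (by
        simp [he, norm_smul, abs_of_pos hr]; linarith)
      simp only [inner_add_left, inner_smul_left] at h1 h2
      have h3 : inner ℝ e e = (1 : ℝ) := by simp [he]
      rw [h3] at h2
      simp only [conj_trivial, mul_one] at h2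
      have h4 : r / 2 = 0 := by
        simp only [Pi.zero_apply] at h1 h2
        linarith
      linarith
    · rw [integral_sub hc.integrableOn_ball continuous_const.integrableOn_ball,
        setIntegral_const, smul_eq_mul, hm, setAverage_eq, smul_eq_mul, ← mul_assoc,
        mul_inv_cancel₀ hvol, one_mul, sub_self]
  · rintro q ⟨u, G, h, hne, hmean, rfl⟩
    have hpos : 0 < ∫ x in ball x₀ r, u x ^ 2 := by
      refine lt_of_le_of_ne (integral_nonneg fun x ↦ sq_nonneg _) fun h0 ↦ hne ?_
      have := (integral_eq_zero_iff_of_nonneg (fun x ↦ sq_nonneg (u x)) h.memLp.integrable_sq).1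
        h0.symm
      filter_upwards [this] with x hx
      simpa using hx
    rw [le_div_iff₀ hpos]
    exact poincare_sobolev_ball hr h hmean

/-- The first nontrivial Neumann eigenvalue of a disconnected set vanishes. -/
lemma mu2_eq_zero_of_not_isPreconnected {Ω : Set (E N)} (hΩ : IsOpen Ω) (hfin : volume Ω ≠ ⊤)
    (h : ¬ IsPreconnected Ω) : mu2 Ω = 0 := by
  simp only [IsPreconnected, not_forall] at h
  obtain ⟨U, V, hU, hV, hUV, hUn, hVn, hd⟩ := h
  set A := Ω ∩ U with hA
  set B := Ω ∩ V with hB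
  have hAo : IsOpen A := hΩ.inter hU
  have hBo : IsOpen B := hΩ.inter hV
  have hAB : ∀ x, x ∈ A → x ∉ B := fun x hxA hxB ↦ hd ⟨x, hxA.1, hxA.2, hxB.2⟩
  have hcover : ∀ x ∈ Ω, x ∈ A ∨ x ∈ B := fun x hx ↦
    (hUV hx).imp (fun h ↦ ⟨hx, h⟩) fun h ↦ ⟨hx, h⟩
  have hAfin : volume A ≠ ⊤ := measure_ne_top_of_subset inter_subset_left hfin
  have hBfin : volume B ≠ ⊤ := measure_ne_top_of_subset inter_subset_left hfin
  set a := volume.real A with ha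
  set b := volume.real B with hb
  have ha0 : 0 < a := ENNReal.toReal_pos (hAo.measure_pos volume hUn).ne' hAfin
  have hb0 : 0 < b := ENNReal.toReal_pos (hBo.measure_pos volume hVn).ne' hBfin
  classical
  -- A locally constant competitor; weighting each piece by the volume of the other makes the mean
  -- zero.
  set u : E N → ℝ := fun x ↦ if x ∈ A then b else -a with hu
  have huA : ∀ x ∈ A, u x = b := fun x hx ↦ by simp [hu, hx]
  have huB : ∀ x ∈ B, u x = -a := fun x hx ↦ by
    have : x ∉ A := fun h ↦ hAB x h hx
    simp [hu, this]
  have hder : ∀ x ∈ Ω, HasFDerivAt u (innerSL ℝ (0 : E N)) x := by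
    intro x hx
    rw [map_zero]
    rcases hcover x hx with h | h
    · exact (hasFDerivAt_const b x).congr_of_eventuallyEq
        (by filter_upwards [hAo.mem_nhds h] with y hy using huA y hy)
    · exact (hasFDerivAt_const (-a) x).congr_of_eventuallyEq
        (by filter_upwards [hBo.mem_nhds h] with y hy using huB y hy)
  have hS : IsSobolev Ω u fun _ ↦ 0 := by
    refine isSobolev_of_hasFDerivAt hΩ hfin (C := a + b) hder continuousOn_const ?_ ?_
    · intro x hx
      rcases hcover x hx with h | h
      · rw [huA x h, abs_of_pos hb0]; linarith
      · rw [huB x h, abs_neg, abs_of_pos ha0]; linarith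
    · intro x _; rw [norm_zero]; positivity
  have : IsFiniteMeasure (volume.restrict Ω) := ⟨by simpa using hfin.lt_top⟩
  have hΩe : Ω = A ∪ B := by
    ext x
    exact ⟨hcover x, fun h ↦ h.elim (fun h ↦ h.1) fun h ↦ h.1⟩
  have hdis : Disjoint A B := Set.disjoint_left.2 hAB
  have hint : ∀ f : E N → ℝ, IntegrableOn f Ω →
      ∫ x in Ω, f x = (∫ x in A, f x) + ∫ x in B, f x := by
    intro f hf
    rw [hΩe] at hf ⊢
    exact setIntegral_union hdis hBo.measurableSet
      (hf.mono_set subset_union_left) (hf.mono_set subset_union_right)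
  have hmean : ∫ x in Ω, u x = 0 := by
    rw [hint u (hS.memLp.integrable (by norm_num)), setIntegral_congr_fun hAo.measurableSet huA,
      setIntegral_congr_fun hBo.measurableSet huB, setIntegral_const, setIntegral_const]
    simp only [smul_eq_mul, ← ha, ← hb]
    ring
  have hsq : ∫ x in Ω, u x ^ 2 = a * b ^ 2 + b * a ^ 2 := by
    rw [hint _ hS.memLp.integrable_sq, setIntegral_congr_fun hAo.measurableSet
        (fun x hx ↦ by simp only [huA x hx] : EqOn (fun x ↦ u x ^ 2) (fun _ ↦ b ^ 2) A),
      setIntegral_congr_fun hBo.measurableSet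
        (fun x hx ↦ by simp only [huB x hx] : EqOn (fun x ↦ u x ^ 2) (fun _ ↦ (-a) ^ 2) B),
      setIntegral_const, setIntegral_const]
    simp only [smul_eq_mul, ← ha, ← hb]
    ring
  have key := mu2_mul_le hS hmean
  rw [hsq] at key
  simp only [norm_zero, ne_eq, OfNat.ofNat_ne_zero, not_false_eq_true, zero_pow,
    integral_zero] at key
  have hpos : 0 < a * b ^ 2 + b * a ^ 2 := by positivity
  refine le_antisymm ?_ (mu2_nonneg Ω)
  by_contra! hc
  exact absurd key (not_le.2 (mul_pos hc hpos))

/-! ### Weinberger's trial functions and their densities. -/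

/-- Weinberger's radial factor: the profile of the eigenfunctions in the unit ball, continued so
that `√s * weinberger N s` is constant for `s ≥ 1`. -/
noncomputable def weinberger (N : ℕ) (s : ℝ) : ℝ :=
  if s ≤ 1 then profile N s else profile N 1 / √s

/-- The derivative of `weinberger`. -/
noncomputable def weinbergerD (N : ℕ) (s : ℝ) : ℝ :=
  if s ≤ 1 then profileD N s else -(profile N 1 / (2 * s * √s))

lemma weinberger_of_le {s : ℝ} (hs : s ≤ 1) : weinberger N s = profile N s := if_pos hs

lemma weinbergerD_of_le {s : ℝ} (hs : s ≤ 1) : weinbergerD N s = profileD N s := if_pos hs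

lemma weinberger_of_ge {s : ℝ} (hs : 1 ≤ s) : weinberger N s = profile N 1 / √s := by
  rcases hs.eq_or_lt with rfl | h
  · simp [weinberger]
  · exact if_neg (not_le.2 h)

/-- At `s = 1` the inner and outer formulas agree precisely because of the Neumann condition
`profile_add_one`, which makes the extension `C^1`. -/
lemma weinbergerD_of_ge [NeZero N] {s : ℝ} (hs : 1 ≤ s) :
    weinbergerD N s = -(profile N 1 / (2 * s * √s)) := by
  rcases hs.eq_or_lt with rfl | h
  · have := profile_add_one N
    simp only [weinbergerD, le_refl, if_true, Real.sqrt_one, mul_one]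
    linarith
  · exact if_neg (not_le.2 h)

lemma hasDerivAt_div_sqrt (c : ℝ) {s : ℝ} (hs : 0 < s) :
    HasDerivAt (fun s ↦ c / √s) (-(c / (2 * s * √s))) s := by
  have h := ((Real.hasDerivAt_sqrt hs.ne').inv (Real.sqrt_pos.2 hs).ne').const_mul c
  refine h.congr_deriv ?_
  have h1 : √s ≠ 0 := (Real.sqrt_pos.2 hs).ne'
  have h2 : s = √s ^ 2 := (Real.sq_sqrt hs.le).symm
  rw [Real.sq_sqrt hs.le]
  field_simp

lemma hasDerivAt_weinberger [NeZero N] (s : ℝ) :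
    HasDerivAt (weinberger N) (weinbergerD N s) s := by
  rcases lt_trichotomy s 1 with h | rfl | h
  · rw [weinbergerD_of_le h.le]
    refine (hasDerivAt_profile N s).congr_of_eventuallyEq ?_
    filter_upwards [gt_mem_nhds h] with t ht using weinberger_of_le ht.le
  · have h1 : HasDerivWithinAt (weinberger N) (weinbergerD N 1) (Iic 1) 1 := by
      rw [weinbergerD_of_le le_rfl]
      exact (hasDerivAt_profile N 1).hasDerivWithinAt.congr
        (fun t ht ↦ weinberger_of_le ht) (weinberger_of_le le_rfl)
    have h2 : HasDerivWithinAt (weinberger N) (weinbergerD N 1) (Ici 1) 1 := by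
      rw [weinbergerD_of_ge le_rfl]
      exact (hasDerivAt_div_sqrt _ one_pos).hasDerivWithinAt.congr
        (fun t ht ↦ weinberger_of_ge ht) (weinberger_of_ge le_rfl)
    have := h1.union h2
    rwa [Iic_union_Ici, hasDerivWithinAt_univ] at this
  · rw [weinbergerD_of_ge h.le]
    refine (hasDerivAt_div_sqrt _ (by linarith)).congr_of_eventuallyEq ?_
    filter_upwards [lt_mem_nhds h] with t ht using weinberger_of_ge (le_of_lt ht)

lemma continuous_weinberger [NeZero N] : Continuous (weinberger N) :=
  continuous_iff_continuousAt.2 fun s ↦ (hasDerivAt_weinberger s).continuousAt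

lemma continuous_weinbergerD [NeZero N] : Continuous (weinbergerD N) := by
  refine continuous_iff_continuousAt.2 fun s ↦ ?_
  have hP : Continuous (profileD N) := (contDiff_profileD N (n := 1)).continuous
  have hQ : ∀ s : ℝ, 0 < s → ContinuousAt (fun s ↦ -(profile N 1 / (2 * s * √s))) s := by
    intro s hs
    have h1 : 0 < √s := Real.sqrt_pos.2 hs
    exact (continuousAt_const.div ((continuousAt_const.mul continuousAt_id).mul
      Real.continuous_sqrt.continuousAt) (ne_of_gt (by positivity : (0 : ℝ) < 2 * s * √s))).neg
  rcases lt_trichotomy s 1 with h | rfl | h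
  · refine hP.continuousAt.congr ?_
    filter_upwards [gt_mem_nhds h] with t ht using (weinbergerD_of_le ht.le).symm
  · have h1 : ContinuousWithinAt (weinbergerD N) (Iic 1) 1 :=
      hP.continuousWithinAt.congr (fun t ht ↦ weinbergerD_of_le ht) (weinbergerD_of_le le_rfl)
    have h2 : ContinuousWithinAt (weinbergerD N) (Ici 1) 1 :=
      (hQ 1 one_pos).continuousWithinAt.congr (fun t ht ↦ weinbergerD_of_ge ht)
        (weinbergerD_of_ge le_rfl)
    have := h1.union h2
    rwa [Iic_union_Ici, continuousWithinAt_univ] at this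
  · refine (hQ s (by linarith)).congr ?_
    filter_upwards [lt_mem_nhds h] with t ht using (weinbergerD_of_ge (le_of_lt ht)).symm

lemma weinberger_pos [NeZero N] {s : ℝ} (hs : 0 ≤ s) : 0 < weinberger N s := by
  rcases le_total s 1 with h | h
  · rw [weinberger_of_le h]; exact profile_pos hs h
  · rw [weinberger_of_ge h]
    exact div_pos (profile_pos zero_le_one le_rfl) (Real.sqrt_pos.2 (by linarith))

/-- The total energy density of Weinberger's trial functions, in terms of `s = |x|²`. -/
noncomputable def energyDensity (N : ℕ) (s : ℝ) : ℝ :=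
  ((N : ℝ) - 1) * weinberger N s ^ 2 + (weinberger N s + 2 * s * weinbergerD N s) ^ 2

lemma continuous_energyDensity [NeZero N] : Continuous (energyDensity N) := by
  have h1 := continuous_weinberger (N := N)
  have h2 := continuous_weinbergerD (N := N)
  unfold energyDensity
  fun_prop

lemma energyDensity_of_ge [NeZero N] {s : ℝ} (hs : 1 ≤ s) :
    energyDensity N s = (N - 1) * profile N 1 ^ 2 * s⁻¹ := by
  have h0 : 0 < s := by linarith
  have h1 : 0 < √s := Real.sqrt_pos.2 h0
  have e : weinberger N s + 2 * s * weinbergerD N s = 0 := by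
    rw [weinberger_of_ge hs, weinbergerD_of_ge hs]
    field_simp
    ring
  rw [energyDensity, e, weinberger_of_ge hs, div_pow, Real.sq_sqrt h0.le]
  ring

lemma one_le_cast_of_neZero [NeZero N] : (1 : ℝ) ≤ N := by exact_mod_cast NeZero.one_le

/-- By `profile_ode` the derivative is `-4 (N - 1) s κ'² - β² κ (κ + 2 s κ')`; both terms are
nonpositive up to `s = 1`, as `r κ(r²)` is positive and increasing there. -/
lemma antitoneOn_energyDensity [NeZero N] : AntitoneOn (energyDensity N) (Icc 0 1) := by
  set f : ℝ → ℝ := fun s ↦ ((N : ℝ) - 1) * profile N s ^ 2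
    + (profile N s + 2 * s * profileD N s) ^ 2 with hf
  have hN : (1 : ℝ) ≤ N := one_le_cast_of_neZero
  have hfd : ∀ s, HasDerivAt f (-4 * (N - 1) * s * profileD N s ^ 2
      - besselBeta N ^ 2 * profile N s * (profile N s + 2 * s * profileD N s)) s := by
    intro s
    have hp := hasDerivAt_profile N s
    have hq := hasDerivAt_profileD N s
    have h := ((hp.pow 2).const_mul ((N : ℝ) - 1)).add
      ((hp.add (((hasDerivAt_id s).const_mul 2).mul hq)).pow 2)
    refine h.congr_deriv ?_
    have := profile_ode N s
    simp
    linear_combination (profile N s + 2 * s * profileD N s) * this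
  have hanti : AntitoneOn f (Icc 0 1) := by
    refine antitoneOn_of_deriv_nonpos (convex_Icc 0 1)
      (fun s _ ↦ (hfd s).continuousAt.continuousWithinAt)
      (fun s _ ↦ (hfd s).differentiableAt.differentiableWithinAt) fun s hs ↦ ?_
    rw [interior_Icc] at hs
    rw [(hfd s).deriv]
    have h1 := profile_pos (N := N) hs.1.le hs.2.le
    have h2 := profile_add_nonneg (N := N) hs.1.le hs.2.le
    have h3 : 0 ≤ (N - 1 : ℝ) * s * profileD N s ^ 2 :=
      mul_nonneg (mul_nonneg (by linarith) hs.1.le) (sq_nonneg _)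
    have h4 : 0 ≤ besselBeta N ^ 2 * profile N s * (profile N s + 2 * s * profileD N s) := by
      positivity
    linarith
  refine hanti.congr fun s hs ↦ ?_
  simp only [hf, energyDensity, weinberger_of_le hs.2, weinbergerD_of_le hs.2]

lemma le_energyDensity [NeZero N] {s : ℝ} (hs : 0 ≤ s) (hs1 : s ≤ 1) :
    (N - 1) * profile N 1 ^ 2 ≤ energyDensity N s := by
  have h := antitoneOn_energyDensity (N := N) ⟨hs, hs1⟩ (right_mem_Icc.2 zero_le_one) hs1
  rw [energyDensity_of_ge le_rfl] at h
  simpa using h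

lemma energyDensity_nonneg [NeZero N] (s : ℝ) : 0 ≤ energyDensity N s := by
  have hN : (1 : ℝ) ≤ N := one_le_cast_of_neZero
  have : (0 : ℝ) ≤ N - 1 := by linarith
  unfold energyDensity
  positivity

lemma energyDensity_le [NeZero N] {s : ℝ} (hs : 0 ≤ s) : energyDensity N s ≤ energyDensity N 0 := by
  rcases le_total s 1 with h | h
  · exact antitoneOn_energyDensity (left_mem_Icc.2 zero_le_one) ⟨hs, h⟩ hs
  · have h1 := antitoneOn_energyDensity (N := N) (left_mem_Icc.2 zero_le_one)
      (right_mem_Icc.2 zero_le_one) zero_le_one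
    refine le_trans ?_ h1
    rw [energyDensity_of_ge h, energyDensity_of_ge le_rfl]
    have hN : (1 : ℝ) ≤ N := one_le_cast_of_neZero
    have : (0 : ℝ) ≤ N - 1 := by linarith
    gcongr

/-- The total density of the squares of Weinberger's trial functions. -/
noncomputable def massDensity (N : ℕ) (s : ℝ) : ℝ := s * weinberger N s ^ 2

lemma continuous_massDensity [NeZero N] : Continuous (massDensity N) :=
  continuous_id.mul (continuous_weinberger.pow 2)

lemma massDensity_nonneg {s : ℝ} (hs : 0 ≤ s) : 0 ≤ massDensity N s := by
  unfold massDensity; positivity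

lemma massDensity_of_ge [NeZero N] {s : ℝ} (hs : 1 ≤ s) : massDensity N s = profile N 1 ^ 2 := by
  have h0 : 0 < s := by linarith
  rw [massDensity, weinberger_of_ge hs, div_pow, Real.sq_sqrt h0.le]
  field_simp

/-- At `s = r²` the density is the square of `r κ(r²)` inside the unit ball, which increases, and it
is constant outside. -/
lemma massDensity_le [NeZero N] {s : ℝ} (hs : 0 ≤ s) : massDensity N s ≤ profile N 1 ^ 2 := by
  rcases le_total s 1 with h | h
  swap
  · exact (massDensity_of_ge h).le
  have hd : ∀ s, HasDerivAt (massDensity N)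
      (weinberger N s * (weinberger N s + 2 * s * weinbergerD N s)) s := by
    intro s
    refine ((hasDerivAt_id s).mul ((hasDerivAt_weinberger s).pow 2)).congr_deriv ?_
    simp
    ring
  have hmono : MonotoneOn (massDensity N) (Icc 0 1) := by
    refine monotoneOn_of_deriv_nonneg (convex_Icc 0 1)
      (fun s _ ↦ (hd s).continuousAt.continuousWithinAt)
      (fun s _ ↦ (hd s).differentiableAt.differentiableWithinAt) fun s hs ↦ ?_
    rw [interior_Icc] at hs
    rw [(hd s).deriv, weinberger_of_le hs.2.le, weinbergerD_of_le hs.2.le]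
    exact mul_nonneg (profile_pos hs.1.le hs.2.le).le (profile_add_nonneg hs.1.le hs.2.le)
  have := hmono ⟨hs, h⟩ (right_mem_Icc.2 zero_le_one) h
  rwa [massDensity_of_ge le_rfl] at this

/-- Weinberger's trial functions. -/
noncomputable def trial (i : Fin N) (x : E N) : ℝ := weinberger N (‖x‖ ^ 2) * x i

lemma hasFDerivAt_weinberger_norm_sq [NeZero N] (x : E N) :
    HasFDerivAt (fun y : E N ↦ weinberger N (‖y‖ ^ 2))
      ((2 * weinbergerD N (‖x‖ ^ 2)) • innerSL ℝ x) x :=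
  hasFDerivAt_comp_norm_sq (hasDerivAt_weinberger _)

lemma contDiff_weinberger_norm_sq [NeZero N] :
    ContDiff ℝ 1 fun y : E N ↦ weinberger N (‖y‖ ^ 2) := by
  refine contDiff_one_iff_fderiv.2
    ⟨fun x ↦ (hasFDerivAt_weinberger_norm_sq x).differentiableAt, ?_⟩
  rw [funext fun x ↦ (hasFDerivAt_weinberger_norm_sq (N := N) x).fderiv]
  exact (continuous_const.mul (continuous_weinbergerD.comp (continuous_norm.pow 2))).smul
    (innerSL ℝ).continuous

lemma contDiff_trial [NeZero N] (i : Fin N) : ContDiff ℝ 1 (trial i) :=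
  contDiff_weinberger_norm_sq.mul (EuclideanSpace.proj i : E N →L[ℝ] ℝ).contDiff

lemma sum_trial_sq (x : E N) : ∑ i, trial i x ^ 2 = massDensity N (‖x‖ ^ 2) := by
  simp only [trial, mul_pow]
  rw [← Finset.mul_sum, massDensity, EuclideanSpace.norm_sq_eq]
  simp [mul_comm]

lemma sum_norm_fderiv_trial_sq [NeZero N] (x : E N) :
    ∑ i, ‖fderiv ℝ (trial i) x‖ ^ 2 = energyDensity N (‖x‖ ^ 2) := by
  have h := hasFDerivAt_weinberger_norm_sq (N := N) x
  have := sum_norm_fderiv_mul_coord h.differentiableAt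
  rw [h.fderiv, norm_smul, innerSL_apply_norm] at this
  refine this.trans ?_
  simp only [smul_apply, innerSL_apply_apply, real_inner_self_eq_norm_sq, smul_eq_mul,
    energyDensity, mul_pow, Real.norm_eq_abs, sq_abs]
  ring

/-- On the unit ball, the trial functions are eigenfunctions. -/
lemma integral_energyDensity_ball [NeZero N] :
    ∫ x in ball (0 : E N) 1, energyDensity N (‖x‖ ^ 2)
      = besselBeta N ^ 2 * ∫ x in ball (0 : E N) 1, massDensity N (‖x‖ ^ 2) := by
  have hmem : ∀ x ∈ ball (0 : E N) 1, ‖x‖ ^ 2 < 1 := fun x hx ↦ by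
    have : ‖x‖ < 1 := by simpa using hx
    nlinarith [norm_nonneg x]
  set e : Fin N → E N := fun i ↦ EuclideanSpace.single i 1 with he
  have heq : ∀ i x, x ∈ ball (0 : E N) 1 → trial i x = eigenfun (e i) x := by
    intro i x hx
    simp only [trial, eigenfun, weinberger_of_le (hmem x hx).le, he,
      EuclideanSpace.inner_single_right]
    simp [mul_comm]
  have hD : ∀ i x, x ∈ ball (0 : E N) 1 → ‖fderiv ℝ (trial i) x‖ = ‖eigenGrad (e i) x‖ := by
    intro i x hx
    have : trial i =ᶠ[𝓝 x] eigenfun (e i) := by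
      filter_upwards [isOpen_ball.mem_nhds hx] with y hy using heq i y hy
    rw [this.fderiv_eq, (hasFDerivAt_eigenfun (e i) x).fderiv, innerSL_apply_norm]
  have hψc : ∀ i, ContDiff ℝ 1 (eigenfun (e i)) := fun i ↦ by
    refine contDiff_one_iff_fderiv.2 ⟨fun x ↦ (hasFDerivAt_eigenfun _ x).differentiableAt, ?_⟩
    rw [funext fun x ↦ (hasFDerivAt_eigenfun (e i) x).fderiv]
    exact (innerSL ℝ).continuous.comp (contDiff_eigenGrad _).continuous
  have hi : ∀ i, ∫ x in ball (0 : E N) 1, ‖fderiv ℝ (trial i) x‖ ^ 2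
      = besselBeta N ^ 2 * ∫ x in ball (0 : E N) 1, trial i x ^ 2 := by
    intro i
    have h := integral_divg_ball_eq_zero (Y := fun x ↦ eigenfun (e i) x • eigenGrad (e i) x)
      ((hψc i).smul (contDiff_eigenGrad _))
      (fun x hx ↦ by rw [inner_smul_left, inner_eigenGrad _ hx, mul_zero])
    have e1 : ∀ x, divg (fun x ↦ eigenfun (e i) x • eigenGrad (e i) x) x
        = ‖eigenGrad (e i) x‖ ^ 2 - besselBeta N ^ 2 * eigenfun (e i) x ^ 2 := by
      intro x
      rw [divg_smul ((hψc i).differentiable (by norm_num) x)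
        ((contDiff_eigenGrad (e i)).differentiable (by norm_num) x), divg_eigenGrad,
        (hasFDerivAt_eigenfun (e i) x).fderiv, innerSL_apply_apply, real_inner_self_eq_norm_sq]
      ring
    have c1 : Continuous fun x ↦ ‖eigenGrad (e i) x‖ ^ 2 :=
      (contDiff_eigenGrad _).continuous.norm.pow 2
    have c2 : Continuous fun x ↦ eigenfun (e i) x ^ 2 := (hψc i).continuous.pow 2
    simp_rw [e1] at h
    rw [integral_sub c1.integrableOn_ball (c2.integrableOn_ball.const_mul _),
      integral_const_mul, sub_eq_zero] at h
    rw [setIntegral_congr_fun measurableSet_ball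
        (fun x hx ↦ by simp only [hD i x hx] :
          EqOn (fun x ↦ ‖fderiv ℝ (trial i) x‖ ^ 2) (fun x ↦ ‖eigenGrad (e i) x‖ ^ 2) _),
      setIntegral_congr_fun measurableSet_ball
        (fun x hx ↦ by simp only [heq i x hx] :
          EqOn (fun x ↦ trial i x ^ 2) (fun x ↦ eigenfun (e i) x ^ 2) _), h]
  simp_rw [← sum_norm_fderiv_trial_sq, ← sum_trial_sq]
  have i1 : ∀ i : Fin N, IntegrableOn (fun x ↦ ‖fderiv ℝ (trial i) x‖ ^ 2) (ball 0 1) := fun i ↦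
    (((contDiff_trial i).continuous_fderiv (by norm_num)).norm.pow 2).integrableOn_ball
  have i2 : ∀ i : Fin N, IntegrableOn (fun x ↦ trial i x ^ 2) (ball 0 1) := fun i ↦
    ((contDiff_trial i).continuous.pow 2).integrableOn_ball
  rw [integral_finsetSum _ fun i _ ↦ i1 i, integral_finsetSum _ fun i _ ↦ i2 i, Finset.mul_sum]
  exact Finset.sum_congr rfl fun i _ ↦ hi i

lemma abs_trial_le [NeZero N] (i : Fin N) (x : E N) : |trial i x| ≤ profile N 1 := by
  have h1 : trial i x ^ 2 ≤ profile N 1 ^ 2 :=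
    (Finset.single_le_sum (f := fun i ↦ trial i x ^ 2) (fun i _ ↦ sq_nonneg _)
      (Finset.mem_univ i)).trans ((sum_trial_sq x).trans_le (massDensity_le (by positivity)))
  exact abs_le_of_sq_le_sq h1 (profile_pos zero_le_one le_rfl).le

lemma norm_fderiv_trial_le [NeZero N] (i : Fin N) (x : E N) :
    ‖fderiv ℝ (trial i) x‖ ≤ √(energyDensity N 0) := by
  refine Real.le_sqrt_of_sq_le ?_
  exact (Finset.single_le_sum (f := fun i ↦ ‖fderiv ℝ (trial i) x‖ ^ 2) (fun i _ ↦ sq_nonneg _)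
      (Finset.mem_univ i)).trans
    ((sum_norm_fderiv_trial_sq x).trans_le (energyDensity_le (by positivity)))

/-! ### Centring the trial functions. -/

/-- A potential of the vector field whose components are Weinberger's trial functions. -/
noncomputable def potential (N : ℕ) (x : E N) : ℝ :=
  2⁻¹ * ∫ t in (0 : ℝ)..‖x‖ ^ 2, weinberger N t

lemma hasDerivAt_integral_weinberger [NeZero N] (s : ℝ) :
    HasDerivAt (fun s ↦ ∫ t in (0 : ℝ)..s, weinberger N t) (weinberger N s) s :=
  intervalIntegral.integral_hasDerivAt_right (continuous_weinberger.intervalIntegrable _ _)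
    (continuous_weinberger.stronglyMeasurableAtFilter _ _) continuous_weinberger.continuousAt

lemma hasFDerivAt_potential [NeZero N] (x : E N) :
    HasFDerivAt (potential N) (weinberger N (‖x‖ ^ 2) • innerSL ℝ x) x := by
  refine ((hasFDerivAt_comp_norm_sq (hasDerivAt_integral_weinberger (‖x‖ ^ 2))).const_mul
    (2⁻¹ : ℝ)).congr_fderiv ?_
  rw [smul_smul]
  congr 1
  ring

lemma continuous_potential [NeZero N] : Continuous (potential N) :=
  continuous_iff_continuousAt.2 fun x ↦ (hasFDerivAt_potential x).continuousAt

lemma norm_weinberger_smul_le [NeZero N] (x : E N) :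
    ‖weinberger N (‖x‖ ^ 2) • innerSL ℝ x‖ ≤ profile N 1 := by
  rw [norm_smul, innerSL_apply_norm]
  refine (sq_le_sq₀ (by positivity) (profile_pos zero_le_one le_rfl).le).1 ?_
  refine le_trans (le_of_eq ?_) (massDensity_le (N := N) (sq_nonneg ‖x‖))
  rw [massDensity, mul_pow, Real.norm_eq_abs, sq_abs, mul_comm]

lemma abs_potential_sub_le [NeZero N] (x y : E N) :
    |potential N x - potential N y| ≤ profile N 1 * ‖x - y‖ :=
  convex_univ.norm_image_sub_le_of_norm_hasFDerivWithin_le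
    (fun x _ ↦ (hasFDerivAt_potential x).hasFDerivWithinAt)
    (fun x _ ↦ norm_weinberger_smul_le x) (mem_univ y) (mem_univ x)

lemma potential_zero : potential N 0 = 0 := by simp [potential]

lemma potential_le [NeZero N] (x : E N) : potential N x ≤ profile N 1 * ‖x‖ := by
  have := abs_potential_sub_le x 0
  rw [potential_zero, sub_zero, sub_zero] at this
  exact (le_abs_self _).trans this

/-- For `s ≥ 1` the integrand is `profile N 1 / √s`, so the potential grows exactly like `profile N
1 * ‖x‖` outside the unit ball. Together with `potential_le` this gives coercivity in the centring
argument. -/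
lemma le_potential [NeZero N] (x : E N) : profile N 1 * (‖x‖ - 1) ≤ potential N x := by
  have hK : 0 < profile N 1 := profile_pos zero_le_one le_rfl
  have h0 : ∀ s : ℝ, 0 ≤ s → 0 ≤ ∫ t in (0 : ℝ)..s, weinberger N t := fun s hs ↦
    intervalIntegral.integral_nonneg hs fun t ht ↦ (weinberger_pos ht.1).le
  rcases le_total ‖x‖ 1 with h | h
  · have := h0 (‖x‖ ^ 2) (sq_nonneg _)
    unfold potential
    nlinarith
  have hd : ∀ s : ℝ, 1 ≤ s → HasDerivAt
      (fun s ↦ (∫ t in (0 : ℝ)..s, weinberger N t) - 2 * profile N 1 * √s) 0 s := by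
    intro s hs
    have hs0 : 0 < s := by linarith
    refine ((hasDerivAt_integral_weinberger s).sub
      ((Real.hasDerivAt_sqrt hs0.ne').const_mul _)).congr_deriv ?_
    rw [weinberger_of_ge hs]
    have := Real.sqrt_pos.2 hs0
    field_simp
    ring
  have hmono : MonotoneOn
      (fun s ↦ (∫ t in (0 : ℝ)..s, weinberger N t) - 2 * profile N 1 * √s) (Ici 1) := by
    refine monotoneOn_of_deriv_nonneg (convex_Ici 1)
      (fun s hs ↦ (hd s hs).continuousAt.continuousWithinAt)
      (fun s hs ↦ (hd s (interior_subset hs)).differentiableAt.differentiableWithinAt)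
      fun s hs ↦ ?_
    rw [(hd s (interior_subset hs)).deriv]
  have h1 : (1 : ℝ) ≤ ‖x‖ ^ 2 := one_le_pow₀ h
  have := hmono self_mem_Ici h1 h1
  simp only [Real.sqrt_one, Real.sqrt_sq (norm_nonneg x)] at this
  have := h0 1 zero_le_one
  unfold potential
  linarith

lemma weinberger_smul_innerSL_single (i : Fin N) (x : E N) :
    (weinberger N (‖x‖ ^ 2) • innerSL ℝ x) (EuclideanSpace.single i 1) = trial i x := by
  simp [trial, EuclideanSpace.inner_single_right]

/-- Every finite nonzero measure has a centre with respect to Weinberger's trial functions. -/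
theorem exists_integral_trial_eq_zero [NeZero N] (μ : Measure (E N)) [IsFiniteMeasure μ]
    (hμ : μ ≠ 0) : ∃ y : E N, ∀ i, ∫ x, trial i (x - y) ∂μ = 0 := by
  set K := profile N 1 with hKdef
  have hK : 0 < K := profile_pos zero_le_one le_rfl
  -- The derivative of `F` consists of minus the integrals of the shifted trial functions, so a
  -- minimiser is a centre. Subtracting `potential N x` bounds the integrand by `K ‖y‖`, so `μ`
  -- needs no first moment.
  set F : E N → ℝ := fun y ↦ ∫ x, (potential N (x - y) - potential N x) ∂μ with hF
  have hcont : ∀ y, Continuous fun x ↦ potential N (x - y) - potential N x := fun y ↦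
    (continuous_potential.comp (continuous_id.sub continuous_const)).sub continuous_potential
  have hbd : ∀ y x, |potential N (x - y) - potential N x| ≤ K * ‖y‖ := fun y x ↦ by
    simpa using abs_potential_sub_le (x - y) x
  have hint : ∀ y, Integrable (fun x ↦ potential N (x - y) - potential N x) μ := fun y ↦
    Integrable.of_bound (hcont y).aestronglyMeasurable (K * ‖y‖) (ae_of_all _ (hbd y))
  have hderiv : ∀ y, HasFDerivAt F
      (∫ x, -(weinberger N (‖x - y‖ ^ 2) • innerSL ℝ (x - y)) ∂μ) y := by
    intro y
    refine hasFDerivAt_integral_of_dominated_of_fderiv_le (bound := fun _ ↦ K)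
      (F' := fun y x ↦ -(weinberger N (‖x - y‖ ^ 2) • innerSL ℝ (x - y)))
      (s := univ) univ_mem
      (Eventually.of_forall fun y ↦ (hcont y).aestronglyMeasurable) (hint y) ?_
      (ae_of_all _ fun x y _ ↦ ?_) (integrable_const K) (ae_of_all _ fun x y _ ↦ ?_)
    · have hc : Continuous fun x : E N ↦ x - y := continuous_id.sub continuous_const
      exact (((continuous_weinberger.comp (hc.norm.pow 2)).smul
        ((innerSL ℝ).continuous.comp hc)).neg).aestronglyMeasurable
    · rw [norm_neg]
      exact norm_weinberger_smul_le (x - y)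
    · have h1 := (hasFDerivAt_potential (x - y)).comp y ((hasFDerivAt_id y).const_sub x)
      refine (h1.sub_const (potential N x)).congr_fderiv ?_
      ext v
      simp
  have hFc : Continuous F := continuous_iff_continuousAt.2 fun y ↦ (hderiv y).continuousAt
  -- A ball carrying more than half of the mass: there the integrand grows like `K ‖y‖`, elsewhere
  -- it is at least `-K ‖y‖`, so the majority decides and `F` is coercive.
  obtain ⟨M, hM0, hM⟩ : ∃ M : ℝ, 0 ≤ M ∧ μ.real univ < 2 * μ.real (ball 0 M) := by
    have ht := tendsto_measure_iUnion_atTop (μ := μ) (s := fun n : ℕ ↦ ball (0 : E N) n)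
      (fun m n h ↦ ball_subset_ball (by exact_mod_cast h))
    rw [iUnion_ball_nat] at ht
    have ht2 := (ENNReal.tendsto_toReal (measure_ne_top μ univ)).comp ht
    have hpos : 0 < μ.real univ := by
      simpa [Measure.real, ENNReal.toReal_pos_iff, pos_iff_ne_zero] using hμ
    obtain ⟨n, hn⟩ := (ht2.eventually (lt_mem_nhds (half_lt_self hpos))).exists
    refine ⟨n, n.cast_nonneg, ?_⟩
    have : μ.real univ / 2 < μ.real (ball (0 : E N) n) := hn
    linarith
  set c := 2 * μ.real (ball 0 M) - μ.real univ with hc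
  have hc0 : 0 < c := by linarith
  have hlow : ∀ y, K * c * ‖y‖ - K * (2 * M + 1) * μ.real (ball 0 M) ≤ F y := by
    intro y
    have hpt : ∀ x, (ball (0 : E N) M).indicator
        (fun _ ↦ 2 * K * ‖y‖ - K * (2 * M + 1)) x - K * ‖y‖
          ≤ potential N (x - y) - potential N x := by
      intro x
      by_cases hx : x ∈ ball (0 : E N) M
      · rw [indicator_of_mem hx]
        have hxM : ‖x‖ ≤ M := by simpa using (mem_ball_zero_iff.1 hx).le
        have h1 := le_potential (x - y)
        have h2 := potential_le x
        have h3 : ‖y‖ - ‖x‖ ≤ ‖x - y‖ := by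
          rw [norm_sub_rev]; exact norm_sub_norm_le y x
        rw [← hKdef] at h1 h2
        nlinarith
      · rw [indicator_of_notMem hx]
        have := (abs_le.1 (hbd y x)).1
        linarith
    have hi1 : Integrable ((ball (0 : E N) M).indicator
        (fun _ ↦ 2 * K * ‖y‖ - K * (2 * M + 1))) μ :=
      (integrable_const _).indicator measurableSet_ball
    refine le_trans (le_of_eq ?_)
      (integral_mono (hi1.sub (integrable_const (K * ‖y‖))) (hint y) hpt)
    rw [integral_sub' hi1 (integrable_const _), integral_indicator_const _ measurableSet_ball,
      integral_const, smul_eq_mul, smul_eq_mul]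
    ring
  have htend : Tendsto F (cocompact (E N)) atTop := by
    refine tendsto_atTop_mono hlow ?_
    exact tendsto_atTop_add_const_right _ _
      ((tendsto_norm_cocompact_atTop (E := E N)).const_mul_atTop (mul_pos hK hc0))
  obtain ⟨y, hy⟩ := hFc.exists_forall_le htend
  refine ⟨y, fun i ↦ ?_⟩
  have hz : ∫ x, -(weinberger N (‖x - y‖ ^ 2) • innerSL ℝ (x - y)) ∂μ = 0 :=
    IsLocalMin.hasFDerivAt_eq_zero (Eventually.of_forall hy) (hderiv y)
  have hi : Integrable (fun x ↦ -(weinberger N (‖x - y‖ ^ 2) • innerSL ℝ (x - y))) μ := by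
    have hcx : Continuous fun x : E N ↦ x - y := continuous_id.sub continuous_const
    refine Integrable.of_bound (((continuous_weinberger.comp (hcx.norm.pow 2)).smul
        ((innerSL ℝ).continuous.comp hcx)).neg).aestronglyMeasurable K (ae_of_all _ fun x ↦ ?_)
    rw [norm_neg]
    exact norm_weinberger_smul_le (x - y)
  have := ContinuousLinearMap.integral_apply hi (EuclideanSpace.single i (1 : ℝ))
  rw [hz] at this
  simp only [neg_apply, weinberger_smul_innerSL_single, zero_apply, integral_neg] at this
  linarith

lemma omega_pos (N : ℕ) : 0 < omega N :=
  ENNReal.toReal_pos (measure_ball_pos volume _ zero_lt_one).ne' measure_ball_lt_top.ne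

/-- Change of variables under a homothety. -/
lemma setIntegral_preimage_homothety {F : Type*} [NormedAddCommGroup F] [NormedSpace ℝ F]
    {Ω : Set (E N)} (hΩ : MeasurableSet Ω) (f : E N → F) {R : ℝ} (hR : 0 < R) (y : E N) :
    ∫ z in (fun z ↦ R • (z + y)) ⁻¹' Ω, f z = (R ^ N)⁻¹ • ∫ x in Ω, f (R⁻¹ • x - y) := by
  have hm : Measurable fun z : E N ↦ R • (z + y) := by fun_prop
  rw [← integral_indicator (hm hΩ), ← integral_indicator hΩ]
  have h1 : ((fun z ↦ R • (z + y)) ⁻¹' Ω).indicator f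
      = fun z ↦ Ω.indicator (fun x ↦ f (R⁻¹ • x - y)) (R • (z + y)) := by
    ext z
    by_cases hz : R • (z + y) ∈ Ω
    · rw [indicator_of_mem hz, indicator_of_mem (show z ∈ (fun z ↦ R • (z + y)) ⁻¹' Ω from hz),
        smul_smul, inv_mul_cancel₀ hR.ne', one_smul, add_sub_cancel_right]
    · rw [indicator_of_notMem hz,
        indicator_of_notMem (show z ∉ (fun z ↦ R • (z + y)) ⁻¹' Ω from hz)]
  rw [h1, integral_add_right_eq_self
    (fun z ↦ Ω.indicator (fun x ↦ f (R⁻¹ • x - y)) (R • z)) y, Measure.integral_comp_smul,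
    finrank_euclideanSpace_fin, abs_of_pos (by positivity)]

lemma measureReal_preimage_homothety {Ω : Set (E N)} (hΩ : MeasurableSet Ω) {R : ℝ} (hR : 0 < R)
    (y : E N) :
    volume.real ((fun z ↦ R • (z + y)) ⁻¹' Ω) = (R ^ N)⁻¹ * volume.real Ω := by
  simpa using setIntegral_preimage_homothety hΩ (fun _ ↦ (1 : ℝ)) hR y

/-- Weinberger's bound: after rescaling and recentring, the trial functions are admissible. -/
theorem exists_centre_mu2_mul_le [NeZero N] {Ω : Set (E N)} (hΩ : IsOpen Ω) (hne : Ω.Nonempty)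
    (hfin : volume Ω ≠ ⊤) {R : ℝ} (hR : 0 < R) :
    ∃ y : E N,
      R ^ 2 * mu2 Ω * ∫ z in (fun z ↦ R • (z + y)) ⁻¹' Ω, massDensity N (‖z‖ ^ 2)
        ≤ ∫ z in (fun z ↦ R • (z + y)) ⁻¹' Ω, energyDensity N (‖z‖ ^ 2) := by
  have : IsFiniteMeasure (volume.restrict Ω) := ⟨by simpa using hfin.lt_top⟩
  have hm : Measurable fun x : E N ↦ R⁻¹ • x := by fun_prop
  have hμ : Measure.map (fun x : E N ↦ R⁻¹ • x) (volume.restrict Ω) ≠ 0 := by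
    rw [Ne, Measure.map_eq_zero_iff hm.aemeasurable, Measure.restrict_eq_zero]
    exact (hΩ.measure_pos _ hne).ne'
  obtain ⟨y, hy⟩ := exists_integral_trial_eq_zero _ hμ
  refine ⟨y, ?_⟩
  have hL : Continuous fun x : E N ↦ R⁻¹ • x - y := by fun_prop
  set G : Fin N → E N → E N := fun i x ↦
    R⁻¹ • (InnerProductSpace.toDual ℝ (E N)).symm (fderiv ℝ (trial i) (R⁻¹ • x - y)) with hG
  have hGc : ∀ i, Continuous (G i) := fun i ↦ by
    have h : Continuous fun x ↦
        (InnerProductSpace.toDual ℝ (E N)).symm (fderiv ℝ (trial i) (R⁻¹ • x - y)) :=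
      (InnerProductSpace.toDual ℝ (E N)).symm.continuous.comp
        (((contDiff_trial i).continuous_fderiv (by norm_num)).comp hL)
    exact h.const_smul R⁻¹
  have hGn : ∀ i x, ‖G i x‖ = R⁻¹ * ‖fderiv ℝ (trial i) (R⁻¹ • x - y)‖ := fun i x ↦ by
    rw [hG, norm_smul, LinearIsometryEquiv.norm_map, Real.norm_of_nonneg (by positivity)]
  have hder : ∀ i x, HasFDerivAt (fun x ↦ trial i (R⁻¹ • x - y)) (innerSL ℝ (G i x)) x := by
    intro i x
    have h1 : HasFDerivAt (trial i) (fderiv ℝ (trial i) (R⁻¹ • x - y)) (R⁻¹ • x - y) :=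
      ((contDiff_trial i).differentiable (by norm_num) _).hasFDerivAt
    have h2 := h1.comp x (((hasFDerivAt_id x).const_smul R⁻¹).sub_const y)
    refine h2.congr_fderiv ?_
    ext v
    simp [hG, InnerProductSpace.toDual_symm_apply]
  have hS : ∀ i, IsSobolev Ω (fun x ↦ trial i (R⁻¹ • x - y)) (G i) := by
    intro i
    refine isSobolev_of_hasFDerivAt hΩ hfin (C := max (profile N 1) (R⁻¹ * √(energyDensity N 0)))
      (fun x _ ↦ hder i x) (hGc i).continuousOn
      (fun x _ ↦ (abs_trial_le i _).trans (le_max_left _ _)) fun x _ ↦ ?_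
    rw [hGn]
    exact (mul_le_mul_of_nonneg_left (norm_fderiv_trial_le i _) (by positivity)).trans
      (le_max_right _ _)
  have hle : ∀ i, mu2 Ω * ∫ x in Ω, trial i (R⁻¹ • x - y) ^ 2 ≤ ∫ x in Ω, ‖G i x‖ ^ 2 := by
    intro i
    refine mu2_mul_le (hS i) ?_
    have := hy i
    rwa [integral_map hm.aemeasurable] at this
    exact ((contDiff_trial i).continuous.comp
      (continuous_id.sub continuous_const)).aestronglyMeasurable
  -- Single trial functions have non-radial densities; only after summing over the coordinates are
  -- both sides integrals of radial functions.
  have hsum := Finset.sum_le_sum fun i (_ : i ∈ Finset.univ) ↦ hle i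
  have hi1 : ∀ i, IntegrableOn (fun x ↦ trial i (R⁻¹ • x - y) ^ 2) Ω := fun i ↦
    (hS i).memLp.integrable_sq
  have hi2 : ∀ i, IntegrableOn (fun x ↦ ‖G i x‖ ^ 2) Ω := fun i ↦
    (hS i).memLp_grad.integrable_norm_pow (by norm_num)
  rw [← Finset.mul_sum, ← integral_finsetSum _ fun i _ ↦ hi1 i,
    ← integral_finsetSum _ fun i _ ↦ hi2 i] at hsum
  simp only [hGn, mul_pow, sum_trial_sq, ← Finset.mul_sum, sum_norm_fderiv_trial_sq] at hsum
  rw [integral_const_mul] at hsum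
  rw [setIntegral_preimage_homothety hΩ.measurableSet _ hR,
    setIntegral_preimage_homothety hΩ.measurableSet _ hR, smul_eq_mul, smul_eq_mul]
  calc _ = (R ^ N)⁻¹ * (R ^ 2 *
        (mu2 Ω * ∫ x in Ω, massDensity N (‖R⁻¹ • x - y‖ ^ 2))) := by ring
    _ ≤ (R ^ N)⁻¹ * (R ^ 2 *
        (R⁻¹ ^ 2 * ∫ x in Ω, energyDensity N (‖R⁻¹ • x - y‖ ^ 2))) := by gcongr
    _ = _ := by field_simp

/-! ### Quantitative comparison with the unit ball. -/

/-- Convexity of the `N`-th power between `1` and `1 + d = 2^{1/N}`. Thus the shell between radii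
`1` and `1 + d a / 2` has volume at most `a ω / 2`. -/
lemma pow_one_add_root_two_le [NeZero N] {d a : ℝ} (hd : (1 + d) ^ N = 2) (hd0 : 0 ≤ d)
    (ha : 0 ≤ a) (ha1 : a ≤ 1) : (1 + d * (a / 2)) ^ N ≤ 1 + a / 2 := by
  have h := (convexOn_pow N).2 (mem_Ici.2 zero_le_one : (1 : ℝ) ∈ Ici 0)
    (show 1 + d ∈ Ici (0 : ℝ) from add_nonneg zero_le_one hd0)
    (show 0 ≤ 1 - a / 2 by linarith) (show 0 ≤ a / 2 by linarith) (by ring)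
  simp only [smul_eq_mul, hd, one_pow] at h
  calc _ = ((1 - a / 2) * 1 + a / 2 * (1 + d)) ^ N := by ring
    _ ≤ _ := h
    _ = _ := by ring

/-- Replaces the energy drop by a bound linear in `a`. From `(1 + d a / 2)² ≥ 1 + d a` the right
side is at least `d a / (1 + d a)`, and Bernoulli's inequality gives `N d ≤ 1`. -/
lemma mul_sq_div_le_one_sub [NeZero N] {d a : ℝ} (hd : (1 + d) ^ N = 2) (hd0 : 0 ≤ d)
    (ha : 0 ≤ a) (ha1 : a ≤ 1) :
    N * d ^ 2 * a / (1 + d) ≤ 1 - ((1 + d * (a / 2)) ^ 2)⁻¹ := by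
  have hN : (N : ℝ) * d ≤ 1 := by
    have := one_add_mul_le_pow (show (-2 : ℝ) ≤ d by linarith) N
    linarith
  have hda : 0 ≤ d * a := mul_nonneg hd0 ha
  have hda1 : d * a ≤ d := by nlinarith
  have h1 : N * d ^ 2 * a / (1 + d) ≤ d * a / (1 + d * a) := by
    rw [div_le_div_iff₀ (by linarith) (by linarith)]
    have : N * d ^ 2 * a ≤ d * a := by nlinarith
    have h0 : 0 ≤ N * d ^ 2 * a := by positivity
    nlinarith
  refine h1.trans ?_
  have hpos : (0 : ℝ) < (1 + d * (a / 2)) ^ 2 := by positivity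
  rw [inv_eq_one_div, one_sub_div hpos.ne', div_le_div_iff₀ (by linarith) hpos]
  have : 0 ≤ d * a * (d * a) := mul_nonneg hda hda
  nlinarith [mul_nonneg this hda]

lemma integrableOn_massDensity [NeZero N] {U : Set (E N)} (hU : volume U ≠ ⊤) :
    IntegrableOn (fun x ↦ massDensity N (‖x‖ ^ 2)) U := by
  have : IsFiniteMeasure (volume.restrict U) := ⟨by simpa using hU.lt_top⟩
  refine Integrable.of_bound
    (continuous_massDensity.comp (continuous_norm.pow 2)).aestronglyMeasurable (profile N 1 ^ 2)
    (ae_of_all _ fun x ↦ ?_)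
  rw [Real.norm_of_nonneg (massDensity_nonneg (sq_nonneg _))]
  exact massDensity_le (sq_nonneg _)

lemma integrableOn_energyDensity [NeZero N] {U : Set (E N)} (hU : volume U ≠ ⊤) :
    IntegrableOn (fun x ↦ energyDensity N (‖x‖ ^ 2)) U := by
  have : IsFiniteMeasure (volume.restrict U) := ⟨by simpa using hU.lt_top⟩
  refine Integrable.of_bound
    (continuous_energyDensity.comp (continuous_norm.pow 2)).aestronglyMeasurable
    (energyDensity N 0) (ae_of_all _ fun x ↦ ?_)
  rw [Real.norm_of_nonneg (energyDensity_nonneg _)]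
  exact energyDensity_le (sq_nonneg _)

lemma sq_le_one_of_mem_ball {x : E N} (hx : x ∈ ball (0 : E N) 1) : ‖x‖ ^ 2 ≤ 1 :=
  pow_le_one₀ (norm_nonneg x) (mem_ball_zero_iff.1 hx).le

lemma one_le_sq_of_notMem_ball {x : E N} (hx : x ∉ ball (0 : E N) 1) : 1 ≤ ‖x‖ ^ 2 :=
  one_le_pow₀ (by simpa using hx)

/-- The sets `ball \ U` and `U \ ball` have equal measure, and on the second the density takes its
maximal value. -/
lemma integral_massDensity_ball_le [NeZero N] {U : Set (E N)} (hU : MeasurableSet U)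
    (hvol : volume U = volume (ball (0 : E N) 1)) :
    ∫ x in ball (0 : E N) 1, massDensity N (‖x‖ ^ 2) ≤ ∫ x in U, massDensity N (‖x‖ ^ 2) := by
  have hB := measure_ball_lt_top (μ := volume) (x := (0 : E N)) (r := 1) |>.ne
  have hUf : volume U ≠ ⊤ := hvol ▸ hB
  rw [← integral_inter_add_sdiff hU (integrableOn_massDensity hB),
    ← integral_inter_add_sdiff measurableSet_ball (integrableOn_massDensity hUf), inter_comm]
  refine add_le_add le_rfl ?_
  have hBU : volume (ball 0 1 \ U) ≠ ⊤ := measure_ne_top_of_subset sdiff_subset hB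
  have hUB : volume (U \ ball 0 1) ≠ ⊤ := measure_ne_top_of_subset sdiff_subset hUf
  calc _ ≤ ∫ x in ball 0 1 \ U, profile N 1 ^ 2 :=
        setIntegral_mono (integrableOn_massDensity hBU) (integrableOn_const hBU)
          fun x ↦ massDensity_le (sq_nonneg _)
    _ = ∫ x in U \ ball 0 1, profile N 1 ^ 2 := by
        rw [setIntegral_const, setIntegral_const, measureReal_def, measureReal_def,
          measure_sdiff_symm measurableSet_ball.nullMeasurableSet hU.nullMeasurableSet hvol.symm
            (measure_ne_top_of_subset inter_subset_left hB)]
    _ = _ := setIntegral_congr_fun (hU.diff measurableSet_ball) fun x hx ↦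
        (massDensity_of_ge (one_le_sq_of_notMem_ball hx.2)).symm

/-- Transplanting mass out of the unit ball lowers the energy by a definite amount. -/
lemma integral_energyDensity_le [NeZero N] {U : Set (E N)} (hU : MeasurableSet U)
    (hvol : volume U = volume (ball (0 : E N) 1)) {d a : ℝ} (hd : (1 + d) ^ N = 2) (hd0 : 0 ≤ d)
    (ha : 0 ≤ a) (ha1 : a ≤ 1) (hm : volume.real (U \ ball 0 1) = a * omega N) :
    (∫ x in U, energyDensity N (‖x‖ ^ 2)) + ((N : ℝ) - 1) * profile N 1 ^ 2 *
        (N * d ^ 2 * a / (1 + d)) * (a * omega N / 2)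
      ≤ ∫ x in ball (0 : E N) 1, energyDensity N (‖x‖ ^ 2) := by
  have hB := measure_ball_lt_top (μ := volume) (x := (0 : E N)) (r := 1) |>.ne
  have hUf : volume U ≠ ⊤ := hvol ▸ hB
  have hBU : volume (ball 0 1 \ U) ≠ ⊤ := measure_ne_top_of_subset sdiff_subset hB
  have hUB : volume (U \ ball 0 1) ≠ ⊤ := measure_ne_top_of_subset sdiff_subset hUf
  have hm' : volume.real (ball 0 1 \ U) = a * omega N := by
    rw [← hm, measureReal_def, measureReal_def,
      measure_sdiff_symm measurableSet_ball.nullMeasurableSet hU.nullMeasurableSet hvol.symm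
        (measure_ne_top_of_subset inter_subset_left hB)]
  set K := ((N : ℝ) - 1) * profile N 1 ^ 2 with hK
  have hK0 : 0 ≤ K := mul_nonneg (sub_nonneg.2 one_le_cast_of_neZero) (sq_nonneg _)
  -- The shell up to radius `t` can hold at most half of the part of `U` outside the unit ball; the
  -- other half has energy density at most `K / t²` instead of `K`.
  set t := 1 + d * (a / 2) with ht
  have ht1 : 1 ≤ t := by
    have : 0 ≤ d * (a / 2) := by positivity
    linarith
  have ht0 : 0 < t := by linarith
  set φ := 1 - (t ^ 2)⁻¹ with hφ
  have hφle : N * d ^ 2 * a / (1 + d) ≤ φ := mul_sq_div_le_one_sub hd hd0 ha ha1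
  have hφ0 : 0 ≤ φ := by rw [hφ, sub_nonneg]; exact inv_le_one_of_one_le₀ (one_le_pow₀ ht1)
  have hlow : K * (a * omega N) ≤ ∫ x in ball 0 1 \ U, energyDensity N (‖x‖ ^ 2) := by
    calc K * (a * omega N) = ∫ x in ball 0 1 \ U, K := by
          rw [setIntegral_const, hm', smul_eq_mul, mul_comm]
      _ ≤ _ := setIntegral_mono_on (integrableOn_const hBU) (integrableOn_energyDensity hBU)
          (measurableSet_ball.diff hU) fun x hx ↦
            le_energyDensity (sq_nonneg _) (sq_le_one_of_mem_ball hx.1)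
  have hball : volume.real (ball (0 : E N) t \ ball 0 1) ≤ a * omega N / 2 := by
    rw [measureReal_sdiff (ball_subset_ball ht1) measurableSet_ball
      (measure_ball_lt_top (μ := volume)).ne, measureReal_def,
      Measure.addHaar_ball _ _ ht0.le, ENNReal.toReal_mul, ENNReal.toReal_ofReal (by positivity),
      ← measureReal_def, ← omega, finrank_euclideanSpace_fin]
    have := pow_one_add_root_two_le hd hd0 ha ha1
    have := mul_le_mul_of_nonneg_right this (omega_pos N).le
    linarith
  have hfar : a * omega N / 2 ≤ volume.real ((U \ ball 0 1) \ ball 0 t) := by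
    have h1 := measureReal_inter_add_sdiff (μ := volume) (s := U \ ball 0 1)
      (measurableSet_ball (x := (0 : E N)) (ε := t)) hUB
    have h2 : volume.real ((U \ ball 0 1) ∩ ball 0 t) ≤ volume.real (ball (0 : E N) t \ ball 0 1) :=
      measureReal_mono (fun x hx ↦ ⟨hx.2, hx.1.2⟩)
        (measure_ne_top_of_subset sdiff_subset (measure_ball_lt_top (μ := volume)).ne)
    linarith
  have hup : ∫ x in U \ ball 0 1, energyDensity N (‖x‖ ^ 2)
      ≤ K * (a * omega N) - K * φ * (a * omega N / 2) := by
    have hms : MeasurableSet (U \ ball (0 : E N) 1) := hU.diff measurableSet_ball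
    have hi : IntegrableOn ((ball (0 : E N) t)ᶜ.indicator fun _ ↦ K * φ) (U \ ball 0 1) :=
      (integrableOn_const hUB).indicator measurableSet_ball.compl
    have hic : IntegrableOn (fun _ : E N ↦ K) (U \ ball 0 1) := integrableOn_const hUB
    calc _ ≤ ∫ x in U \ ball 0 1, (K - (ball (0 : E N) t)ᶜ.indicator (fun _ ↦ K * φ) x) := by
          refine setIntegral_mono_on (integrableOn_energyDensity hUB) (hic.sub hi) hms
            fun x hx ↦ ?_
          have hx1 := one_le_sq_of_notMem_ball hx.2
          rw [energyDensity_of_ge hx1, ← hK]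
          by_cases hxt : x ∈ ball (0 : E N) t
          · rw [indicator_of_notMem (notMem_compl_iff.2 hxt), sub_zero]
            exact mul_le_of_le_one_right hK0 (inv_le_one_of_one_le₀ hx1)
          · rw [indicator_of_mem hxt]
            have hxn : t ≤ ‖x‖ := by simpa using hxt
            have : (‖x‖ ^ 2)⁻¹ ≤ (t ^ 2)⁻¹ := by gcongr
            have := mul_le_mul_of_nonneg_left this hK0
            rw [hφ]
            linarith
      _ = K * (a * omega N) - K * φ * volume.real ((U \ ball 0 1) \ ball 0 t) := by
          rw [integral_sub hic hi, setIntegral_const, hm,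
            setIntegral_indicator measurableSet_ball.compl, setIntegral_const,
            ← Set.sdiff_eq, smul_eq_mul, smul_eq_mul]
          ring
      _ ≤ _ := by
          have := mul_le_mul_of_nonneg_left hfar (mul_nonneg hK0 hφ0)
          linarith
  have hlast : K * (N * d ^ 2 * a / (1 + d)) * (a * omega N / 2) ≤ K * φ * (a * omega N / 2) := by
    have := (omega_pos N).le
    gcongr
  rw [← integral_inter_add_sdiff hU (integrableOn_energyDensity hB),
    ← integral_inter_add_sdiff (measurableSet_ball (x := (0 : E N)) (ε := 1))
      (integrableOn_energyDensity hUf), inter_comm]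
  linarith

/-! ### The explicit constant, the asymmetry, and the conclusion. -/

/-- The denominator of the explicit constant, up to normalization. -/
noncomputable def profileMass (N : ℕ) : ℝ :=
  ∫ s in (0 : ℝ)..1, s ^ (N + 1) * profile N (s ^ 2) ^ 2

lemma integral_massDensity_ball [NeZero N] :
    ∫ x in ball (0 : E N) 1, massDensity N (‖x‖ ^ 2) = N * omega N * profileMass N := by
  have h := integral_fun_norm_addHaar (volume : Measure (E N))
    ((Iio 1).indicator fun s ↦ massDensity N (s ^ 2))
  have e1 : (fun x : E N ↦ (Iio 1).indicator (fun s ↦ massDensity N (s ^ 2)) ‖x‖)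
      = (ball (0 : E N) 1).indicator fun x ↦ massDensity N (‖x‖ ^ 2) := by
    ext x
    simp only [indicator, mem_Iio, mem_ball_zero_iff]
  have e2 : (fun s : ℝ ↦ s ^ (N - 1) • (Iio 1).indicator (fun s ↦ massDensity N (s ^ 2)) s)
      = (Iio 1).indicator fun s ↦ s ^ (N - 1) * massDensity N (s ^ 2) := by
    ext s
    by_cases hs : s ∈ Iio (1 : ℝ)
    · simp [indicator_of_mem hs]
    · simp [indicator_of_notMem hs]
  rw [e1, finrank_euclideanSpace_fin, e2, integral_indicator measurableSet_ball,
    setIntegral_indicator measurableSet_Iio, Ioi_inter_Iio, ← integral_Ioc_eq_integral_Ioo,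
    ← intervalIntegral.integral_of_le zero_le_one, ← omega, smul_eq_mul, nsmul_eq_mul] at h
  rw [h, profileMass, mul_assoc]
  congr 2
  refine intervalIntegral.integral_congr fun s hs ↦ ?_
  rw [uIcc_of_le zero_le_one] at hs
  have hN : N + 1 = N - 1 + 2 := by have := NeZero.one_le (n := N); omega
  simp only [massDensity, weinberger_of_le (pow_le_one₀ hs.1 hs.2 : s ^ 2 ≤ 1)]
  rw [hN, pow_add]
  ring

lemma profileMass_pos [NeZero N] : 0 < profileMass N := by
  have hc : Continuous (profile N) := (contDiff_profile N (n := 1)).continuous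
  refine intervalIntegral.intervalIntegral_pos_of_pos_on
    (Continuous.intervalIntegrable (by fun_prop) _ _) (fun s hs ↦ ?_) zero_lt_one
  have := profile_pos (N := N) (sq_nonneg s) (pow_le_one₀ hs.1.le hs.2.le)
  have := hs.1
  positivity

/-- The Bessel factors at `β` and under the integral share the power `(β / 2)^N`, which cancels. -/
lemma rho_eq [NeZero N] : rho N = ((N : ℝ) - 1) *
    (((2 : ℝ) ^ (1 / (N : ℝ)) - 1) ^ 2 / (8 * (2 : ℝ) ^ (1 / (N : ℝ)))) *
    (omega N ^ (2 / (N : ℝ)) * profile N 1 ^ 2 / profileMass N) := by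
  have hβ := besselBeta_pos N
  have hsq : ∀ s : ℝ, 0 < s → (s ^ ((N : ℝ) / 2)) ^ 2 = s ^ N := fun s hs ↦ by
    rw [← Real.rpow_natCast, ← Real.rpow_mul hs.le, Nat.cast_ofNat, div_mul_cancel₀ _ two_ne_zero,
      Real.rpow_natCast]
  have h1 : besselJ ((N : ℝ) / 2) (besselBeta N) ^ 2
      = (besselBeta N / 2) ^ N * profile N 1 ^ 2 := by
    have := besselJ_besselBeta_mul (N := N) zero_lt_one
    rw [mul_one, Real.one_rpow, mul_one, one_pow] at this
    rw [this, mul_pow, hsq _ (by positivity)]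
  have h2 : ∫ s in (0 : ℝ)..1, besselJ ((N : ℝ) / 2) (besselBeta N * s) ^ 2 * s
      = (besselBeta N / 2) ^ N * profileMass N := by
    rw [profileMass, ← intervalIntegral.integral_const_mul]
    refine intervalIntegral.integral_congr_ae (ae_of_all _ fun s hs ↦ ?_)
    rw [uIoc_of_le zero_le_one] at hs
    rw [besselJ_besselBeta_mul hs.1, mul_pow, mul_pow, hsq _ (by positivity), hsq _ hs.1]
    ring
  rw [rho, h1, h2, mul_left_comm, mul_div_mul_left _ _ (by positivity)]

lemma exists_measureReal_eq_pow_mul_omega [NeZero N] {Ω : Set (E N)} (hΩ : IsOpen Ω)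
    (hne : Ω.Nonempty) (hfin : volume Ω ≠ ⊤) :
    ∃ R : ℝ, 0 < R ∧ volume.real Ω = R ^ N * omega N := by
  have hpos : 0 < volume.real Ω := ENNReal.toReal_pos (hΩ.measure_pos _ hne).ne' hfin
  have hω := omega_pos N
  refine ⟨(volume.real Ω / omega N) ^ (N : ℝ)⁻¹, by positivity, ?_⟩
  rw [Real.rpow_inv_natCast_pow (by positivity) (NeZero.ne N), div_mul_cancel₀ _ hω.ne']

lemma volume_preimage_homothety_eq {Ω : Set (E N)} (hΩ : MeasurableSet Ω) {R : ℝ} (hR : 0 < R)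
    (h : volume.real Ω = R ^ N * omega N) (y : E N) :
    volume ((fun z ↦ R • (z + y)) ⁻¹' Ω) = volume (ball (0 : E N) 1) := by
  have hr := measureReal_preimage_homothety hΩ hR y
  rw [h, inv_mul_cancel_left₀ (by positivity)] at hr
  have hf : volume ((fun z ↦ R • (z + y)) ⁻¹' Ω) ≠ ⊤ := fun ht ↦ by
    rw [measureReal_def, ht, ENNReal.toReal_top] at hr
    exact (omega_pos N).ne hr
  exact (ENNReal.toReal_eq_toReal_iff' hf (measure_ball_lt_top (μ := volume)).ne).1 hr

lemma measureReal_ball_eq [NeZero N] (x : E N) {r : ℝ} (hr : 0 < r) :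
    volume.real (ball x r) = r ^ N * omega N := by
  rw [measureReal_def, Measure.addHaar_ball _ _ hr.le, ENNReal.toReal_mul,
    ENNReal.toReal_ofReal (by positivity), finrank_euclideanSpace_fin, omega, measureReal_def]

lemma asymmetry_nonneg (Ω : Set (E N)) : 0 ≤ asymmetry Ω := by
  refine Real.sInf_nonneg ?_
  rintro _ ⟨x, r, -, -, rfl⟩
  positivity

lemma asymmetry_le {Ω : Set (E N)} {x : E N} {r : ℝ} (hr : 0 < r)
    (h : volume (ball x r) = volume Ω) :
    asymmetry Ω ≤ volume.real (symmDiff Ω (ball x r)) / volume.real Ω := by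
  refine csInf_le ⟨0, ?_⟩ ⟨x, r, hr, h, rfl⟩
  rintro _ ⟨x, r, -, -, rfl⟩
  positivity

/-- The asymmetry is controlled by the mass outside a competing ball. -/
lemma asymmetry_le_two_mul [NeZero N] {Ω : Set (E N)} (hΩ : MeasurableSet Ω)
    (hfin : volume Ω ≠ ⊤) {R : ℝ} (hR : 0 < R) (h : volume.real Ω = R ^ N * omega N) (y : E N) :
    asymmetry Ω
      ≤ 2 * (volume.real (((fun z ↦ R • (z + y)) ⁻¹' Ω) \ ball 0 1) / omega N) := by
  have hω := omega_pos N
  have hballf : volume (ball (R • y) R) ≠ ⊤ := (measure_ball_lt_top (μ := volume)).ne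
  have hball : volume (ball (R • y) R) = volume Ω := by
    refine (ENNReal.toReal_eq_toReal_iff' hballf hfin).1 ?_
    exact (measureReal_ball_eq _ hR).trans h.symm
  refine (asymmetry_le hR hball).trans (le_of_eq ?_)
  have hpre : (fun z ↦ R • (z + y)) ⁻¹' (ball (R • y) R) = ball (0 : E N) 1 := by
    ext z
    rw [mem_preimage, mem_ball_iff_norm, ← smul_sub, add_sub_cancel_right, norm_smul,
      Real.norm_of_nonneg hR.le, mem_ball_zero_iff, mul_lt_iff_lt_one_right hR]
  rw [measureReal_symmDiff_eq hΩ measurableSet_ball hfin hballf, measureReal_def (s := _ \ Ω),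
    measure_sdiff_symm measurableSet_ball.nullMeasurableSet hΩ.nullMeasurableSet hball
      (measure_ne_top_of_subset inter_subset_left hballf), ← measureReal_def, ← two_mul,
    mul_div_assoc, ← hpre, ← preimage_sdiff,
    measureReal_preimage_homothety (hΩ.diff measurableSet_ball) hR, h]
  field_simp

lemma rpow_two_div_natCast [NeZero N] {R : ℝ} (hR : 0 < R) :
    (R ^ N * omega N) ^ (2 / (N : ℝ)) = omega N ^ (2 / (N : ℝ)) * R ^ 2 := by
  have hN : (N : ℝ) ≠ 0 := NeZero.ne _
  rw [Real.mul_rpow (by positivity) (omega_pos N).le, ← Real.rpow_natCast R N,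
    ← Real.rpow_mul hR.le, mul_div_cancel₀ _ hN, mul_comm]
  norm_num

lemma le_measureReal_rpow_mul_mu2_ball [NeZero N] (x₀ : E N) {r : ℝ} (hr : 0 < r) :
    omega N ^ (2 / (N : ℝ)) * besselBeta N ^ 2
      ≤ volume.real (ball x₀ r) ^ (2 / (N : ℝ)) * mu2 (ball x₀ r) := by
  rw [measureReal_ball_eq _ hr, rpow_two_div_natCast hr]
  have hω := omega_pos N
  calc _ = omega N ^ (2 / (N : ℝ)) * r ^ 2 * (besselBeta N ^ 2 / r ^ 2) := by field_simp
    _ ≤ _ := by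
      gcongr
      exact le_mu2_ball x₀ hr

/-- The quantitative Szegő–Weinberger inequality. -/
theorem rho_mul_asymmetry_sq_le [NeZero N] {Ω : Set (E N)} (hΩ : IsOpen Ω) (hne : Ω.Nonempty)
    (hfin : volume Ω ≠ ⊤) (x₀ : E N) {r : ℝ} (hr : 0 < r) :
    rho N * asymmetry Ω ^ 2 ≤ volume.real (ball x₀ r) ^ (2 / (N : ℝ)) * mu2 (ball x₀ r)
      - volume.real Ω ^ (2 / (N : ℝ)) * mu2 Ω := by
  obtain ⟨R, hR, hvol⟩ := exists_measureReal_eq_pow_mul_omega hΩ hne hfin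
  obtain ⟨y, hy⟩ := exists_centre_mu2_mul_le hΩ hne hfin hR
  set U := (fun z ↦ R • (z + y)) ⁻¹' Ω with hU
  have hUm : MeasurableSet U := (by fun_prop : Measurable fun z ↦ R • (z + y)) hΩ.measurableSet
  have hUv : volume U = volume (ball (0 : E N) 1) :=
    volume_preimage_homothety_eq hΩ.measurableSet hR hvol y
  have hω := omega_pos N
  have hJ := profileMass_pos (N := N)
  have hN1 : (1 : ℝ) ≤ N := one_le_cast_of_neZero
  set q : ℝ := (2 : ℝ) ^ (1 / (N : ℝ)) with hq
  have hqN : (1 + (q - 1)) ^ N = 2 := by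
    rw [add_sub_cancel, hq, one_div, Real.rpow_inv_natCast_pow zero_le_two (NeZero.ne N)]
  have hq1 : 1 ≤ q := Real.one_le_rpow one_le_two (by positivity)
  have hq0 : 0 < q := by linarith
  set a := volume.real (U \ ball 0 1) / omega N with ha
  have ha0 : 0 ≤ a := by positivity
  have ha1 : a ≤ 1 := by
    rw [ha, div_le_one hω, omega, measureReal_def, measureReal_def, ← hUv]
    exact ENNReal.toReal_mono (hUv ▸ (measure_ball_lt_top (μ := volume)).ne)
      (measure_mono sdiff_subset)
  have hT : 0 ≤ R ^ 2 * mu2 Ω := mul_nonneg (sq_nonneg _) (mu2_nonneg Ω)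
  have hen := integral_energyDensity_le hUm hUv hqN (by linarith) ha0 ha1
    (div_mul_cancel₀ _ hω.ne').symm
  have hma := mul_le_mul_of_nonneg_left (integral_massDensity_ball_le hUm hUv) hT
  rw [integral_energyDensity_ball, integral_massDensity_ball, add_sub_cancel] at hen
  rw [integral_massDensity_ball] at hma
  -- Weinberger's bound gives `R² μ₂(Ω)` times the mass of `U`, hence of the ball, at most the
  -- energy of `U`. That energy is at most `β²` times the mass of the ball minus the gain.
  have hmain : ((N : ℝ) - 1) * profile N 1 ^ 2 * (q - 1) ^ 2 * a ^ 2 / (2 * q * profileMass N)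
      ≤ besselBeta N ^ 2 - R ^ 2 * mu2 Ω := by
    rw [div_le_iff₀ (by positivity)]
    have h1 : ((N : ℝ) - 1) * profile N 1 ^ 2 * (N * (q - 1) ^ 2 * a / q) * (a * omega N / 2)
        = N * omega N / (2 * q) *
          (((N : ℝ) - 1) * profile N 1 ^ 2 * (q - 1) ^ 2 * a ^ 2) := by
      field_simp
    have h2 : (besselBeta N ^ 2 - R ^ 2 * mu2 Ω) * (N * omega N * profileMass N)
        = N * omega N / (2 * q) *
          ((besselBeta N ^ 2 - R ^ 2 * mu2 Ω) * (2 * q * profileMass N)) := by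
      field_simp
    have h3 : 0 < N * omega N / (2 * q) := by positivity
    refine le_of_mul_le_mul_left ?_ h3
    rw [← h1, ← h2]
    linarith
  have hA := asymmetry_le_two_mul hΩ.measurableSet hfin hR hvol y
  have hA2 : asymmetry Ω ^ 2 ≤ (2 * a) ^ 2 := pow_le_pow_left₀ (asymmetry_nonneg Ω) hA 2
  have hρ0 : 0 ≤ rho N := by
    rw [rho_eq]
    have : (0 : ℝ) ≤ N - 1 := by linarith
    positivity
  have hball := le_measureReal_rpow_mul_mu2_ball x₀ hr
  -- The `8` in `rho` is the `2` of the gain in `hmain` times the `4` from squaring the asymmetry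
  -- bound `2 a`.
  have hρ : rho N * (2 * a) ^ 2 = omega N ^ (2 / (N : ℝ)) *
      (((N : ℝ) - 1) * profile N 1 ^ 2 * (q - 1) ^ 2 * a ^ 2 / (2 * q * profileMass N)) := by
    rw [rho_eq]
    field_simp
    ring
  calc rho N * asymmetry Ω ^ 2 ≤ rho N * (2 * a) ^ 2 := by gcongr
    _ ≤ omega N ^ (2 / (N : ℝ)) * (besselBeta N ^ 2 - R ^ 2 * mu2 Ω) := by
      rw [hρ]
      gcongr
    _ ≤ _ := by
      rw [hvol, rpow_two_div_natCast hR]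
      linarith

lemma rho_pos (hN : 2 ≤ N) : 0 < rho N := by
  have : NeZero N := ⟨by omega⟩
  rw [rho_eq]
  have hω := omega_pos N
  have hJ := profileMass_pos (N := N)
  have hK : 0 < profile N 1 := profile_pos zero_le_one le_rfl
  have h1 : (0 : ℝ) < N - 1 := by
    have : (2 : ℝ) ≤ N := by exact_mod_cast hN
    linarith
  have h2 : (0 : ℝ) < 2 ^ (1 / (N : ℝ)) - 1 :=
    sub_pos.2 (Real.one_lt_rpow one_lt_two (by positivity))
  positivity

/-! ### Dimension one. -/

lemma asymmetry_le_two [NeZero N] {Ω : Set (E N)} (hΩ : IsOpen Ω) (hne : Ω.Nonempty)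
    (hfin : volume Ω ≠ ⊤) : asymmetry Ω ≤ 2 := by
  obtain ⟨R, hR, hvol⟩ := exists_measureReal_eq_pow_mul_omega hΩ hne hfin
  have hA := asymmetry_le_two_mul hΩ.measurableSet hfin hR hvol 0
  have hv := volume_preimage_homothety_eq hΩ.measurableSet hR hvol 0
  refine hA.trans ?_
  have : volume.real (((fun z : E N ↦ R • (z + 0)) ⁻¹' Ω) \ ball 0 1) / omega N ≤ 1 := by
    rw [div_le_one (omega_pos N), omega, measureReal_def, measureReal_def, ← hv]
    exact ENNReal.toReal_mono (hv ▸ (measure_ball_lt_top (μ := volume)).ne)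
      (measure_mono sdiff_subset)
  linarith

lemma _root_.IsConnected.exists_eq_Ioo {s : Set ℝ} (hs : IsConnected s) (ho : IsOpen s)
    (hfin : volume s ≠ ⊤) : ∃ a b, a < b ∧ s = Ioo a b := by
  obtain ⟨c, hc⟩ := hs.nonempty
  have hord := hs.isPreconnected.ordConnected
  have hab : BddAbove s := by
    by_contra hb
    refine hfin (measure_mono_top (s₁ := Ici c) (fun x hx ↦ ?_) Real.volume_Ici)
    obtain ⟨z, hz, hxz⟩ := not_bddAbove_iff.1 hb x
    exact hord.out hc hz ⟨hx, hxz.le⟩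
  have hbb : BddBelow s := by
    by_contra hb
    refine hfin (measure_mono_top (s₁ := Iic c) (fun x hx ↦ ?_) Real.volume_Iic)
    obtain ⟨z, hz, hxz⟩ := not_bddBelow_iff.1 hb x
    exact hord.out hz hc ⟨hxz.le, hx⟩
  have hsub : s ⊆ Ioo (sInf s) (sSup s) := by
    rw [← interior_Icc]
    exact interior_maximal (subset_Icc_csInf_csSup hbb hab) ho
  exact ⟨sInf s, sSup s, (hsub hc).1.trans (hsub hc).2,
    hsub.antisymm (hs.Ioo_csInf_csSup_subset hbb hab)⟩

/-- The line, as a one-dimensional Euclidean space. -/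
noncomputable def lineEquiv : ℝ ≃ₗᵢ[ℝ] E 1 where
  toFun t := EuclideanSpace.single 0 t
  invFun x := x 0
  map_add' s t := by ext i; simp [Subsingleton.elim i 0]
  map_smul' c t := by ext i; simp [Subsingleton.elim i 0]
  left_inv t := by simp
  right_inv x := by ext i; simp [Subsingleton.elim i 0]
  norm_map' t := by simp

lemma exists_eq_ball_of_isPreconnected {Ω : Set (E 1)} (hΩ : IsOpen Ω) (hne : Ω.Nonempty)
    (hfin : volume Ω ≠ ⊤) (hc : IsPreconnected Ω) : ∃ x r, 0 < r ∧ Ω = ball x r := by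
  have hv : volume (lineEquiv ⁻¹' Ω) = volume Ω :=
    lineEquiv.measurePreserving.measure_preimage hΩ.measurableSet.nullMeasurableSet
  have hconn : IsConnected (lineEquiv ⁻¹' Ω) :=
    (lineEquiv.toHomeomorph.isConnected_preimage).2 ⟨hne, hc⟩
  obtain ⟨a, b, hab, h⟩ := hconn.exists_eq_Ioo (hΩ.preimage lineEquiv.continuous)
    (hv.trans_ne hfin)
  refine ⟨lineEquiv ((a + b) / 2), (b - a) / 2, by linarith, ?_⟩
  rw [← lineEquiv.image_ball, ← Real.Ioo_eq_ball, ← h,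
    image_preimage_eq _ lineEquiv.surjective]

/-- In dimension one, disconnected sets have vanishing eigenvalue and connected ones are balls. -/
lemma one_dimensional_bound {Ω : Set (E 1)} (hΩ : IsOpen Ω) (hne : Ω.Nonempty)
    (hfin : volume Ω ≠ ⊤) (x₀ : E 1) {r : ℝ} (hr : 0 < r) :
    omega 1 ^ (2 / ((1 : ℕ) : ℝ)) * besselBeta 1 ^ 2 / 4 * asymmetry Ω ^ 2
      ≤ volume.real (ball x₀ r) ^ (2 / ((1 : ℕ) : ℝ)) * mu2 (ball x₀ r)
        - volume.real Ω ^ (2 / ((1 : ℕ) : ℝ)) * mu2 Ω := by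
  by_cases hc : IsPreconnected Ω
  · obtain ⟨x, s, hs, h⟩ := exists_eq_ball_of_isPreconnected hΩ hne hfin hc
    have hA : asymmetry Ω = 0 := by
      refine le_antisymm ?_ (asymmetry_nonneg Ω)
      refine (asymmetry_le hs (congrArg volume h.symm)).trans ?_
      simp [h]
    -- With zero asymmetry the general bound still gives the plain Szegő–Weinberger inequality,
    -- which is all that is needed here.
    have := rho_mul_asymmetry_sq_le hΩ hne hfin x₀ hr
    rw [hA] at this ⊢
    linarith
  · rw [mu2_eq_zero_of_not_isPreconnected hΩ hfin hc, mul_zero, sub_zero]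
    refine le_trans ?_ (le_measureReal_rpow_mul_mu2_ball x₀ hr)
    have h0 : 0 ≤ omega 1 ^ (2 / ((1 : ℕ) : ℝ)) * besselBeta 1 ^ 2 :=
      mul_nonneg (Real.rpow_nonneg (omega_pos 1).le _) (sq_nonneg _)
    have h1 : asymmetry Ω ^ 2 ≤ 2 ^ 2 :=
      pow_le_pow_left₀ (asymmetry_nonneg Ω) (asymmetry_le_two hΩ hne hfin) 2
    nlinarith

end SzegoWeinberger

theorem mainTheorem2 (N : ℕ) (hN : 1 ≤ N) :
    ∃ ρ : ℝ, 0 < ρ ∧ (2 ≤ N → ρ = SzegoWeinberger.rho N) ∧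
      ∀ Ω : Set (EuclideanSpace ℝ (Fin N)), IsOpen Ω → Ω.Nonempty → volume Ω ≠ ⊤ →
        ∀ (x₀ : EuclideanSpace ℝ (Fin N)) (r : ℝ), 0 < r →
          volume.real (Metric.ball x₀ r) ^ (2 / (N : ℝ)) *
                SzegoWeinberger.mu2 (Metric.ball x₀ r)
              - volume.real Ω ^ (2 / (N : ℝ)) * SzegoWeinberger.mu2 Ω
            ≥ ρ * SzegoWeinberger.asymmetry Ω ^ 2 := by
  have : NeZero N := ⟨by omega⟩
  rcases hN.eq_or_lt with rfl | h
  -- Here `rho` vanishes through its factor `N - 1`. The replacement is the lower bound for the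
  -- ball's scaled eigenvalue divided by `4`, the largest value allowed for the squared asymmetry.
  · refine ⟨SzegoWeinberger.omega 1 ^ (2 / ((1 : ℕ) : ℝ)) * SzegoWeinberger.besselBeta 1 ^ 2 / 4,
      ?_, fun h ↦ absurd h (by norm_num), fun Ω hΩ hne hfin x₀ r hr ↦
        SzegoWeinberger.one_dimensional_bound hΩ hne hfin x₀ hr⟩
    have := SzegoWeinberger.omega_pos 1
    have := SzegoWeinberger.besselBeta_pos 1
    positivity
  · exact ⟨SzegoWeinberger.rho N, SzegoWeinberger.rho_pos h, fun _ ↦ rfl,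
      fun Ω hΩ hne hfin x₀ r hr ↦ SzegoWeinberger.rho_mul_asymmetry_sq_le hΩ hne hfin x₀ hr⟩
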